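/- Let $d>0$ be a squarefree integer, let $F=\mathbb{Q}(\sqrt d)$, and suppose that the ring of integers $\mathfrak{o}$ of $F$ is a principal ideal domain. Fix an embedding $F\subset\mathbb{R}$. Let $L$ be an $\mathfrak{o}$-lattice with an $F$-valued symmetric bilinear form $x\cdot y$ (write $x^2=x\cdot x$) of signature $(2,1)$ that is arithmetic, i.e. its conjugate under every nontrivial element of $\mathrm{Gal}(F/\mathbb{Q})$ is definite. A root of $L$ is a primitive vector $r\in L$ with $r^2>0$ and $r\cdot v\in\frac{r^2}{2}\mathfrak{o}$ for all $v\in L$. Let $\mathrm{Aut}(L)$ be the group of isometries of $L$ that preserve a fixed future cone $\mathfrak{C}^+$ (one of the two components of $\{x\in L\otimes_{\mathfrak{o}}\mathbb{R}: x^2<0\}$). The lattice $L$ is reflective if finitely many reflections in roots of $L$ generate a subgroup of finite index in $\mathrm{Aut}(L)$. A fundamental chamber of $L$ is one of the closed cells into which the hyperbolic plane $\mathfrak{C}^+/\mathbb{R}_{>0}$ is divided by the lines $r^\perp$, $r$ a root of $L$. 1. If $d>27935$, or if $d\equiv 2$ or $3 \pmod 4$ and $d>6983$, then $L$ is not reflective;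 that is, there are no reflective arithmetic lattices of signature $(2,1)$ with ground field $F$. 2. If $d>1296$, or if $d\equiv 2$ or $3\pmod 4$ and $d>324$, and if $L$ is reflective, then no fundamental chamber of $L$ has a short pair or a close pair. Here an edge of a hyperbolic polygon $P$ is called short if the angle bisectors of $P$ (the rays that start at a corner, bisect its angle and enter the interior of $P$) at its two endpoints intersect. The perpendicular bisector of an edge is the ray that starts at its midpoint, is orthogonal to it and enters $P$. The polygon $P$ has a short pair $(S,T)$ if $P$ has at least $5$ edges, $S$ is a short edge orthogonal to both its neighbors, $T$ is one of these neighbors, and the perpendicular bisector of $S$ intersects the angle bisector at the end of $T$ opposite to $S$. It has a close pair $(S,S')$ if $P$ has at least $6$ edges, $S$ and $S'$ are short edges with a common neighbor that is not short, both are orthogonal to their neighbors, and their perpendicular bisectors intersect. -/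

import Mathlib

open scoped TensorProduct NumberField IntermediateField

noncomputable section

/-! ## Plane hyperbolic geometry in a Minkowski space

`W` is a real vector space with a symmetric bilinear form `β` of signature `(2,1)`, and `p` is a
fixed vector of negative norm. -/

namespace Minkowski

variable {W : Type*} [AddCommGroup W] [Module ℝ W]

/-- `β` has signature `(2,1)`: in a suitable basis the quadratic form is `-x₀² + x₁² + x₂²`
(in particular `W` has dimension `3`). -/
def HasSignatureTwoOne (β : LinearMap.BilinForm ℝ W) : Prop :=
  β.IsSymm ∧ ∃ e : Module.Basis (Fin 3) ℝ W,
    ∀ x : W, β x x = -(e.repr x 0) ^ 2 + (e.repr x 1) ^ 2 + (e.repr x 2) ^ 2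

/-- The future cone: the time-like vectors whose inner product with `p` is negative. -/
def futureCone (β : LinearMap.BilinForm ℝ W) (p : W) : Set W :=
  {x | β x x < 0 ∧ β x p < 0}

/-- The hyperbolic plane, i.e. the set of rays in the future cone; each ray is represented
by its unique vector of norm `-1`. -/
def hyperbolicPlane (β : LinearMap.BilinForm ℝ W) (p : W) : Set W :=
  {x | β x x = -1 ∧ x ∈ futureCone β p}

/-- The edges of a convex polygon `P` in the hyperbolic plane. An edge is recorded by its outward
unit normal vector `n`: the polygon lies in the half-plane `n · x ≤ 0`, and the edge itself, which
is the set of `x ∈ P` with `n · x = 0`, is not just a point. -/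
def edges (β : LinearMap.BilinForm ℝ W) (P : Set W) : Set W :=
  {n | β n n = 1 ∧ (∀ x ∈ P, β n x ≤ 0) ∧ ∃ x ∈ P, ∃ y ∈ P, x ≠ y ∧ β n x = 0 ∧ β n y = 0}

/-- `x` is the corner of `P` at which the two distinct edges `m`, `n` meet; then `m` and `n` are
neighbors. -/
def IsCorner (β : LinearMap.BilinForm ℝ W) (P : Set W) (m n x : W) : Prop :=
  m ∈ edges β P ∧ n ∈ edges β P ∧ m ≠ n ∧ x ∈ P ∧ β m x = 0 ∧ β n x = 0

/-- The angle bisector at the corner of the edges `m` and `n`: the ray of the points that are on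
the inner side of both edge lines and equidistant from them (the hyperbolic sine of the distance
from `y` to the line orthogonal to the unit vector `m` is `|m · y|`). -/
def angleBisector (β : LinearMap.BilinForm ℝ W) (p m n : W) : Set W :=
  {y | y ∈ hyperbolicPlane β p ∧ β m y = β n y ∧ β m y ≤ 0}

/-- The perpendicular bisector of the edge `m` with endpoints `x` and `y`: the ray of the points
that are equidistant from `x` and `y` and on the inner side of the edge line. -/
def perpBisector (β : LinearMap.BilinForm ℝ W) (p m x y : W) : Set W :=
  {z | z ∈ hyperbolicPlane β p ∧ β x z = β y z ∧ β m z ≤ 0}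

/-- The edge `m` of `P` is short: the angle bisectors at its two endpoints intersect. -/
def IsShortEdge (β : LinearMap.BilinForm ℝ W) (p : W) (P : Set W) (m : W) : Prop :=
  ∃ l n x y : W, IsCorner β P l m x ∧ IsCorner β P m n y ∧ x ≠ y ∧
    (angleBisector β p l m ∩ angleBisector β p m n).Nonempty

/-- `P` has at least five edges and a short pair `(S, T)`: there are consecutive edges
`R, S, T, R'` such that `S` is short and orthogonal to both its neighbors `R` and `T`, and the
perpendicular bisector of `S` intersects the angle bisector at the opposite end of `T`. -/
def HasShortPair (β : LinearMap.BilinForm ℝ W) (p : W) (P : Set W) : Prop :=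
  5 ≤ (edges β P).encard ∧
  ∃ R S T R' x y z : W,
    IsCorner β P R S x ∧ IsCorner β P S T y ∧ IsCorner β P T R' z ∧ x ≠ y ∧ y ≠ z ∧
    IsShortEdge β p P S ∧ β R S = 0 ∧ β S T = 0 ∧
    (perpBisector β p S x y ∩ angleBisector β p T R').Nonempty

/-- `P` has at least six edges and a close pair `(S, S')`: there are consecutive edges
`R, S, T, S', R'` such that `S` and `S'` are short and orthogonal to their neighbors, the common
neighbor `T` is not short, and the perpendicular bisectors of `S` and `S'` intersect. -/
def HasClosePair (β : LinearMap.BilinForm ℝ W) (p : W) (P : Set W) : Prop :=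
  6 ≤ (edges β P).encard ∧
  ∃ R S T S' R' w x y z : W,
    IsCorner β P R S w ∧ IsCorner β P S T x ∧ IsCorner β P T S' y ∧ IsCorner β P S' R' z ∧
    w ≠ x ∧ x ≠ y ∧ y ≠ z ∧
    IsShortEdge β p P S ∧ IsShortEdge β p P S' ∧ ¬ IsShortEdge β p P T ∧
    β R S = 0 ∧ β S T = 0 ∧ β T S' = 0 ∧ β S' R' = 0 ∧
    (perpBisector β p S w x ∩ perpBisector β p S' y z).Nonempty

end Minkowski

/-! ## Lattices over the ring of integers of a number field

`F` is a number field with a fixed embedding into `ℝ` (the algebra structure on `ℝ`), `V` is a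
vector space over `F` with a bilinear form `B`, and `L` is an `𝓞 F`-lattice in `V`. -/

namespace QuadLattice

open Minkowski

variable {F : Type*} [Field F] [NumberField F] [Algebra F ℝ]
variable {V : Type*} [AddCommGroup V] [Module F V] [Module (𝓞 F) V] [IsScalarTower (𝓞 F) F V]

/-- The real extension `ℝ ⊗ V` of `V` (Minkowski space if the signature is `(2,1)`). -/
abbrev RealSpace (F : Type*) [Field F] [Algebra F ℝ] (V : Type*) [AddCommGroup V] [Module F V] :
    Type _ := ℝ ⊗[F] V

/-- The extension of the bilinear form to the real space. -/
def realForm (B : LinearMap.BilinForm F V) : LinearMap.BilinForm ℝ (RealSpace F V) :=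
  LinearMap.BilinForm.baseChange ℝ B

/-- The inclusion of `V` in the real space. -/
def toReal (v : V) : RealSpace F V := (1 : ℝ) ⊗ₜ[F] v

/-- The form is arithmetic: every conjugate by a nontrivial Galois element `σ` is definite.
For a nondegenerate form it is equivalent to test definiteness on the vectors of `V`, since these
are dense in the conjugate real space and the radical of a form is defined over `F`. -/
def IsArithmetic (B : LinearMap.BilinForm F V) : Prop :=
  ∀ σ : F ≃ₐ[ℚ] F, σ ≠ 1 →
    (∀ v : V, v ≠ 0 → 0 < algebraMap F ℝ (σ (B v v))) ∨
    (∀ v : V, v ≠ 0 → algebraMap F ℝ (σ (B v v)) < 0)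

/-- `v` is a primitive vector of `L`. -/
def IsPrimitive (L : Submodule (𝓞 F) V) (v : V) : Prop :=
  v ∈ L ∧ ∀ (a : 𝓞 F), ∀ w ∈ L, v = a • w → IsUnit a

/-- `r` is a root of `L`: a primitive space-like vector with `r · v ∈ (r² / 2) 𝓞 F` for all
`v ∈ L`, that is, the reflection in `r` preserves `L`. -/
def IsRoot (B : LinearMap.BilinForm F V) (L : Submodule (𝓞 F) V) (r : V) : Prop :=
  IsPrimitive L r ∧ 0 < algebraMap F ℝ (B r r) ∧
    ∀ v ∈ L, ∃ a : 𝓞 F, B r v = (B r r / 2) * (a : F)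

/-- `Aut(L)`: the isometries of `V` that preserve `L` and the future cone. -/
def autGroup (B : LinearMap.BilinForm F V) (L : Submodule (𝓞 F) V) (p : RealSpace F V) :
    Subgroup (V ≃ₗ[F] V) where
  carrier := {g | (∀ v w, B (g v) (g w) = B v w) ∧ (∀ v, g v ∈ L ↔ v ∈ L) ∧
    ∀ x, (g : V →ₗ[F] V).baseChange ℝ x ∈ futureCone (realForm B) p ↔
      x ∈ futureCone (realForm B) p}
  one_mem' := by
    refine ⟨fun _ _ => rfl, fun _ => Iff.rfl, fun x => ?_⟩
    have h : (((1 : V ≃ₗ[F] V) : V →ₗ[F] V)).baseChange ℝ x = x := by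
      have h1 : (((1 : V ≃ₗ[F] V) : V →ₗ[F] V)) = LinearMap.id := rfl
      rw [h1, LinearMap.baseChange_id]; rfl
    rw [h]
  mul_mem' := by
    rintro g h ⟨g1, g2, g3⟩ ⟨h1, h2, h3⟩
    refine ⟨fun v w => (g1 _ _).trans (h1 _ _), fun v => (g2 _).trans (h2 _), fun x => ?_⟩
    have e : ((g * h : V ≃ₗ[F] V) : V →ₗ[F] V).baseChange ℝ x =
        (g : V →ₗ[F] V).baseChange ℝ ((h : V →ₗ[F] V).baseChange ℝ x) := by
      have e1 : ((g * h : V ≃ₗ[F] V) : V →ₗ[F] V) = (g : V →ₗ[F] V) ∘ₗ (h : V →ₗ[F] V) := rfl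
      rw [e1, LinearMap.baseChange_comp]; rfl
    rw [e]
    exact (g3 _).trans (h3 _)
  inv_mem' := by
    rintro g ⟨g1, g2, g3⟩
    have e0 : ∀ v, g (g⁻¹ v) = v := fun v => g.apply_symm_apply v
    refine ⟨fun v w => ?_, fun v => ?_, fun x => ?_⟩
    · rw [← g1, e0, e0]
    · rw [← g2, e0]
    · have e : (g : V →ₗ[F] V).baseChange ℝ
          (((g⁻¹ : V ≃ₗ[F] V) : V →ₗ[F] V).baseChange ℝ x) = x := by
        have e1 : (g : V →ₗ[F] V) ∘ₗ ((g⁻¹ : V ≃ₗ[F] V) : V →ₗ[F] V) = LinearMap.id :=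
          LinearMap.ext e0
        rw [← LinearMap.comp_apply, ← LinearMap.baseChange_comp, e1, LinearMap.baseChange_id]
        rfl
      rw [← g3, e]

/-- The reflections `v ↦ v - (2 (r · v) / r²) r` in the roots `r` of `L`. -/
def reflections (B : LinearMap.BilinForm F V) (L : Submodule (𝓞 F) V) : Set (V ≃ₗ[F] V) :=
  {g | ∃ r, IsRoot B L r ∧ ∀ v, g v = v - (2 * B r v / B r r) • r}

/-- `L` is reflective: `Aut(L)` is generated up to finite index by finitely many reflections. -/
def IsReflective (B : LinearMap.BilinForm F V) (L : Submodule (𝓞 F) V) (p : RealSpace F V) :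
    Prop :=
  ∃ S : Set (V ≃ₗ[F] V), S.Finite ∧ S ⊆ reflections B L ∧
    (Subgroup.closure S).IsFiniteRelIndex (autGroup B L p)

/-- `P` is a (closed) fundamental chamber of the group generated by the reflections in the roots
of `L`: one of the cells into which the mirrors `r · x = 0` of the roots divide the hyperbolic
plane, namely the one that contains some point `x₀` lying on no mirror. -/
def IsChamber (B : LinearMap.BilinForm F V) (L : Submodule (𝓞 F) V) (p : RealSpace F V)
    (P : Set (RealSpace F V)) : Prop :=
  ∃ x₀ ∈ hyperbolicPlane (realForm B) p,
    (∀ r, IsRoot B L r → realForm B (toReal r) x₀ ≠ 0) ∧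
    P = {x | x ∈ hyperbolicPlane (realForm B) p ∧
      ∀ r, IsRoot B L r → 0 ≤ realForm B (toReal r) x * realForm B (toReal r) x₀}

end QuadLattice

end

/-! The proof plays the size of inner products of roots against their arithmetic. For roots `r`, `t`
the number `A = 4(r·t)²/(r²t²)` is a product of two Cartan integers, hence an algebraic integer, and
because the conjugate form is definite its conjugate lies in `[0,4)` when `r`, `t` are not
proportional. If also `A ≤ M` with `4 ≤ M`, then `A - σA`, which is an integral multiple of `√d` (an
even one if `d ≡ 2, 3 mod 4`), has absolute value at most `M`. So `M² < d` (or `M² < 4d`) forces `A`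
to be one of the integers `0, 1, 2, 3`. This is `gap`: there are no moderately large values, only
those of lines meeting at a few angles.

Part 2 follows at once. If a short edge is orthogonal to both its neighbors `R` and `T`, the point
where its angle bisectors meet gives `|R·T| ≤ 3`, so `A ≤ 36 = √1296`; but `R` and `T` have a common
perpendicular, so `A ≥ 4`, contrary to `gap`. Thus no short edge of a chamber is orthogonal to both
its neighbors, which excludes short and close pairs alike.

For part 1, assume that `L` is reflective. The conjugate form is definite, so `Aut(L)` acts
cocompactly on the hyperbolic plane (`autGroup_cobounded`), and then so does the reflection group.
Hence finitely many mirrors bound a compact polygon around a generic point `o`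
(`exists_finite_cone`). Growing inscribed circles in that polygon produces an ear: linearly
independent normals `a`, `b`, `c`, where the line of `c` meets those of `a` and `b`, and a point
equidistant from all three (`exists_ear`). Since `c` crosses `a` and `b`, `gap` limits these angles
to `|a·c|, |c·b| ≤ √3/2`, and Cauchy-Schwarz at the equidistant point gives `|a·b| ≤ 3 + 2√3`
(`short_bound`). Now `gap` applies to `a`, `b` as well, with `M = 4(3 + 2√3)²` and `M² < 27936`. But
then the normalized Gram determinant of the three roots is fixed by `σ`. It is negative in signature
`(2,1)`, while definiteness of the conjugate form makes it positive: a contradiction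
(`no_triangle`).

Cocompactness is proved with quaternions, which represent rotations. Given a point `x`, let `u` be
the quaternion of the half-turn that exchanges `x` and `o`. Minkowski's convex body theorem yields
an integral `z ≠ 0` such that both `uz` and the conjugate of `z` are bounded independently of `x`,
so that the rotation by `z` takes `o` near `x` and the norm of `z` has finitely many values. Modulo
a fixed integer there are finitely many classes of such `z`, and two in one class with equal norm
differ by a norm `1` quaternion that preserves `L`. -/

namespace Minkowski

/-! ### Linear algebra of three-dimensional Minkowski space. -/

variable {W : Type*} [AddCommGroup W] [Module ℝ W] {β : LinearMap.BilinForm ℝ W}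
  {e : Module.Basis (Fin 3) ℝ W}

/-- In the coordinates of `e`, the bilinear form is `-x₀y₀ + x₁y₁ + x₂y₂`. -/
def IsLorentzBasis (β : LinearMap.BilinForm ℝ W) (e : Module.Basis (Fin 3) ℝ W) : Prop :=
  ∀ x y, β x y = -(e.repr x 0 * e.repr y 0) + e.repr x 1 * e.repr y 1 + e.repr x 2 * e.repr y 2

theorem HasSignatureTwoOne.exists_isLorentzBasis (h : HasSignatureTwoOne β) :
    ∃ e : Module.Basis (Fin 3) ℝ W, IsLorentzBasis β e := by
  obtain ⟨hs, e, he⟩ := h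
  refine ⟨e, fun x y => ?_⟩
  have h1 := he (x + y)
  have h2 := he x
  have h3 := he y
  have h4 : β y x = β x y := hs.eq y x
  simp only [map_add, LinearMap.add_apply, Finsupp.add_apply] at h1
  linarith

/-- The determinant of three vectors in the coordinates of `e`. -/
noncomputable def vol (e : Module.Basis (Fin 3) ℝ W) (a b c : W) : ℝ :=
  (e.repr a 1 * e.repr b 2 - e.repr a 2 * e.repr b 1) * e.repr c 0 +
    (e.repr a 2 * e.repr b 0 - e.repr a 0 * e.repr b 2) * e.repr c 1 +
    (e.repr a 0 * e.repr b 1 - e.repr a 1 * e.repr b 0) * e.repr c 2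

/-- The Lorentzian cross product. -/
noncomputable def cross (e : Module.Basis (Fin 3) ℝ W) (a b : W) : W :=
  e.equivFun.symm ![-(e.repr a 1 * e.repr b 2 - e.repr a 2 * e.repr b 1),
    e.repr a 2 * e.repr b 0 - e.repr a 0 * e.repr b 2,
    e.repr a 0 * e.repr b 1 - e.repr a 1 * e.repr b 0]

theorem repr_cross (a b : W) (i : Fin 3) : e.repr (cross e a b) i =
    ![-(e.repr a 1 * e.repr b 2 - e.repr a 2 * e.repr b 1),
    e.repr a 2 * e.repr b 0 - e.repr a 0 * e.repr b 2,
    e.repr a 0 * e.repr b 1 - e.repr a 1 * e.repr b 0] i := by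
  rw [cross, ← Module.Basis.equivFun_apply, LinearEquiv.apply_symm_apply]

theorem IsLorentzBasis.cross_left (he : IsLorentzBasis β e) (a b x : W) :
    β (cross e a b) x = vol e a b x := by
  rw [he, repr_cross, repr_cross, repr_cross, vol]
  simp
  ring

theorem IsLorentzBasis.symm (he : IsLorentzBasis β e) (x y : W) : β x y = β y x := by
  rw [he, he]; ring

/-- The minus sign is the determinant of the Lorentz form. It makes independent unit vectors have a
negative Gram determinant, which conjugation will contradict. -/
theorem IsLorentzBasis.gram (he : IsLorentzBasis β e) (a b c : W) :
    β a a * β b b * β c c + 2 * β a b * β b c * β a c - β a a * β b c ^ 2 - β b b * β a c ^ 2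
      - β c c * β a b ^ 2 = -(vol e a b c) ^ 2 := by
  simp only [he _ _, vol]; ring

/-- Cramer's rule, cleared of denominators. -/
theorem vol_smul_eq (a b c x : W) :
    vol e a b c • x = vol e x b c • a + vol e a x c • b + vol e a b x • c := by
  apply e.repr.injective
  ext i
  simp only [map_add, map_smul, Finsupp.add_apply, Finsupp.smul_apply, smul_eq_mul, vol]
  fin_cases i <;> simp <;> ring

theorem vol_left_self (a b : W) : vol e a b a = 0 := by simp only [vol]; ring
theorem vol_right_self (a b : W) : vol e a b b = 0 := by simp only [vol]; ring
theorem vol_swap (a b c : W) : vol e b a c = -vol e a b c := by simp only [vol]; ring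

theorem ne_zero_repr {a : W} (ha : a ≠ 0) :
    0 < e.repr a 0 ^ 2 + e.repr a 1 ^ 2 + e.repr a 2 ^ 2 := by
  by_contra h
  apply ha
  apply e.repr.injective
  ext i
  have h0 : e.repr a 0 = 0 := by nlinarith [sq_nonneg (e.repr a 0), sq_nonneg (e.repr a 1), sq_nonneg (e.repr a 2)]
  have h1 : e.repr a 1 = 0 := by nlinarith [sq_nonneg (e.repr a 0), sq_nonneg (e.repr a 1), sq_nonneg (e.repr a 2)]
  have h2 : e.repr a 2 = 0 := by nlinarith [sq_nonneg (e.repr a 0), sq_nonneg (e.repr a 1), sq_nonneg (e.repr a 2)]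
  fin_cases i <;> simp [h0, h1, h2]

/-- The orthogonal complement of a time-like vector is positive definite. -/
theorem IsLorentzBasis.pos_of_orthogonal (he : IsLorentzBasis β e) {a y : W} (hy : β y y < 0)
    (hay : β a y = 0) (ha : a ≠ 0) : 0 < β a a := by
  have hpos := ne_zero_repr (e := e) ha
  rw [he] at *
  set a0 := e.repr a 0
  set a1 := e.repr a 1
  set a2 := e.repr a 2
  set y0 := e.repr y 0
  set y1 := e.repr y 1
  set y2 := e.repr y 2
  have h1 : a0 * y0 = a1 * y1 + a2 * y2 := by linarith
  have h2 : (a0 * y0) ^ 2 ≤ (a1 ^ 2 + a2 ^ 2) * (y1 ^ 2 + y2 ^ 2) := by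
    rw [h1]; nlinarith [sq_nonneg (a1 * y2 - a2 * y1)]
  have h3 : 0 < y0 ^ 2 := by nlinarith [sq_nonneg y1, sq_nonneg y2]
  have h4 : y1 ^ 2 + y2 ^ 2 < y0 ^ 2 := by linarith
  by_contra hcon
  have h5 : a1 ^ 2 + a2 ^ 2 ≤ a0 ^ 2 := by linarith
  have h6 : 0 < a0 ^ 2 := by nlinarith
  have h7 : a0 ^ 2 * y0 ^ 2 ≤ a0 ^ 2 * (y1 ^ 2 + y2 ^ 2) := by
    nlinarith [mul_le_mul_of_nonneg_right h5 (by positivity : 0 ≤ y1 ^ 2 + y2 ^ 2)]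
  nlinarith [mul_lt_mul_of_pos_left h4 h6]

theorem IsLorentzBasis.nonneg_of_orthogonal (he : IsLorentzBasis β e) {a y : W} (hy : β y y < 0)
    (hay : β a y = 0) : 0 ≤ β a a := by
  by_cases ha : a = 0
  · simp [ha]
  · exact (he.pos_of_orthogonal hy hay ha).le

/-- The Cauchy-Schwarz inequality in the orthogonal complement of a time-like vector. -/
theorem IsLorentzBasis.cauchy (he : IsLorentzBasis β e) {a b y : W} (hy : β y y < 0)
    (hay : β a y = 0) (hby : β b y = 0) : β a b ^ 2 ≤ β a a * β b b := by
  by_cases ha : a = 0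
  · simp [ha]
  have hpos := he.pos_of_orthogonal hy hay ha
  have h := he.nonneg_of_orthogonal hy (a := β a a • b - β a b • a) (by simp [hay, hby])
  simp only [map_sub, map_smul, LinearMap.sub_apply, LinearMap.smul_apply, smul_eq_mul] at h
  rw [he.symm b a] at h
  by_contra hc
  nlinarith

/-- The vector `(a·a)b - (a·b)a` lies in the positive definite space `y^⊥`, and its norm is `a·a`
times the defect in Cauchy-Schwarz. -/
theorem IsLorentzBasis.cauchy_strict (he : IsLorentzBasis β e) {a b y : W} (hy : β y y < 0)
    (hay : β a y = 0) (hby : β b y = 0) (hab : β a a • b - β a b • a ≠ 0) :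
    β a b ^ 2 < β a a * β b b := by
  have ha : a ≠ 0 := by rintro rfl; simp at hab
  have hpos := he.pos_of_orthogonal hy hay ha
  have h := he.pos_of_orthogonal hy (a := β a a • b - β a b • a) (by simp [hay, hby]) hab
  simp only [map_sub, map_smul, LinearMap.sub_apply, LinearMap.smul_apply, smul_eq_mul] at h
  rw [he.symm b a] at h
  by_contra hc
  nlinarith

/-- Time-like vectors that have nonzero inner product: the reversed Cauchy-Schwarz inequality. -/
theorem IsLorentzBasis.reverse_cauchy (he : IsLorentzBasis β e) {x y : W} (hy : β y y < 0) :
    β x x * β y y ≤ β x y ^ 2 := by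
  have h := he.nonneg_of_orthogonal hy (a := β y y • x - β x y • y) (by
    simp only [map_sub, map_smul, LinearMap.sub_apply, LinearMap.smul_apply, smul_eq_mul]; ring)
  simp only [map_sub, map_smul, LinearMap.sub_apply, LinearMap.smul_apply, smul_eq_mul] at h
  rw [he.symm y x] at h
  by_contra hc
  nlinarith

theorem IsLorentzBasis.ne_zero_of_timelike (he : IsLorentzBasis β e) {x y : W} (hx : β x x < 0)
    (hy : β y y < 0) : β x y ≠ 0 := by
  intro h
  have := he.reverse_cauchy (x := x) hy
  rw [h] at this
  nlinarith [mul_pos_of_neg_of_neg hx hy]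

/-- The positive definite form attached to a point `o` with `o² = -1` satisfies the
Cauchy-Schwarz inequality. -/
theorem IsLorentzBasis.cauchy_at (he : IsLorentzBasis β e) {o : W} (ho : β o o = -1) (a b : W) :
    (β a b + β a o * β b o) ^ 2 ≤ (β a a + β a o ^ 2) * (β b b + β b o ^ 2) := by
  have h := he.cauchy (a := a + β a o • o) (b := b + β b o • o) (y := o) (by rw [ho]; norm_num)
    (by simp [ho]) (by simp [ho])
  simp only [map_add, map_smul, LinearMap.add_apply, LinearMap.smul_apply, smul_eq_mul, ho] at h
  rw [he.symm o b, he.symm o a] at h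
  nlinarith

theorem IsLorentzBasis.add_sq_nonneg (he : IsLorentzBasis β e) {o : W} (ho : β o o = -1) (a : W) :
    0 ≤ β a a + β a o ^ 2 := by
  have h := he.nonneg_of_orthogonal (a := a + β a o • o) (y := o) (by rw [ho]; norm_num)
    (by simp [ho])
  simp only [map_add, map_smul, LinearMap.add_apply, LinearMap.smul_apply, smul_eq_mul, ho] at h
  rw [he.symm o a] at h
  nlinarith

/-- Two vectors of the future cone have negative inner product. -/
theorem IsLorentzBasis.neg_of_future (he : IsLorentzBasis β e) {x y p : W} (hp : β p p < 0)
    (hx : β x x < 0) (hy : β y y < 0) (hxp : β x p < 0) (hyp : β y p < 0) : β x y < 0 := by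
  -- the segment from `x` to `y` stays time-like
  by_contra hcon
  push Not at hcon
  -- This combination is orthogonal to `p`, yet its norm is negative if `x·y ≥ 0`.
  have hz := he.ne_zero_of_timelike (x := β y p • x - β x p • y) (y := p) (by
    simp only [map_sub, map_smul, LinearMap.sub_apply, LinearMap.smul_apply, smul_eq_mul]
    rw [he.symm y x]
    nlinarith [mul_pos_of_neg_of_neg hxp hyp, sq_pos_of_neg hyp, sq_pos_of_neg hxp,
      mul_nonneg (mul_pos_of_neg_of_neg hxp hyp).le hcon,
      mul_neg_of_pos_of_neg (sq_pos_of_neg hyp) hx, mul_neg_of_pos_of_neg (sq_pos_of_neg hxp) hy])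
    hp
  apply hz
  simp only [map_sub, map_smul, LinearMap.sub_apply, LinearMap.smul_apply, smul_eq_mul]
  ring

/-- The hyperbolic form of the triangle inequality `cosh (a + b) ≤ 2 cosh a cosh b`. -/
theorem IsLorentzBasis.triangle (he : IsLorentzBasis β e) {x y z : W} (hx : β x x = -1)
    (hy : β y y = -1) (hz : β z z = -1) (hxy : β x y < 0) (hyz : β y z < 0) :
    -β x z ≤ 2 * (β x y * β y z) := by
  have h := he.cauchy_at hy x z
  rw [hx, hz, he.symm z y] at h
  have h1 : (β x z + β x y * β y z) ^ 2 ≤ (β x y * β y z) ^ 2 := by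
    have := he.add_sq_nonneg hy x
    have := he.add_sq_nonneg hy z
    rw [he.symm z y, hz] at this
    nlinarith [sq_nonneg (β x y), sq_nonneg (β y z)]
  have h2 := mul_pos_of_neg_of_neg hxy hyz
  have := abs_le_of_sq_le_sq h1 h2.le
  linarith [(abs_le.mp this).1]

/-- The orthogonal reflection in a unit vector `u`. -/
def hypRefl (β : LinearMap.BilinForm ℝ W) (u x : W) : W := x - (2 * β u x) • u

theorem refl_neg (u x : W) : hypRefl β (-u) x = hypRefl β u x := by
  simp [hypRefl]

theorem IsLorentzBasis.refl_left (he : IsLorentzBasis β e) (u x y : W) :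
    β (hypRefl β u x) y = β x (hypRefl β u y) := by
  simp only [hypRefl, map_sub, map_smul, LinearMap.sub_apply, LinearMap.smul_apply, smul_eq_mul]
  rw [he.symm x u]; ring

theorem refl_refl {u : W} (hu : β u u = 1) (x : W) : hypRefl β u (hypRefl β u x) = x := by
  simp only [hypRefl, map_sub, map_smul, smul_eq_mul, hu]
  module

theorem refl_self {u : W} (hu : β u u = 1) : hypRefl β u u = -u := by
  simp only [hypRefl, hu]; module

/-- Conjugating a reflection by an isometry reflects in the image vector; this is the rule `s_u s_v
= s_v s_{s_v u}` for rewriting words. -/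
theorem IsLorentzBasis.refl_conj (he : IsLorentzBasis β e) {v : W} (hv : β v v = 1) (u x : W) :
    hypRefl β u (hypRefl β v x) = hypRefl β v (hypRefl β (hypRefl β v u) x) := by
  conv_rhs => rw [hypRefl.eq_def β (hypRefl β v u) x, hypRefl.eq_def β v (x - _)]
  rw [he.refl_left, hypRefl.eq_def β u]
  simp only [map_sub, map_smul, smul_eq_mul]
  have : hypRefl β v (hypRefl β v u) = u := refl_refl hv u
  have h2 : hypRefl β v x - (2 * β u (hypRefl β v x)) • hypRefl β v (hypRefl β v u) =
    (x - (2 * β u (hypRefl β v x)) • hypRefl β v u) -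
      (2 * (β v x - 2 * β u (hypRefl β v x) * β v (hypRefl β v u))) • v := by
    simp only [hypRefl, map_sub, map_smul, smul_eq_mul]
    module
  rw [this] at h2
  exact h2

theorem hypRefl_add (u x y : W) : hypRefl β u (x + y) = hypRefl β u x + hypRefl β u y := by
  simp only [hypRefl, map_add]; module

theorem hypRefl_smul (u x : W) (c : ℝ) : hypRefl β u (c • x) = c • hypRefl β u x := by
  simp only [hypRefl, map_smul, smul_eq_mul]; module

end Minkowski

/-! ### Reflection groups: simple reflections and the exchange condition. -/

namespace Minkowski

variable {W : Type*} [AddCommGroup W] [Module ℝ W] {β : LinearMap.BilinForm ℝ W}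
  {e : Module.Basis (Fin 3) ℝ W}

/-- The image of `x` under the product of the reflections in the members of a list. -/
def reflWord (β : LinearMap.BilinForm ℝ W) (l : List W) (x : W) : W := l.foldr (hypRefl β) x

theorem reflWord_nil (x : W) : reflWord β [] x = x := rfl
theorem reflWord_cons (u : W) (l : List W) (x : W) :
    reflWord β (u :: l) x = hypRefl β u (reflWord β l x) := rfl
theorem reflWord_append (l m : List W) (x : W) :
    reflWord β (l ++ m) x = reflWord β l (reflWord β m x) := by
  simp [reflWord, List.foldr_append]

/-- A set of unit vectors that is stable under its own reflections and `-1`, such that only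
finitely many of the mirrors meet a given neighborhood of `o`, which lies on no mirror. -/
structure IsRootSystemAt (β : LinearMap.BilinForm ℝ W) (U : Set W) (o : W) : Prop where
  sq : ∀ u ∈ U, β u u = 1
  neg : ∀ u ∈ U, -u ∈ U
  refl : ∀ u ∈ U, ∀ t ∈ U, hypRefl β u t ∈ U
  finite : ∀ C : ℝ, {u ∈ U | |β u o| ≤ C}.Finite
  point : β o o = -1
  off : ∀ u ∈ U, β u o ≠ 0

/-- `u` is a unit vector of `U`, negative on `o`, and its mirror is the only one that separates
`o` from its mirror image. -/
def IsSimple (β : LinearMap.BilinForm ℝ W) (U : Set W) (o u : W) : Prop :=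
  u ∈ U ∧ β u o < 0 ∧ ∀ t ∈ U, β t o < 0 → 0 < β t (hypRefl β u o) → t = u

/-- Some other mirror separates `o` from `s_u o`. It, or its image under `s_u`, crosses the half of
the segment between `o` and the midpoint `o - (u·o)u`, and Cauchy-Schwarz at `o` shows that such a
mirror is closer to `o` than that of `u`. -/
theorem IsLorentzBasis.exists_closer (he : IsLorentzBasis β e) {U : Set W} {o : W}
    (hU : IsRootSystemAt β U o) {u : W} (hu : u ∈ U) (huo : β u o < 0)
    (hns : ¬ IsSimple β U o u) :
    ∃ t ∈ U, β t o < 0 ∧ β u o < β t o ∧ 0 < β u t := by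
  simp only [IsSimple, hu, huo, true_and, not_forall] at hns
  obtain ⟨t, ht, hto, htu, hne⟩ := hns
  -- a mirror that meets the segment from `o` to the midpoint of `o` and its mirror image
  have key : ∀ t ∈ U, β t o < 0 → t ≠ u → 0 ≤ β t (o - β u o • u) →
      β u o < β t o ∧ 0 < β u t := by
    intro t ht hto hne hm
    simp only [map_sub, map_smul, smul_eq_mul] at hm
    rw [he.symm t u] at hm
    have hc : 0 < β u t := by
      by_contra hc
      push Not at hc
      nlinarith [mul_nonneg_of_nonpos_of_nonpos huo.le hc]
    refine ⟨?_, hc⟩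
    by_contra hle
    push Not at hle
    have hs' : (β u t + β u o * β t o) ^ 2 ≤ (1 + β u o ^ 2) * (1 + β t o ^ 2) := by
      have := he.cauchy_at hU.point u t
      rwa [hU.sq u hu, hU.sq t ht] at this
    set p := -β u o with hp
    set q := -β t o with hq
    have hp0 : 0 < p := by linarith
    have hpq : p ≤ q := by linarith
    have e1 : β u o = -p := by linarith
    have e2 : β t o = -q := by linarith
    rw [e1, e2] at hs' hm
    set c := β u t
    have hq0 : 0 < q := by linarith
    have h1 : q ≤ c * p := by nlinarith
    -- `q (1 + p²) ≤ p (c + p q)`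
    have h2 : q * (1 + p ^ 2) ≤ p * (c + p * q) := by nlinarith
    have h3 : (q * (1 + p ^ 2)) ^ 2 ≤ (p * (c + p * q)) ^ 2 := by
      apply pow_le_pow_left₀ (by positivity) h2
    have h4 : q ^ 2 * (1 + p ^ 2) ^ 2 ≤ p ^ 2 * ((1 + p ^ 2) * (1 + q ^ 2)) := by nlinarith
    have h5 : q ^ 2 * (1 + p ^ 2) ≤ p ^ 2 * (1 + q ^ 2) := by
      have : 0 < 1 + p ^ 2 := by positivity
      by_contra h
      push Not at h
      nlinarith
    have h6 : q = p := by nlinarith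
    have h7 : 1 ≤ c := by
      rw [h6] at h1
      nlinarith
    have h8 : β (u - t) (u - t) = 2 - 2 * c := by
      simp only [map_sub, LinearMap.sub_apply]
      rw [he.symm t u, hU.sq u hu, hU.sq t ht]; ring
    have h9 := he.pos_of_orthogonal (a := u - t) (y := o) (by rw [hU.point]; norm_num)
      (by simp only [map_sub, LinearMap.sub_apply]; linarith) (sub_ne_zero.mpr (Ne.symm hne))
    linarith
  by_cases hm : 0 ≤ β t (o - β u o • u)
  · exact ⟨t, ht, hto, key t ht hto hne hm⟩
  · push Not at hm
    have h1 : β (hypRefl β u t) o = β t (hypRefl β u o) := he.refl_left u t o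
    have hne' : -hypRefl β u t ≠ u := by
      intro h
      apply hne
      have h2 : hypRefl β u t = hypRefl β u u := by
        rw [refl_self (hU.sq u hu), ← neg_eq_iff_eq_neg, h]
      have := congrArg (hypRefl β u) h2
      rwa [refl_refl (hU.sq u hu), refl_refl (hU.sq u hu)] at this
    refine ⟨-hypRefl β u t, hU.neg _ (hU.refl u hu t ht), ?_, ?_⟩
    · simp only [map_neg, LinearMap.neg_apply, h1]; linarith
    · refine key _ (hU.neg _ (hU.refl u hu t ht)) ?_ hne' ?_
      · simp only [map_neg, LinearMap.neg_apply, h1]; linarith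
      · simp only [map_neg, LinearMap.neg_apply, he.refl_left]
        have : hypRefl β u (o - β u o • u) = o - β u o • u := by
          simp only [hypRefl, map_sub, map_smul, smul_eq_mul, hU.sq u hu]
          module
        rw [this]; linarith

/-- As `s_t u · o = u·o - 2(u·t)(t·o)`, it is enough that `0 < (u·t)|t·o| < |u·o|`. The upper bound
comes from Cauchy-Schwarz at `o`. -/
theorem IsLorentzBasis.conj_closer (he : IsLorentzBasis β e) {o u t : W} (ho : β o o = -1)
    (hu : β u u = 1) (ht : β t t = 1) (hto : β t o < 0) (hut : β u o < β t o) (hc : 0 < β u t) :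
    |β (hypRefl β t u) o| < -β u o := by
  have hs := he.cauchy_at ho u t
  rw [hu, ht] at hs
  have e3 : β (hypRefl β t u) o = β u o - 2 * β u t * β t o := by
    simp only [hypRefl, map_sub, map_smul, LinearMap.sub_apply, LinearMap.smul_apply, smul_eq_mul]
    rw [he.symm t u]
  rw [e3]
  set p := -β u o with hp
  set q := -β t o with hq
  have e1 : β u o = -p := by linarith
  have e2 : β t o = -q := by linarith
  rw [e1, e2] at hs ⊢
  set c := β u t
  have hq0 : 0 < q := by linarith
  have hpq : q < p := by linarith
  have hcq : c * q < p := by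
    by_contra hcon
    push Not at hcon
    have hp0 : 0 < p := by linarith
    have h2 : p * (1 + q ^ 2) ≤ q * (c + p * q) := by nlinarith
    have h3 : (p * (1 + q ^ 2)) ^ 2 ≤ (q * (c + p * q)) ^ 2 :=
      pow_le_pow_left₀ (by positivity) h2 2
    have h4 : p ^ 2 * (1 + q ^ 2) ^ 2 ≤ q ^ 2 * ((1 + p ^ 2) * (1 + q ^ 2)) := by nlinarith
    have h5 : p ^ 2 * (1 + q ^ 2) ≤ q ^ 2 * (1 + p ^ 2) := by
      have : 0 < 1 + q ^ 2 := by positivity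
      by_contra h
      push Not at h
      nlinarith
    nlinarith
  rw [abs_lt]
  constructor <;> nlinarith [mul_pos hc hq0]

/-- Every reflection of the system is a product of simple ones. -/
theorem IsLorentzBasis.refl_eq_simple_word (he : IsLorentzBasis β e) {U : Set W} {o : W}
    (hU : IsRootSystemAt β U o) (u : W) (hu : u ∈ U) :
    ∃ l : List W, (∀ v ∈ l, IsSimple β U o v) ∧ ∀ x, hypRefl β u x = reflWord β l x := by
  -- induction on the number of the mirrors that are closer
  have main : ∀ n : ℕ, ∀ u ∈ U, β u o < 0 → {t ∈ U | |β t o| < -β u o}.ncard = n →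
      ∃ l : List W, (∀ v ∈ l, IsSimple β U o v) ∧ ∀ x, hypRefl β u x = reflWord β l x := by
    intro n
    induction n using Nat.strong_induction_on with
    | _ n ih =>
      intro u hu huo hn
      by_cases hs : IsSimple β U o u
      · exact ⟨[u], by simpa using hs, fun x => rfl⟩
      have closer : ∀ t ∈ U, |β t o| < -β u o →
          ∃ l : List W, (∀ v ∈ l, IsSimple β U o v) ∧ ∀ x, hypRefl β t x = reflWord β l x := by
        have aux : ∀ t ∈ U, β t o < 0 → |β t o| < -β u o →
            ∃ l : List W, (∀ v ∈ l, IsSimple β U o v) ∧ ∀ x, hypRefl β t x = reflWord β l x := by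
          intro t ht hto htu
          refine ih _ ?_ t ht hto rfl
          rw [← hn]
          rw [abs_of_neg hto] at htu
          have hfin : {t ∈ U | |β t o| < -β u o}.Finite :=
            (hU.finite (-β u o)).subset (by rintro s ⟨h1, h2⟩; exact ⟨h1, h2.le⟩)
          refine Set.ncard_lt_ncard ?_ hfin
          have hsub : {s ∈ U | |β s o| < -β t o} ⊆ {s ∈ U | |β s o| < -β u o} := by
            rintro s ⟨h1, h2⟩
            exact ⟨h1, h2.trans htu⟩
          rw [Set.ssubset_iff_of_subset hsub]
          refine ⟨t, ⟨ht, by rwa [abs_of_neg hto]⟩, fun h => ?_⟩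
          have h2 := h.2
          rw [abs_of_neg hto] at h2
          exact lt_irrefl _ h2
        intro t ht htu
        rcases lt_or_gt_of_ne (hU.off t ht) with h | h
        · exact aux t ht h htu
        · obtain ⟨l, h1, h2⟩ := aux (-t) (hU.neg t ht) (by simpa using h) (by simpa using htu)
          exact ⟨l, h1, fun x => by rw [← refl_neg, h2]⟩
      obtain ⟨t, ht, hto, hut, hc⟩ := he.exists_closer hU hu huo hs
      obtain ⟨l, hl1, hl2⟩ := closer t ht (by rw [abs_of_neg hto]; linarith)
      obtain ⟨m, hm1, hm2⟩ := closer _ (hU.refl t ht u hu)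
        (he.conj_closer hU.point (hU.sq u hu) (hU.sq t ht) hto hut hc)
      -- `s_u = s_t s_{s_t u} s_t`, where both mirrors on the right are closer to `o` than that of
      -- `u`.
      refine ⟨l ++ m ++ l, ?_, fun x => ?_⟩
      · intro v hv
        simp only [List.mem_append] at hv
        rcases hv with (h | h) | h
        · exact hl1 v h
        · exact hm1 v h
        · exact hl1 v h
      · rw [reflWord_append, reflWord_append, ← hl2, ← hm2, ← hl2,
          ← he.refl_conj (hU.sq t ht), refl_refl (hU.sq t ht)]
  rcases lt_or_gt_of_ne (hU.off u hu) with h | h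
  · exact main _ u hu h rfl
  · obtain ⟨l, h1, h2⟩ := main _ (-u) (hU.neg u hu) (by simpa using h) rfl
    exact ⟨l, h1, fun x => by rw [← refl_neg, h2]⟩

theorem IsLorentzBasis.word_eq_simple_word (he : IsLorentzBasis β e) {U : Set W} {o : W}
    (hU : IsRootSystemAt β U o) (l : List W) (hl : ∀ u ∈ l, u ∈ U) :
    ∃ m : List W, (∀ v ∈ m, IsSimple β U o v) ∧ ∀ x, reflWord β l x = reflWord β m x := by
  induction l with
  | nil => exact ⟨[], by simp, fun x => rfl⟩
  | cons u l ih =>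
    obtain ⟨m, hm1, hm2⟩ := ih fun v hv => hl v (List.mem_cons_of_mem u hv)
    obtain ⟨k, hk1, hk2⟩ := he.refl_eq_simple_word hU u (hl u List.mem_cons_self)
    refine ⟨k ++ m, fun v hv => ?_, fun x => ?_⟩
    · rcases List.mem_append.mp hv with h | h
      · exact hk1 v h
      · exact hm1 v h
    · rw [reflWord_cons, reflWord_append, hk2, hm2]

/-- The exchange condition. -/
theorem IsLorentzBasis.exchange (he : IsLorentzBasis β e) {U : Set W} {o : W}
    (hU : IsRootSystemAt β U o) (l : List W) (hl : ∀ v ∈ l, IsSimple β U o v) :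
    ∀ u ∈ U, β u o < 0 → 0 < β u (reflWord β l o) →
      ∃ m v k, l = m ++ v :: k ∧
        ∀ x, hypRefl β u (reflWord β m (hypRefl β v x)) = reflWord β m x := by
  induction l with
  | nil =>
    intro u hu huo h
    rw [reflWord_nil] at h
    linarith
  | cons w l ih =>
    intro u hu huo h
    have hw := hl w List.mem_cons_self
    have hw1 := hU.sq w hw.1
    rw [reflWord_cons, ← he.refl_left] at h
    have hu' := hU.refl w hw.1 u hu
    -- Either `s_w u` is still negative on `o` and the induction applies to it, or the mirror of `u`
    -- separates `o` from `s_w o` and simplicity gives `u = w`.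
    rcases lt_or_gt_of_ne (hU.off _ hu') with h1 | h1
    · obtain ⟨m, v, k, h2, h3⟩ := ih (fun v hv => hl v (List.mem_cons_of_mem w hv)) _ hu' h1 h
      refine ⟨w :: m, v, k, by rw [h2]; rfl, fun x => ?_⟩
      rw [reflWord_cons, reflWord_cons, he.refl_conj hw1, h3]
    · rw [he.refl_left] at h1
      have := hw.2.2 u hu huo h1
      subst this
      exact ⟨[], u, l, rfl, fun x => by simp only [reflWord_nil]; rw [refl_refl hw1]⟩

/-- A point of the chamber of `o` is closest to `o` among the points of the orbit of `o`. -/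
theorem IsLorentzBasis.word_le (he : IsLorentzBasis β e) {U : Set W} {o : W}
    (hU : IsRootSystemAt β U o) {x : W} (hx : ∀ v, IsSimple β U o v → β v x ≤ 0) (n : ℕ) :
    ∀ l : List W, l.length = n → (∀ v ∈ l, IsSimple β U o v) → β x (reflWord β l o) ≤ β x o := by
  induction n using Nat.strong_induction_on with
  | _ n ih =>
    intro l hn hl
    cases l with
    | nil => exact le_rfl
    | cons u l =>
      have hu := hl u List.mem_cons_self
      have hl' : ∀ v ∈ l, IsSimple β U o v := fun v hv => hl v (List.mem_cons_of_mem u hv)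
      rw [List.length_cons] at hn
      rw [reflWord_cons]
      rcases le_or_gt (β u (reflWord β l o)) 0 with h | h
      · have h1 := ih l.length (by omega) l rfl hl'
        have h2 : β x (hypRefl β u (reflWord β l o)) =
            β x (reflWord β l o) - 2 * (β u (reflWord β l o) * β u x) := by
          simp only [hypRefl, map_sub, map_smul, smul_eq_mul]
          rw [he.symm x u]; ring
        rw [h2]
        nlinarith [mul_nonneg_of_nonpos_of_nonpos h (hx u hu)]
      -- The exchange condition cancels `u` against a letter `v`, so the word becomes shorter by
      -- two.
      · obtain ⟨m, v, k, h1, h2⟩ := he.exchange hU l hl' u hu.1 hu.2.1 h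
        have h3 : hypRefl β u (reflWord β l o) = reflWord β (m ++ k) o := by
          rw [h1, reflWord_append, reflWord_append, reflWord_cons, h2]
        rw [h3]
        refine ih (m ++ k).length ?_ _ rfl ?_
        · rw [h1] at hn; simp at hn ⊢; omega
        · intro w hw
          apply hl'
          rw [h1]
          simp only [List.mem_append, List.mem_cons] at hw ⊢
          tauto

end Minkowski

/-! ### Compact polygons and their ears. -/

namespace Minkowski

variable {W : Type*} [AddCommGroup W] [Module ℝ W] {β : LinearMap.BilinForm ℝ W}
  {e : Module.Basis (Fin 3) ℝ W}

/-- If the orbit of `o` under the group generated by the reflections is cobounded, then finitely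
many of the mirrors bound a compact polygon around `o`. -/
theorem IsLorentzBasis.exists_finite_cone (he : IsLorentzBasis β e) {U : Set W} {o : W}
    (hU : IsRootSystemAt β U o) {D : ℝ}
    (hD : ∀ x, β x x = -1 → β x o < 0 → ∃ l : List W, (∀ u ∈ l, u ∈ U) ∧
      -β x (reflWord β l o) ≤ D) :
    ∃ R : Set W, R.Finite ∧ R ⊆ U ∧ (∀ u ∈ R, β u o < 0) ∧
      ∀ x, x ≠ 0 → (∀ u ∈ R, β u x ≤ 0) → β x x < 0 := by
  -- Any `E > D` with `E ≥ 1` serves: a chamber point at distance `arcosh E` from `o` is too far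
  -- from the orbit of `o`, whose nearest point to it is `o` itself.
  set E := max D 0 + 1 with hE
  have hE1 : 1 ≤ E := by rw [hE]; linarith [le_max_right D 0]
  refine ⟨{u ∈ U | |β u o| ≤ E ∧ β u o < 0}, ?_, fun u hu => hu.1, fun u hu => hu.2.2, ?_⟩
  · exact (hU.finite E).subset (by rintro s ⟨h1, h2, h3⟩; exact ⟨h1, h2⟩)
  intro x hx0 hx
  by_contra hxx
  push Not at hxx
  have hos : β o x = β x o := he.symm o x
  obtain ⟨a, ha⟩ : ∃ a, a = -β x o := ⟨_, rfl⟩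
  obtain ⟨w, hw⟩ : ∃ w, w = x - a • o := ⟨_, rfl⟩
  have hxo : β x o = -a := by linarith
  have hwo : β w o = 0 := by simp [hw, hU.point, hxo]
  have hww : β w w = β x x + a ^ 2 := by
    simp only [hw, map_sub, map_smul, LinearMap.sub_apply, LinearMap.smul_apply, smul_eq_mul,
      hU.point, hos, hxo]
    ring
  have hw0 : w ≠ 0 := by
    intro h
    rw [h] at hww
    simp only [map_zero] at hww
    have ha0 : a = 0 := by nlinarith [sq_nonneg a]
    rw [h, ha0] at hw
    simp at hw
    exact hx0 hw.symm
  have hwpos : 0 < β w w := he.pos_of_orthogonal (by rw [hU.point]; norm_num) hwo hw0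
  -- The hyperbolic tangent of the distance whose hyperbolic cosine is `E`.
  set k := Real.sqrt (1 - 1 / E ^ 2) with hk
  have hEinv : 1 / E ^ 2 ≤ 1 := by
    rw [div_le_one (by positivity)]; nlinarith
  have hk2 : k ^ 2 = 1 - 1 / E ^ 2 := Real.sq_sqrt (by linarith)
  have hEpos : 0 < 1 / E ^ 2 := by positivity
  set n := Real.sqrt (β w w) with hn
  have hn2 : n ^ 2 = β w w := Real.sq_sqrt hwpos.le
  have hn0 : 0 < n := Real.sqrt_pos.mpr hwpos
  set L := k / n with hL
  have hL0 : 0 ≤ L := div_nonneg (Real.sqrt_nonneg _) hn0.le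
  have hLw : L ^ 2 * β w w = k ^ 2 := by
    rw [← hn2, hL]; field_simp
  have hLa : L * a < 1 := by
    have h1 : (L * a) ^ 2 ≤ k ^ 2 := by
      rw [← hLw, mul_pow, hww]
      nlinarith [mul_nonneg (sq_nonneg L) hxx]
    nlinarith
  -- The ray of `o + L w` is the point at distance `arcosh E` from `o` towards `x`. Since `L a < 1`
  -- and `x` is not time-like, it comes before `x` is reached.
  have hy1 : (1 - L * a) • o + L • x = o + L • w := by rw [hw]; module
  have hyy : β (o + L • w) (o + L • w) = -(1 / E ^ 2) := by
    simp only [map_add, map_smul, LinearMap.add_apply, LinearMap.smul_apply, smul_eq_mul,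
      hU.point, he.symm o w, hwo]
    nlinarith
  -- Near mirrors are respected because the point is a nonnegative combination of `o` and `x`; a
  -- mirror with `|u·o| > E` is too far away to be crossed.
  have hle : ∀ u ∈ U, β u o < 0 → β u (o + L • w) ≤ 0 := by
    intro u hu huo
    by_cases huE : |β u o| ≤ E
    · rw [← hy1]
      simp only [map_add, map_smul, smul_eq_mul]
      have h1 := hx u ⟨hu, huE, huo⟩
      nlinarith [mul_pos_of_neg_of_neg huo huo, mul_nonneg hL0 (neg_nonneg.mpr h1)]
    · push Not at huE
      rw [abs_of_neg huo] at huE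
      have h1 := he.cauchy_at hU.point u w
      rw [hU.sq u hu, hwo] at h1
      have h2 : (L * β u w) ^ 2 ≤ (1 + β u o ^ 2) * k ^ 2 := by
        rw [← hLw]
        nlinarith [mul_le_mul_of_nonneg_left h1 (sq_nonneg L)]
      have h3 : (1 + β u o ^ 2) * k ^ 2 ≤ β u o ^ 2 := by
        rw [hk2]
        have h4 : 1 ≤ β u o ^ 2 * (1 / E ^ 2) := by
          rw [mul_one_div, le_div_iff₀ (by positivity)]
          nlinarith
        nlinarith
      have h5 := abs_le_of_sq_le_sq' (h2.trans h3 |>.trans_eq (neg_sq _).symm) (by linarith)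
      simp only [map_add, map_smul, smul_eq_mul]
      linarith [h5.2]
  obtain ⟨l, hl, hlD⟩ := hD (E • (o + L • w)) (by
      simp only [map_smul, LinearMap.smul_apply, smul_eq_mul, hyy]; field_simp) (by
      simp only [map_smul, LinearMap.smul_apply, smul_eq_mul, map_add, LinearMap.add_apply,
        hU.point, hwo]; linarith)
  obtain ⟨m, hm, hml⟩ := he.word_eq_simple_word hU l hl
  have h6 := he.word_le hU (x := E • (o + L • w)) (fun v hv => by
    simp only [map_smul, smul_eq_mul]
    exact mul_nonpos_of_nonneg_of_nonpos (by linarith) (hle v hv.1 hv.2.1)) _ m rfl hm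
  rw [← hml] at h6
  simp only [map_smul, LinearMap.smul_apply, smul_eq_mul, map_add, LinearMap.add_apply,
        hU.point, hwo] at h6 hlD
  have := le_max_left D 0
  linarith

/-- The ratio test of linear programming: move along `δ` until the first constraint becomes tight.
For time-like `y`, the conditions `u·y ≤ -1` describe a circle inscribed in the polygon, and
equality means contact. -/
theorem exists_push {R : Set W} (hR : R.Finite) {y δ : W} (hy : ∀ u ∈ R, β u y ≤ -1)
    (hδ : ∃ u ∈ R, 0 < β u δ) :
    ∃ c ∈ R, 0 < β c δ ∧ ∃ s : ℝ, (∀ u ∈ R, β u (y + s • δ) ≤ -1) ∧ β c (y + s • δ) = -1 := by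
  obtain ⟨c, ⟨hc, hcδ⟩, hmin⟩ := Set.exists_min_image {u ∈ R | 0 < β u δ}
    (fun u => (-1 - β u y) / β u δ) (hR.subset fun u hu => hu.1) hδ
  refine ⟨c, hc, hcδ, (-1 - β c y) / β c δ, fun u hu => ?_, ?_⟩
  · simp only [map_add, map_smul, smul_eq_mul]
    by_cases huδ : 0 < β u δ
    · have := hmin u ⟨hu, huδ⟩
      rw [le_div_iff₀ huδ] at this
      linarith
    · have h1 : 0 ≤ (-1 - β c y) / β c δ := div_nonneg (by linarith [hy c hc]) hcδ.le
      nlinarith [hy u hu, mul_nonneg h1 (neg_nonneg.mpr (not_lt.mp huδ))]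
  · simp only [map_add, map_smul, smul_eq_mul]
    field_simp
    ring

/-- Take a subset of least cardinality among those that still cut out a compact polygon. -/
theorem exists_irredundant {R : Set W} (hR : R.Finite)
    (hC : ∀ x, x ≠ 0 → (∀ u ∈ R, β u x ≤ 0) → β x x < 0) :
    ∃ R' ⊆ R, (∀ x, x ≠ 0 → (∀ u ∈ R', β u x ≤ 0) → β x x < 0) ∧
      ∀ u ∈ R', ∃ x, x ≠ 0 ∧ (∀ v ∈ R', v ≠ u → β v x ≤ 0) ∧ 0 ≤ β x x := by
  obtain ⟨R', hR', hmin⟩ := Set.Finite.exists_minimalFor (fun S : Set W => S.ncard)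
    {S | S ⊆ R ∧ ∀ x, x ≠ 0 → (∀ u ∈ S, β u x ≤ 0) → β x x < 0}
    (hR.finite_subsets.subset fun S hS => hS.1) ⟨R, subset_rfl, hC⟩
  refine ⟨R', hR'.1, hR'.2, fun u hu => ?_⟩
  by_contra hcon
  push Not at hcon
  have h1 := hmin (j := R' \ {u}) ⟨Set.sdiff_subset.trans hR'.1, fun x hx hxu =>
    hcon x hx fun v hv hvu => hxu v ⟨hv, hvu⟩⟩
  have h2 := Set.ncard_sdiff_singleton_lt_of_mem hu (hR.subset hR'.1)
  exact absurd (h1 h2.le) (not_le.mpr h2)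

/-- In a compact polygon that contains `o` there are two nonadjacent edges `a`, `b` and an edge
`c` whose line intersects those of `a` and `b`, with a point equidistant from all three. -/
theorem IsLorentzBasis.exists_ear (he : IsLorentzBasis β e) {R : Set W} (hR : R.Finite) {o : W}
    (ho : β o o = -1) (h1 : ∀ u ∈ R, β u u = 1) (hneg : ∀ u ∈ R, β u o < 0)
    (hC : ∀ x, x ≠ 0 → (∀ u ∈ R, β u x ≤ 0) → β x x < 0) :
    ∃ a ∈ R, ∃ b ∈ R, ∃ c ∈ R, vol e a b c ≠ 0 ∧ β a c ^ 2 < 1 ∧ β c b ^ 2 < 1 ∧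
      ∃ y, β y y < 0 ∧ β a y = β b y ∧ β b y = β c y := by
  obtain ⟨S, hSR, hS, hirr⟩ := exists_irredundant hR hC
  have hSfin := hR.subset hSR
  -- no member of `S` is a nonnegative combination of others
  have irr : ∀ u ∈ S, ∀ a ∈ S, ∀ b ∈ S, ∀ c ∈ S, a ≠ u → b ≠ u → c ≠ u →
      ∀ k α γ δ : ℝ, 0 ≤ α → 0 ≤ γ → 0 ≤ δ → k • u = α • a + γ • b + δ • c → k ≤ 0 := by
    intro u hu a ha b hb c hc hau hbu hcu k α γ δ hα hγ hδ hk
    by_contra hk0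
    push Not at hk0
    obtain ⟨x, hx0, hx1, hx2⟩ := hirr u hu
    refine absurd (hS x hx0 fun v hv => ?_) (not_lt.mpr hx2)
    by_cases hvu : v = u
    · subst hvu
      have h3 := congrArg (fun z => β z x) hk
      simp only [map_add, map_smul, LinearMap.add_apply, LinearMap.smul_apply, smul_eq_mul] at h3
      have := mul_nonneg hα (neg_nonneg.mpr (hx1 a ha hau))
      have := mul_nonneg hγ (neg_nonneg.mpr (hx1 b hb hbu))
      have := mul_nonneg hδ (neg_nonneg.mpr (hx1 c hc hcu))
      by_contra h4
      push Not at h4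
      nlinarith
    · exact hx1 v hv hvu
  -- Pairing with `o`, on which all members are negative, excludes the remaining case `k ≤ 0`.
  have comb : ∀ u ∈ S, ∀ x ∈ S, ∀ a ∈ S, ∀ c ∈ S, x ≠ u → a ≠ u → c ≠ u →
      ∀ k α γ δ : ℝ, 0 < α → 0 ≤ γ → 0 ≤ δ → k • u = α • x + γ • a + δ • c → False := by
    intro u hu x hx a ha c hc hxu hau hcu k α γ δ hα hγ hδ hk
    have h2 := irr u hu x hx a ha c hc hxu hau hcu k α γ δ hα.le hγ hδ hk
    have h3 := congrArg (fun z => β z o) hk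
    simp only [map_add, map_smul, LinearMap.add_apply, LinearMap.smul_apply, smul_eq_mul] at h3
    have := mul_pos hα (neg_pos.mpr (hneg x (hSR hx)))
    have := mul_nonneg hγ (neg_pos.mpr (hneg a (hSR ha))).le
    have := mul_nonneg hδ (neg_pos.mpr (hneg c (hSR hc))).le
    have := mul_nonneg (neg_nonneg.mpr h2) (neg_pos.mpr (hneg u (hSR hu))).le
    linarith
  -- An inscribed circle touches `a` and `b`. The induction is on the number of normals on the
  -- positive side of the chord `ab`, as in the search for an ear of a triangulation.
  have main : ∀ n : ℕ, ∀ a ∈ S, ∀ b ∈ S, ∀ y, (∀ u ∈ S, β u y ≤ -1) → β a y = -1 → β b y = -1 →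
      {c ∈ S | 0 < vol e a b c}.Nonempty → {c ∈ S | 0 < vol e a b c}.ncard = n →
      ∃ a ∈ S, ∃ b ∈ S, ∃ c ∈ S, vol e a b c ≠ 0 ∧ β a c ^ 2 < 1 ∧ β c b ^ 2 < 1 ∧
      ∃ y, β y y < 0 ∧ β a y = β b y ∧ β b y = β c y := by
    intro n
    induction n using Nat.strong_induction_on with
    | _ n ih =>
      intro a ha b hb y hy hay hby hne hn
      have hvol : ∀ u, β u (cross e a b) = vol e a b u := fun u => by rw [he.symm, he.cross_left]
      -- Moving along the cross product keeps contact with `a` and `b` until a third line `c` is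
      -- touched.
      obtain ⟨c, hc, hcpos, s, hys, hcs⟩ := exists_push hSfin (δ := cross e a b) hy (by
        obtain ⟨c, hc⟩ := hne
        exact ⟨c, hc.1, by rw [hvol]; exact hc.2⟩)
      rw [hvol] at hcpos
      obtain ⟨z, hz⟩ : ∃ z, z = y + s • cross e a b := ⟨_, rfl⟩
      rw [← hz] at hys hcs
      have haz : β a z = -1 := by
        rw [hz]; simp only [map_add, map_smul, smul_eq_mul, hvol, vol_left_self]; linarith
      have hbz : β b z = -1 := by
        rw [hz]; simp only [map_add, map_smul, smul_eq_mul, hvol, vol_right_self]; linarith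
      have hca : c ≠ a := by rintro rfl; rw [vol_left_self] at hcpos; exact lt_irrefl _ hcpos
      have hcb : c ≠ b := by rintro rfl; rw [vol_right_self] at hcpos; exact lt_irrefl _ hcpos
      have hab : a ≠ b := by rintro rfl; simp [vol] at hcpos; nlinarith
      have hfin : {c ∈ S | 0 < vol e a b c}.Finite := hSfin.subset fun u hu => hu.1
      -- the chords from `c` to `a` and `b` cut off less
      have sub1 : {x ∈ S | 0 < vol e c b x} ⊆ {x ∈ S | 0 < vol e a b x} := by
        rintro x ⟨hx, hxv⟩
        refine ⟨hx, ?_⟩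
        by_contra hcon
        push Not at hcon
        -- A normal beyond `cb` but not beyond `ab` would, by Cramer's rule, make a multiple of `b`
        -- a forbidden combination of `x`, `a`, `c`.
        refine comb b hb x hx a ha c hc ?_ hab hcb (vol e a x c) (vol e a b c) (vol e c b x)
          (-vol e a b x) hcpos hxv.le (by linarith) ?_
        · rintro rfl; rw [vol_right_self] at hxv; exact lt_irrefl _ hxv
        · have h3 := vol_smul_eq (e := e) a b c x
          have h4 : vol e x b c = -vol e c b x := by simp only [vol]; ring
          rw [h4] at h3
          rw [h3]; module
      have sub2 : {x ∈ S | 0 < vol e a c x} ⊆ {x ∈ S | 0 < vol e a b x} := by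
        rintro x ⟨hx, hxv⟩
        refine ⟨hx, ?_⟩
        by_contra hcon
        push Not at hcon
        refine comb a ha x hx b hb c hc ?_ hab.symm hca (vol e x b c) (vol e a b c) (vol e a c x)
          (-vol e a b x) hcpos hxv.le (by linarith) ?_
        · rintro rfl; rw [vol_left_self] at hxv; exact lt_irrefl _ hxv
        · have h3 := vol_smul_eq (e := e) a b c x
          have h4 : vol e a x c = -vol e a c x := by simp only [vol]; ring
          rw [h4] at h3
          rw [h3]; module
      by_cases hN1 : {x ∈ S | 0 < vol e c b x}.Nonempty
      · refine ih _ ?_ c hc b hb z hys hcs hbz hN1 rfl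
        rw [← hn]
        refine Set.ncard_lt_ncard ?_ hfin
        rw [Set.ssubset_iff_of_subset sub1]
        exact ⟨c, ⟨hc, hcpos⟩, fun h => by
          have := h.2; rw [vol_left_self] at this; exact lt_irrefl _ this⟩
      by_cases hN2 : {x ∈ S | 0 < vol e a c x}.Nonempty
      · refine ih _ ?_ a ha c hc z hys haz hcs hN2 rfl
        rw [← hn]
        refine Set.ncard_lt_ncard ?_ hfin
        rw [Set.ssubset_iff_of_subset sub2]
        exact ⟨c, ⟨hc, hcpos⟩, fun h => by
          have := h.2; rw [vol_right_self] at this; exact lt_irrefl _ this⟩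
      -- now `c` is adjacent to both `a` and `b`
      have adj : ∀ p ∈ S, ∀ q ∈ S, ∀ r, vol e p q r ≠ 0 → ¬{x ∈ S | 0 < vol e p q x}.Nonempty →
          β p q ^ 2 < 1 := by
        intro p hp q hq r hr hpq
        have h3 : ∀ u, β u (cross e p q) = vol e p q u := fun u => by rw [he.symm, he.cross_left]
        have h4 : β (cross e p q) (cross e p q) < 0 := by
          apply hS
          · intro h0
            apply hr
            rw [← h3, h0, map_zero]
          · intro u hu
            rw [h3]
            by_contra hcon
            push Not at hcon
            exact hpq ⟨u, hu, hcon⟩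
        have h5 := he.cauchy_strict (a := p) (b := q) h4 (by rw [h3, vol_left_self])
          (by rw [h3, vol_right_self]) (by
            rw [h1 p (hSR hp), one_smul]
            intro h0
            apply hr
            obtain ⟨k, hk⟩ : ∃ k : ℝ, q = k • p := ⟨_, sub_eq_zero.mp h0⟩
            rw [hk]
            simp only [vol, map_smul, Finsupp.smul_apply, smul_eq_mul]
            ring)
        rwa [h1 p (hSR hp), h1 q (hSR hq), one_mul] at h5
      refine ⟨a, ha, b, hb, c, hc, hcpos.ne', adj a ha c hc b ?_ hN2, adj c hc b hb a ?_ hN1, z,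
        hS z ?_ fun u hu => (hys u hu).trans (by norm_num), by rw [haz, hbz], by rw [hbz, hcs]⟩
      · have : vol e a c b = -vol e a b c := by simp only [vol]; ring
        rw [this]; linarith
      · have : vol e c b a = -vol e a b c := by simp only [vol]; ring
        rw [this]; linarith
      · rintro rfl; simp at haz
  -- a first chord
  have hSne : S.Nonempty := by
    by_contra hcon
    rw [Set.not_nonempty_iff_eq_empty] at hcon
    have h3 := hS (e 1) (e.ne_zero 1) (by simp [hcon])
    rw [he] at h3
    simp at h3
    linarith
  obtain ⟨a, ha, hmax⟩ := Set.exists_max_image S (fun u => β u o) hSfin hSne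
  have hao := hneg a (hSR ha)
  -- The largest inscribed circle centered at `o`: it touches the line `a` nearest to `o`.
  obtain ⟨y, hy⟩ : ∃ y, y = (-β a o)⁻¹ • o := ⟨_, rfl⟩
  have hyle : ∀ u ∈ S, β u y ≤ -1 := by
    intro u hu
    have := hmax u hu
    rw [hy, map_smul, smul_eq_mul, inv_mul_le_iff₀ (by linarith)]
    linarith
  have hay : β a y = -1 := by
    rw [hy, map_smul, smul_eq_mul, inv_neg, neg_mul, inv_mul_cancel₀ hao.ne]
  have hvol : ∀ u, β u (cross e a o) = vol e a o u := fun u => by rw [he.symm, he.cross_left]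
  have hpos : 0 < β (cross e a o) (cross e a o) := by
    have h3 : β (cross e a o) (cross e a o) = β a o ^ 2 - β a a * β o o := by
      rw [he (cross e a o), repr_cross, repr_cross, repr_cross, he a o, he a a, he o o]
      simp
      ring
    rw [h3, h1 a (hSR ha), ho]
    nlinarith [sq_nonneg (β a o)]
  -- This direction is orthogonal to `a`, so contact with `a` persists, and it is space-like, so it
  -- leaves the cone and a second line `b` is touched.
  obtain ⟨b, hb, hbpos, s, hys, hbs⟩ := exists_push hSfin (δ := cross e a o) hyle (by
    by_contra hcon
    push Not at hcon
    refine absurd (hS (cross e a o) ?_ hcon) (not_lt.mpr hpos.le)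
    intro h0
    rw [h0] at hpos
    simp at hpos)
  rw [hvol] at hbpos
  obtain ⟨z, hz⟩ : ∃ z, z = y + s • cross e a o := ⟨_, rfl⟩
  rw [← hz] at hys hbs
  have haz : β a z = -1 := by
    rw [hz]; simp only [map_add, map_smul, smul_eq_mul, hvol, vol_left_self]; linarith
  have conclude : ∃ a ∈ S, ∃ b ∈ S, ∃ c ∈ S, vol e a b c ≠ 0 ∧ β a c ^ 2 < 1 ∧ β c b ^ 2 < 1 ∧
      ∃ y, β y y < 0 ∧ β a y = β b y ∧ β b y = β c y := by
    by_cases hN1 : {x ∈ S | 0 < vol e a b x}.Nonempty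
    · exact main _ a ha b hb z hys haz hbs hN1 rfl
    by_cases hN2 : {x ∈ S | 0 < vol e b a x}.Nonempty
    · exact main _ b hb a ha z hys hbs haz hN2 rfl
    -- All normals would be orthogonal to the time-like `n = cross e a b`. Then the component of `o`
    -- orthogonal to `n` is in the cone without being time-like.
    exfalso
    have h3 : ∀ u ∈ S, β u (cross e a b) = 0 := by
      intro u hu
      rw [he.symm, he.cross_left]
      apply le_antisymm
      · by_contra hcon
        push Not at hcon
        exact hN1 ⟨u, hu, hcon⟩
      · by_contra hcon
        push Not at hcon
        exact hN2 ⟨u, hu, by rw [vol_swap]; linarith⟩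
    have h4 : β (cross e a b) o ≠ 0 := by
      rw [he.cross_left]
      have : vol e a b o = -vol e a o b := by simp only [vol]; ring
      rw [this]; linarith
    have h5 : β (cross e a b) (cross e a b) < 0 := by
      apply hS
      · intro h0; rw [h0] at h4; simp at h4
      · intro u hu; exact (h3 u hu).le
    obtain ⟨n, hn⟩ : ∃ n, n = cross e a b := ⟨_, rfl⟩
    rw [← hn] at h3 h4 h5
    have h6 := he.reverse_cauchy (x := n) (y := o) (by rw [ho]; norm_num)
    have h7 := hS (o - (β n o / β n n) • n) (by
      intro h0
      have h8 := congrArg (β a) h0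
      simp only [map_sub, map_smul, smul_eq_mul, h3 a ha, mul_zero, sub_zero, map_zero] at h8
      linarith) (by
      intro u hu
      simp only [map_sub, map_smul, smul_eq_mul, h3 u hu, mul_zero, sub_zero]
      exact (hneg u (hSR hu)).le)
    simp only [map_sub, map_smul, LinearMap.sub_apply, LinearMap.smul_apply, smul_eq_mul, ho,
      he.symm o n] at h7
    rw [ho] at h6
    have h8 : β n n ≠ 0 := h5.ne
    have h9 : -1 - β n o / β n n * β n o - β n o / β n n * (β n o - β n o / β n n * β n n) =
      (-β n n - β n o ^ 2) / β n n := by field_simp; ring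
    have h10 : 0 ≤ (-β n n - β n o ^ 2) / β n n :=
      div_nonneg_of_nonpos (by linarith) h5.le
    linarith
  obtain ⟨a, ha, b, hb, c, hc, h⟩ := conclude
  exact ⟨a, hSR ha, b, hSR hb, c, hSR hc, h⟩

/-- The bound for the inner product of the neighbors of a short edge. -/
theorem IsLorentzBasis.short_bound (he : IsLorentzBasis β e) {a b c y : W} (ha : β a a = 1)
    (hb : β b b = 1) (hc : β c c = 1) (hy : β y y < 0) (hab : β a y = β b y) (hbc : β b y = β c y)
    {k : ℝ} (h1 : -β a c ≤ k) (h2 : -β c b ≤ k) : β a b ≤ 1 ∧ -β a b ≤ 3 + 4 * k := by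
  have hk : ∀ u v : W, β u u = 1 → β v v = 1 → β u y = β v y → β u v ≤ 1 := by
    intro u v hu hv huv
    have h3 := he.nonneg_of_orthogonal (a := u - v) hy (by simp [huv])
    simp only [map_sub, LinearMap.sub_apply, hu, hv] at h3
    rw [he.symm v u] at h3
    linarith
  have hac := hk a c ha hc (hab.trans hbc)
  have hcb := hk c b hc hb hbc.symm
  refine ⟨hk a b ha hb hab, ?_⟩
  -- Both differences lie in `y^⊥` and have norm at most `2(1 + k)`. Expanding their product gives
  -- `-a·b ≤ 1 + 2k + 2(1 + k) = 3 + 4k`.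
  have h4 := he.cauchy (a := a - c) (b := c - b) hy (by simp [hab, hbc]) (by simp [hbc])
  simp only [map_sub, LinearMap.sub_apply, ha, hb, hc] at h4
  rw [he.symm c a, he.symm b c] at h4
  have h5 : (-β a b - 1 + β a c + β c b) ^ 2 ≤ (2 * (1 + k)) ^ 2 := by
    have : (1 - β a c) * (1 - β c b) ≤ (1 + k) * (1 + k) :=
      mul_le_mul (by linarith) (by linarith) (by linarith) (by linarith)
    nlinarith
  have h6 := abs_le_of_sq_le_sq' h5 (by linarith)
  by_contra hcon
  push Not at hcon
  nlinarith [h6.2]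

end Minkowski

/-! ### Integers and conjugation in a real quadratic field. -/

namespace QuadField

/-- In lowest terms the square of the denominator of `r` divides `d`. -/
theorem _root_.Rat.exists_int_of_squarefree_mul_sq {d : ℕ} (hd : Squarefree d) {r : ℚ} {N : ℤ}
    (h : (d : ℚ) * r ^ 2 = N) : ∃ n : ℤ, r = n := by
  have h1 : (d : ℤ) * r.num ^ 2 = N * (r.den : ℤ) ^ 2 := by
    have h2 : (r.den : ℚ) ≠ 0 := by exact_mod_cast r.den_nz
    have h3 : r = r.num / r.den := (Rat.num_div_den r).symm
    rw [h3] at h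
    field_simp at h
    have h4 : (d : ℚ) * (r.num : ℚ) ^ 2 = N * (r.den : ℚ) ^ 2 := by linarith
    exact_mod_cast h4
  have h2 : (r.den : ℤ) ^ 2 ∣ (d : ℤ) * r.num ^ 2 := ⟨N, by rw [h1]; ring⟩
  have h3 : IsCoprime ((r.den : ℤ) ^ 2) (r.num ^ 2) := by
    apply IsCoprime.pow
    rw [Int.isCoprime_iff_gcd_eq_one, Int.gcd_comm]
    exact r.reduced
  have h4 : (r.den : ℤ) ^ 2 ∣ (d : ℤ) := h3.dvd_of_dvd_mul_right h2
  have h5 : r.den * r.den ∣ d := by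
    rw [← sq]; exact_mod_cast h4
  have h6 : r.den = 1 := Nat.isUnit_iff.mp (hd _ h5)
  exact ⟨r.num, (Rat.den_eq_one_iff r).mp h6 |>.symm⟩

variable {F : Type*} [Field F] [NumberField F]

/-- `F = ℚ(s)` with `s² = d`, where `d > 1` is squarefree, and `σ` is the nontrivial
automorphism. -/
structure IsConj (d : ℕ) (s : F) (σ : F ≃ₐ[ℚ] F) : Prop where
  squarefree : Squarefree d
  one_lt : 1 < d
  sq : s ^ 2 = (d : F)
  map : σ s = -s
  gen : ∀ x : F, ∃ p q : ℚ, x = p + q * s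

variable {d : ℕ} {s : F} {σ : F ≃ₐ[ℚ] F}

/-- A squarefree `d > 1` is not a square in `ℚ`, so `X² - d` is the minimal polynomial of `s` and
`-s` is its other root. -/
theorem exists_isConj (hd : Squarefree d) (hd1 : 1 < d) (hs : s ^ 2 = (d : F)) (hF : ℚ⟮s⟯ = ⊤) :
    ∃ σ : F ≃ₐ[ℚ] F, IsConj d s σ := by
  have hgen : ∀ x : F, ∃ p q : ℚ, x = p + q * s := by
    intro x
    have hx : x ∈ Algebra.adjoin ℚ {s} := by
      have h1 : (ℚ⟮s⟯).toSubalgebra = Algebra.adjoin ℚ {s} :=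
        IntermediateField.adjoin_simple_toSubalgebra_of_isAlgebraic (Algebra.IsAlgebraic.isAlgebraic s)
      rw [← h1, hF]
      trivial
    induction hx using Algebra.adjoin_induction with
    | mem x hx =>
      rw [Set.mem_singleton_iff] at hx
      exact ⟨0, 1, by simp [hx]⟩
    | algebraMap r => exact ⟨r, 0, by simp⟩
    | add x y _ _ hx hy =>
      obtain ⟨p, q, rfl⟩ := hx
      obtain ⟨p', q', rfl⟩ := hy
      exact ⟨p + p', q + q', by push_cast; ring⟩
    | mul x y _ _ hx hy =>
      obtain ⟨p, q, rfl⟩ := hx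
      obtain ⟨p', q', rfl⟩ := hy
      refine ⟨p * p' + d * (q * q'), p * q' + q * p', ?_⟩
      push_cast
      rw [← hs]; ring
  have hns : ∀ q : ℚ, q ^ 2 ≠ d := by
    intro q hq
    have h1 : IsSquare d := Rat.isSquare_natCast_iff.mp ⟨q, by rw [← hq, pow_two]⟩
    obtain ⟨m, rfl⟩ := h1
    have := Nat.isUnit_iff.mp (hd m dvd_rfl)
    rw [this] at hd1
    omega
  have hsint : IsIntegral ℚ s := Algebra.IsIntegral.isIntegral s
  have hmin : minpoly ℚ s = Polynomial.X ^ 2 - Polynomial.C (d : ℚ) := by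
    symm
    apply minpoly.eq_of_irreducible_of_monic
    · exact (X_pow_sub_C_irreducible_iff_of_prime Nat.prime_two).mpr hns
    · simp [hs]
    · exact Polynomial.monic_X_pow_sub_C _ two_ne_zero
  let pb : PowerBasis ℚ F :=
    (IntermediateField.adjoin.powerBasis hsint).map
      ((IntermediateField.equivOfEq hF).trans IntermediateField.topEquiv)
  have hgens : pb.gen = s := by
    simp [pb]
  let f : F →ₐ[ℚ] F := pb.lift (-s) (by
    rw [hgens, hmin]; simp [hs])
  have hf : f s = -s := by
    conv_lhs => rw [← hgens]
    exact pb.lift_gen _ _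
  refine ⟨AlgEquiv.ofBijective f (Algebra.IsAlgebraic.algHom_bijective f), hd, hd1, hs, hf, hgen⟩

namespace IsConj

theorem map_eq (h : IsConj d s σ) (p q : ℚ) : σ (p + q * s) = p - q * s := by
  rw [map_add, map_mul, h.map, map_ratCast, map_ratCast]; ring

theorem s_ne_zero (h : IsConj d s σ) : s ≠ 0 := by
  intro h0
  have h1 := h.sq
  rw [h0] at h1
  have : (d : F) ≠ 0 := by exact_mod_cast (by have := h.one_lt; omega)
  apply this
  rw [← h1]; ring

theorem ne_one (h : IsConj d s σ) : σ ≠ 1 := by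
  intro h0
  have h1 := h.map
  rw [h0] at h1
  have h2 : (2 : F) * s = 0 := by
    have : s = -s := h1
    linear_combination this
  rcases mul_eq_zero.mp h2 with h3 | h3
  · exact two_ne_zero h3
  · exact h.s_ne_zero h3

theorem exists_int_of_isIntegral {p : ℚ} (hp : IsIntegral ℤ (p : F)) : ∃ m : ℤ, p = m := by
  have h1 : IsIntegral ℤ p := by
    have h2 : IsIntegral ℤ (algebraMap ℚ F p) := by simpa using hp
    exact (isIntegral_algebraMap_iff (algebraMap ℚ F).injective).mp h2
  obtain ⟨m, hm⟩ := IsIntegrallyClosed.isIntegral_iff.mp h1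
  exact ⟨m, by rw [← hm]; simp⟩

/-- The integers of a quadratic field. -/
theorem integer_form (h : IsConj d s σ) {x : F} (hx : IsIntegral ℤ x) :
    ∃ m n N : ℤ, 2 * x = m + n * s ∧ m ^ 2 - d * n ^ 2 = 4 * N := by
  obtain ⟨p, q, hpq⟩ := h.gen x
  have hσ : IsIntegral ℤ (σ x) := hx.map σ.toAlgHom.toIntAlgHom
  have h1 : IsIntegral ℤ (((2 * p : ℚ)) : F) := by
    have := hx.add hσ
    rw [hpq, h.map_eq] at this
    have e1 : ((2 * p : ℚ) : F) = p + q * s + (p - q * s) := by push_cast; ring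
    rwa [e1]
  have h2 : IsIntegral ℤ (((p ^ 2 - d * q ^ 2 : ℚ)) : F) := by
    have := hx.mul hσ
    rw [hpq, h.map_eq] at this
    have e1 : ((p ^ 2 - d * q ^ 2 : ℚ) : F) = (p + q * s) * (p - q * s) := by
      push_cast; rw [← h.sq]; ring
    rwa [e1]
  obtain ⟨m, hm⟩ := exists_int_of_isIntegral h1
  obtain ⟨N, hN⟩ := exists_int_of_isIntegral h2
  -- Trace `2p = m` and norm `N` are integers, hence so is `d(2q)² = m² - 4N`.
  obtain ⟨n, hn⟩ := Rat.exists_int_of_squarefree_mul_sq h.squarefree (r := 2 * q)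
    (N := m ^ 2 - 4 * N) (by push_cast; rw [← hm, ← hN]; ring)
  refine ⟨m, n, N, ?_, ?_⟩
  · have h3 : (m : F) = ((2 * p : ℚ) : F) := by rw [hm]; norm_cast
    have h4 : (n : F) = ((2 * q : ℚ) : F) := by rw [hn]; norm_cast
    rw [h3, h4, hpq]; push_cast; ring
  · have : (m : ℚ) ^ 2 - d * (n : ℚ) ^ 2 = 4 * N := by rw [← hm, ← hn, ← hN]; ring
    exact_mod_cast this

/-- An element whose square is an integer smaller than `d` is fixed by the conjugation. -/
theorem map_eq_of_sq (h : IsConj d s σ) {x : F} {N : ℤ} (hx : x ^ 2 = N) (hN : N < d) :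
    σ x = x := by
  have h1 : (σ x - x) * (σ x + x) = 0 := by
    have h2 := congrArg σ hx
    rw [map_pow, map_intCast] at h2
    linear_combination h2 - hx
  rcases mul_eq_zero.mp h1 with h2 | h2
  · exact sub_eq_zero.mp h2
  obtain ⟨p, q, rfl⟩ := h.gen x
  rw [h.map_eq] at h2
  have hp : (p : F) = 0 := by
    have : (2 : F) * p = 0 := by linear_combination h2
    exact (mul_eq_zero.mp this).resolve_left two_ne_zero
  rw [hp] at hx ⊢
  -- If `σ x = -x`, then `x = q s` with `d q² = N < d`, where `q` is an integer; so `q = 0`.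
  have h3 : (d : ℚ) * q ^ 2 = N := by
    have : (((d : ℚ) * q ^ 2 : ℚ) : F) = ((N : ℚ) : F) := by
      push_cast; rw [← hx, ← h.sq]; ring
    exact_mod_cast this
  obtain ⟨n, rfl⟩ := Rat.exists_int_of_squarefree_mul_sq h.squarefree h3
  have h4 : (d : ℤ) * n ^ 2 = N := by exact_mod_cast h3
  have h5 : n = 0 := by
    by_contra hn
    have : 0 < n ^ 2 := by positivity
    nlinarith
  rw [h5]; simp

variable [Algebra F ℝ]

theorem real_sq (h : IsConj d s σ) : (algebraMap F ℝ s) ^ 2 = d := by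
  rw [← map_pow, h.sq, map_natCast]

/-- An integer that is close to its conjugate is rational. -/
theorem eq_int_of_close (h : IsConj d s σ) {x : F} (hx : IsIntegral ℤ x) {M : ℝ}
    (hM : |algebraMap F ℝ x - algebraMap F ℝ (σ x)| ≤ M)
    (hMd : M ^ 2 < d ∨ (d % 4 = 2 ∨ d % 4 = 3) ∧ M ^ 2 < 4 * d) : ∃ m : ℤ, x = m := by
  obtain ⟨m, n, N, h1, h2⟩ := h.integer_form hx
  have h3 : 2 * σ x = m - n * s := by
    have := congrArg σ h1
    rw [map_add, map_mul, map_mul, h.map, map_ofNat, map_intCast, map_intCast] at this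
    rw [this]; ring
  have h4 : x - σ x = n * s := by
    have : (2 : F) * (x - σ x) = 2 * (n * s) := by rw [mul_sub, h1, h3]; ring
    exact mul_left_cancel₀ two_ne_zero this
  have h5 : (n : ℝ) ^ 2 * d ≤ M ^ 2 := by
    rw [← map_sub, h4, map_mul, map_intCast] at hM
    rw [← h.real_sq, ← mul_pow, ← sq_abs]
    exact pow_le_pow_left₀ (abs_nonneg _) hM 2
  have hn : n = 0 := by
    by_contra hn
    have hn1 : 1 ≤ n ^ 2 := by
      have : 0 < n ^ 2 := by positivity
      omega
    have hd0 : (0 : ℝ) < d := by exact_mod_cast (by have := h.one_lt; omega : 0 < d)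
    rcases hMd with hMd | ⟨hmod, hMd⟩
    · have : (1 : ℝ) ≤ (n : ℝ) ^ 2 := by exact_mod_cast hn1
      nlinarith
    -- If `n` were odd, then `m² ≡ d n² ≡ d ≡ 2, 3 mod 4`, which is no square. So the difference is
    -- an even multiple of `√d`, and `M² < 4d` suffices.
    · have hn2 : 2 ∣ n := by
        by_contra hodd
        have e1 : n ^ 2 % 4 = 1 := by
          have : n % 4 = 1 ∨ n % 4 = 3 := by omega
          rcases this with h | h <;> simp [pow_two, Int.mul_emod, h]
        have e2 : m ^ 2 % 4 = 0 ∨ m ^ 2 % 4 = 1 := by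
          have : m % 4 = 0 ∨ m % 4 = 1 ∨ m % 4 = 2 ∨ m % 4 = 3 := by omega
          rcases this with h | h | h | h <;> simp [pow_two, Int.mul_emod, h]
        have e3 : ((d : ℤ) * n ^ 2) % 4 = (d : ℤ) % 4 := by
          rw [Int.mul_emod, e1]; simp
        omega
      obtain ⟨k, hk⟩ := hn2
      have hk1 : (1 : ℝ) ≤ (k : ℝ) ^ 2 := by
        have : k ≠ 0 := by rintro rfl; simp at hk; exact hn hk
        have : 0 < k ^ 2 := by positivity
        exact_mod_cast (by omega : 1 ≤ k ^ 2)
      rw [hk] at h5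
      push_cast at h5
      nlinarith
  rw [hn] at h1
  have h6 : x = ((m / 2 : ℚ) : F) := by
    have h7 : (2 : F) * x = 2 * ((m / 2 : ℚ) : F) := by rw [h1]; push_cast; ring
    exact mul_left_cancel₀ two_ne_zero h7
  rw [h6] at hx
  obtain ⟨k, hk⟩ := exists_int_of_isIntegral hx
  exact ⟨k, by rw [h6, hk]; norm_cast⟩

end IsConj

end QuadField

/-! ### Inner products of roots: the gap and the Gram determinant. -/

namespace QuadLattice

open Minkowski QuadField

section RealForm

variable {F : Type*} [Field F] [Algebra F ℝ] {V : Type*} [AddCommGroup V] [Module F V]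
  {B : LinearMap.BilinForm F V}

theorem realForm_toReal (v w : V) :
    realForm B (toReal v) (toReal w) = algebraMap F ℝ (B v w) := by
  simp [realForm, toReal, LinearMap.BilinForm.baseChange_tmul, Algebra.algebraMap_eq_smul_one]

theorem form_smul {c c' : ℝ} {r r' : V} :
    realForm B (c • toReal r) (c' • toReal r') = c * c' * algebraMap F ℝ (B r r') := by
  simp only [map_smul, LinearMap.smul_apply, smul_eq_mul, realForm_toReal]; ring

theorem unit_mul {u : RealSpace F V} {c : ℝ} {r : V} (hu : realForm B u u = 1)
    (h : u = c • toReal r) : c ^ 2 * algebraMap F ℝ (B r r) = 1 := by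
  rw [h] at hu
  simp only [map_smul, LinearMap.smul_apply, smul_eq_mul, realForm_toReal] at hu
  rw [← hu]; ring

theorem unit_ne_zero {u : RealSpace F V} {c : ℝ} {r : V} (hu : realForm B u u = 1)
    (h : u = c • toReal r) : c ≠ 0 ∧ B r r ≠ 0 := by
  have h1 := unit_mul hu h
  constructor
  · rintro rfl; simp at h1
  · intro h0; rw [h0] at h1; simp at h1

end RealForm

variable {F : Type*} [Field F] [NumberField F] [Algebra F ℝ]
variable {V : Type*} [AddCommGroup V] [Module F V]
variable {B : LinearMap.BilinForm F V} {d : ℕ} {s : F} {σ : F ≃ₐ[ℚ] F} {ε : ℝ}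

theorem IsArithmetic.exists_sign (h : IsArithmetic B) (hσ : σ ≠ 1) :
    ∃ ε : ℝ, ∀ v : V, v ≠ 0 → 0 < ε * algebraMap F ℝ (σ (B v v)) := by
  rcases h σ hσ with h | h
  · exact ⟨1, fun v hv => by rw [one_mul]; exact h v hv⟩
  · exact ⟨-1, fun v hv => by rw [neg_one_mul]; exact neg_pos.mpr (h v hv)⟩

/-- The vector `(v·v)w - (v·w)v` has norm `v·v` times the determinant, and definiteness gives the
conjugates of both norms the same sign. -/
theorem conj_cauchy (hB : B.IsSymm) (hε : ∀ v : V, v ≠ 0 → 0 < ε * algebraMap F ℝ (σ (B v v)))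
    {v w : V} (hvw : B v v • w - B v w • v ≠ 0) :
    0 < algebraMap F ℝ (σ (B v v * B w w - B v w ^ 2)) := by
  have hv : v ≠ 0 := by rintro rfl; simp at hvw
  have h1 := hε v hv
  have h2 := hε _ hvw
  have h3 : B (B v v • w - B v w • v) (B v v • w - B v w • v) =
      B v v * (B v v * B w w - B v w ^ 2) := by
    simp only [map_sub, map_smul, LinearMap.sub_apply, LinearMap.smul_apply, smul_eq_mul]
    rw [hB.eq w v]; ring
  rw [h3, map_mul, map_mul, ← mul_assoc] at h2
  exact (mul_pos_iff_of_pos_left h1).mp h2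

/-- The component `w` of `r₃` orthogonal to `r₁` and `r₂`, scaled by `D` to avoid division, has norm
`D G`, and `σ D` is positive. -/
theorem conj_gram (hB : B.IsSymm) (hε : ∀ v : V, v ≠ 0 → 0 < ε * algebraMap F ℝ (σ (B v v)))
    {r₁ r₂ r₃ : V} {D G : F} (hD : D = B r₁ r₁ * B r₂ r₂ - B r₁ r₂ ^ 2) (hD0 : D ≠ 0)
    (hG : G = B r₁ r₁ * B r₂ r₂ * B r₃ r₃ + 2 * B r₁ r₂ * B r₂ r₃ * B r₁ r₃
      - B r₁ r₁ * B r₂ r₃ ^ 2 - B r₂ r₂ * B r₁ r₃ ^ 2 - B r₃ r₃ * B r₁ r₂ ^ 2) (hG0 : G ≠ 0) :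
    0 < ε * algebraMap F ℝ (σ G) := by
  have hb21 := hB.eq r₂ r₁
  have hb31 := hB.eq r₃ r₁
  have hb32 := hB.eq r₃ r₂
  have hTD : 0 < algebraMap F ℝ (σ D) := by
    rw [hD]
    refine conj_cauchy hB hε ?_
    intro h0
    have h1 := congrArg (fun w => B w r₂) h0
    simp only [map_sub, map_smul, LinearMap.sub_apply, LinearMap.smul_apply, smul_eq_mul, map_zero,
      LinearMap.zero_apply] at h1
    apply hD0
    rw [hD, ← h1]; ring
  obtain ⟨x, hx⟩ : ∃ x, x = B r₁ r₃ * B r₂ r₂ - B r₁ r₂ * B r₂ r₃ := ⟨_, rfl⟩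
  obtain ⟨y, hy⟩ : ∃ y, y = B r₁ r₁ * B r₂ r₃ - B r₁ r₂ * B r₁ r₃ := ⟨_, rfl⟩
  obtain ⟨w, hw⟩ : ∃ w, w = D • r₃ - x • r₁ - y • r₂ := ⟨_, rfl⟩
  have hBw : ∀ v, B w v = D * B r₃ v - x * B r₁ v - y * B r₂ v := fun v => by
    rw [hw]
    simp only [map_sub, map_smul, LinearMap.sub_apply, LinearMap.smul_apply, smul_eq_mul]
  have hw3 : B w r₃ = G := by rw [hBw, hG, hD, hx, hy]; ring
  have hw0 : w ≠ 0 := by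
    intro h0
    rw [h0, map_zero, LinearMap.zero_apply] at hw3
    exact hG0 hw3.symm
  have hww : B w w = D * G := by
    have h1 : B w r₁ = 0 := by rw [hBw, hb31, hb21, hD, hx, hy]; ring
    have h2 : B w r₂ = 0 := by rw [hBw, hb32, hD, hx, hy]; ring
    have h3 := congrArg (B w) hw
    simp only [map_sub, map_smul, smul_eq_mul, h1, h2, hw3, mul_zero, sub_zero] at h3
    exact h3
  have hεw := hε w hw0
  rw [hww, map_mul, map_mul] at hεw
  refine (mul_pos_iff_of_pos_left hTD).mp ?_
  linarith

/-- The normalized Gram determinant of three vectors with pairwise inner products as above is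
rational over the fixed field of the conjugation. -/
theorem _root_.QuadField.IsConj.exists_gram (hσ : IsConj d s σ) (hd : 27 < d)
    {b₁₁ b₂₂ b₃₃ b₁₂ b₂₃ b₁₃ : F} (hr0₁ : b₁₁ ≠ 0) (hr0₂ : b₂₂ ≠ 0) (hr0₃ : b₃₃ ≠ 0)
    {c₁ c₂ c₃ x y z v : ℝ} (e1 : c₁ ^ 2 * algebraMap F ℝ b₁₁ = 1)
    (e2 : c₂ ^ 2 * algebraMap F ℝ b₂₂ = 1) (e3 : c₃ ^ 2 * algebraMap F ℝ b₃₃ = 1)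
    (f12 : x = c₁ * c₂ * algebraMap F ℝ b₁₂) (f23 : y = c₂ * c₃ * algebraMap F ℝ b₂₃)
    (f13 : z = c₁ * c₃ * algebraMap F ℝ b₁₃)
    (h₁₂ : ∃ m : ℤ, 0 ≤ m ∧ m ≤ 3 ∧ 4 * x ^ 2 = m) (h₂₃ : ∃ m : ℤ, 0 ≤ m ∧ m ≤ 3 ∧ 4 * y ^ 2 = m)
    (h₁₃ : ∃ m : ℤ, 0 ≤ m ∧ m ≤ 3 ∧ 4 * z ^ 2 = m) (hv : v ≠ 0)
    (hgram : 1 + 2 * x * y * z - y ^ 2 - z ^ 2 - x ^ 2 = -v ^ 2) :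
    ∃ γ : F, σ γ = γ ∧ algebraMap F ℝ γ < 0 ∧
      γ * (b₁₁ * b₂₂ * b₃₃) = b₁₁ * b₂₂ * b₃₃ + 2 * b₁₂ * b₂₃ * b₁₃
      - b₁₁ * b₂₃ ^ 2 - b₂₂ * b₁₃ ^ 2 - b₃₃ * b₁₂ ^ 2 ∧ b₁₁ * b₂₂ - b₁₂ ^ 2 ≠ 0 := by
  obtain ⟨m, hm0, hm3, hm⟩ := h₁₂
  obtain ⟨n, hn0, hn3, hn⟩ := h₂₃
  obtain ⟨k, hk0, hk3, hk⟩ := h₁₃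
  have hTi : Function.Injective (algebraMap F ℝ) := (algebraMap F ℝ).injective
  -- `P = 8xyz` is the only part of the determinant not visibly rational. Its square is
  -- `(4x²)(4y²)(4z²) ≤ 27 < d`, so `σ` fixes it.
  obtain ⟨P, hP⟩ : ∃ P, P = 8 * b₁₂ * b₂₃ * b₁₃ / (b₁₁ * b₂₂ * b₃₃) := ⟨_, rfl⟩
  have hP' : P * (b₁₁ * b₂₂ * b₃₃) = 8 * b₁₂ * b₂₃ * b₁₃ := by
    rw [hP, div_mul_cancel₀ _ (mul_ne_zero (mul_ne_zero hr0₁ hr0₂) hr0₃)]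
  have hTP : algebraMap F ℝ P = 8 * x * y * z := by
    have h0 := congrArg (algebraMap F ℝ) hP'
    simp only [map_mul, map_ofNat] at h0
    have h1 : 8 * x * y * z = c₁ ^ 2 * c₂ ^ 2 * c₃ ^ 2 *
        (8 * algebraMap F ℝ b₁₂ * algebraMap F ℝ b₂₃ * algebraMap F ℝ b₁₃) := by
      rw [f12, f23, f13]; ring
    rw [h1, ← h0]
    have h2 : c₁ ^ 2 * c₂ ^ 2 * c₃ ^ 2 * (algebraMap F ℝ P *
        (algebraMap F ℝ b₁₁ * algebraMap F ℝ b₂₂ * algebraMap F ℝ b₃₃)) = algebraMap F ℝ P *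
        ((c₁ ^ 2 * algebraMap F ℝ b₁₁) * (c₂ ^ 2 * algebraMap F ℝ b₂₂) *
        (c₃ ^ 2 * algebraMap F ℝ b₃₃)) := by ring
    rw [h2, e1, e2, e3]; ring
  have hPsq : P ^ 2 = ((m * n * k : ℤ) : F) := by
    apply hTi
    rw [map_pow, hTP, map_intCast]
    push_cast
    rw [← hm, ← hn, ← hk]; ring
  have hPσ : σ P = P := by
    refine hσ.map_eq_of_sq hPsq ?_
    have h1 : m * n ≤ 9 := by nlinarith
    have h2 : m * n * k ≤ 27 := by nlinarith [mul_nonneg hm0 hn0]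
    have : (27 : ℤ) < d := by exact_mod_cast hd
    linarith
  have hsq : ∀ {a b f : F} {p q w : ℝ} {j : ℤ}, p ^ 2 * algebraMap F ℝ a = 1 →
      q ^ 2 * algebraMap F ℝ b = 1 → w = p * q * algebraMap F ℝ f → 4 * w ^ 2 = j →
      (j : F) * (a * b) = 4 * f ^ 2 := by
    intro a b f p q w j hp hq hw hj
    apply hTi
    simp only [map_mul, map_intCast, map_pow, map_ofNat]
    rw [← hj, hw]
    linear_combination (4 * algebraMap F ℝ f ^ 2 * q ^ 2 * algebraMap F ℝ b) * hp +
      (4 * algebraMap F ℝ f ^ 2) * hq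
  have hm' := hsq e1 e2 f12 hm
  have hn' := hsq e2 e3 f23 hn
  have hk' := hsq e1 e3 f13 hk
  -- This is `1 + 2xyz - x² - y² - z²`, the Gram determinant of the unit vectors.
  refine ⟨1 + P / 4 - (m + n + k) / 4, ?_, ?_, ?_, ?_⟩
  · simp only [map_sub, map_add, map_div₀, map_one, map_ofNat, hPσ, map_intCast]
  · have h1 : algebraMap F ℝ (1 + P / 4 - (m + n + k) / 4) = -v ^ 2 := by
      rw [← hgram]
      simp only [map_sub, map_add, map_div₀, map_one, map_ofNat, map_intCast, hTP]
      rw [← hm, ← hn, ← hk]; ring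
    rw [h1]
    exact neg_neg_of_pos (by positivity)
  · linear_combination hP' / 4 - b₃₃ * hm' / 4 - b₁₁ * hn' / 4 - b₂₂ * hk' / 4
  · intro h0
    have h1 : (4 - m : F) * (b₁₁ * b₂₂) = 0 := by linear_combination 4 * h0 - hm'
    have h4 : (4 - m : F) ≠ 0 := by
      have : (4 - m : ℤ) ≠ 0 := by omega
      exact_mod_cast this
    exact mul_ne_zero h4 (mul_ne_zero hr0₁ hr0₂) h1

section Roots

variable [Module (𝓞 F) V] {L : Submodule (𝓞 F) V}

/-- The unit vectors of the real space that are multiples of roots. -/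
def unitRoots (B : LinearMap.BilinForm F V) (L : Submodule (𝓞 F) V) : Set (RealSpace F V) :=
  {u | realForm B u u = 1 ∧ ∃ r, IsRoot B L r ∧ ∃ c : ℝ, u = c • toReal r}

/-- It is the product of the Cartan integers `2(r·t)/r²` and `2(r·t)/t²`, which the root condition
makes integral. -/
theorem IsRoot.isIntegral (hB : B.IsSymm) {r t : V} (hr : IsRoot B L r) (ht : IsRoot B L t) :
    IsIntegral ℤ (4 * B r t ^ 2 / (B r r * B t t)) := by
  obtain ⟨a, ha⟩ := hr.2.2 t ht.1.1
  obtain ⟨b, hb⟩ := ht.2.2 r hr.1.1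
  have hr0 : B r r ≠ 0 := by intro h; have := hr.2.1; rw [h] at this; simp at this
  have ht0 : B t t ≠ 0 := by intro h; have := ht.2.1; rw [h] at this; simp at this
  have h1 : 4 * B r t ^ 2 / (B r r * B t t) = ((a * b : 𝓞 F) : F) := by
    have h2 : B r t ^ 2 = (B r r / 2 * a) * (B t t / 2 * b) := by
      rw [← ha, ← hb, hB.eq t r]; ring
    rw [h2]
    push_cast
    field_simp
    norm_num
  rw [h1]
  exact NumberField.RingOfIntegers.isIntegral_coe _

/-- The normalized inner products of the roots that are not too large are those of two lines
that meet at an angle of `π/2`, `π/3`, `π/4` or `π/6`. -/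
theorem gap (hσ : IsConj d s σ) (hB : B.IsSymm)
    (hε : ∀ v : V, v ≠ 0 → 0 < ε * algebraMap F ℝ (σ (B v v))) {M : ℝ} (hM4 : 4 ≤ M)
    (hMd : M ^ 2 < d ∨ (d % 4 = 2 ∨ d % 4 = 3) ∧ M ^ 2 < 4 * d)
    {u t : RealSpace F V} (hu : u ∈ unitRoots B L) (ht : t ∈ unitRoots B L) (hne : u ≠ t)
    (hne' : u ≠ -t) (hut : 4 * realForm B u t ^ 2 ≤ M) :
    ∃ m : ℤ, 0 ≤ m ∧ m ≤ 3 ∧ 4 * realForm B u t ^ 2 = m := by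
  obtain ⟨hu1, r, hr, c, hc⟩ := hu
  obtain ⟨ht1, r', hr', c', hc'⟩ := ht
  have e1 := unit_mul hu1 hc
  have e2 := unit_mul ht1 hc'
  obtain ⟨hc0, hr0⟩ := unit_ne_zero hu1 hc
  obtain ⟨hc0', hr0'⟩ := unit_ne_zero ht1 hc'
  have hr0t : algebraMap F ℝ (B r r) ≠ 0 := by simpa using hr0
  have hr0t' : algebraMap F ℝ (B r' r') ≠ 0 := by simpa using hr0'
  have hA : 4 * realForm B u t ^ 2 = algebraMap F ℝ (4 * B r r' ^ 2 / (B r r * B r' r')) := by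
    rw [hc, hc', form_smul, map_div₀, map_mul, map_mul, map_pow, map_ofNat, eq_div_iff (by positivity)]
    linear_combination (4 * (algebraMap F ℝ (B r r')) ^ 2 * c' ^ 2 * algebraMap F ℝ (B r' r')) * e1
      + (4 * (algebraMap F ℝ (B r r')) ^ 2) * e2
  -- Proportional roots would have equal or opposite unit multiples; otherwise the conjugate
  -- Cauchy-Schwarz inequality is strict.
  have hvec : B r r • r' - B r r' • r ≠ 0 := by
    intro h0
    have h1 : r' = (B r r' / B r r) • r := by
      have h2 := sub_eq_zero.mp h0
      rw [div_eq_inv_mul, mul_smul, ← h2, smul_smul, inv_mul_cancel₀ hr0, one_smul]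
    have h2 : (toReal r' : RealSpace F V) = (algebraMap F ℝ (B r r' / B r r)) • toReal r := by
      conv_lhs => rw [h1]
      simp only [toReal, TensorProduct.tmul_smul]
      rw [Algebra.algebraMap_eq_smul_one, TensorProduct.smul_tmul', TensorProduct.smul_tmul',
        smul_eq_mul, mul_one]
    obtain ⟨k, hk⟩ : ∃ k : ℝ, t = k • u := by
      refine ⟨c' * algebraMap F ℝ (B r r' / B r r) * c⁻¹, ?_⟩
      rw [hc', hc, h2, smul_smul, smul_smul]
      congr 1
      field_simp
    have h3 : k ^ 2 = 1 := by
      rw [hk] at ht1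
      simp only [map_smul, LinearMap.smul_apply, smul_eq_mul, hu1] at ht1
      rw [← ht1]; ring
    rcases mul_self_eq_one_iff.mp ((pow_two k).symm.trans h3) with h | h
    · exact hne (by rw [hk, h, one_smul])
    · exact hne' (by
        have h4 : t = -u := by rw [hk, h]; exact neg_one_smul ℝ u
        rw [h4, neg_neg])
  have hcs := conj_cauchy hB hε hvec
  have hr00 : r ≠ 0 := by rintro rfl; simp at hr0
  have hr00' : r' ≠ 0 := by rintro rfl; simp at hr0'
  have hpp : 0 < algebraMap F ℝ (σ (B r r)) * algebraMap F ℝ (σ (B r' r')) := by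
    have h1 := mul_pos (hε r hr00) (hε r' hr00')
    have h2 : ε * algebraMap F ℝ (σ (B r r)) * (ε * algebraMap F ℝ (σ (B r' r'))) =
      ε ^ 2 * (algebraMap F ℝ (σ (B r r)) * algebraMap F ℝ (σ (B r' r'))) := by ring
    rw [h2] at h1
    exact pos_of_mul_pos_right h1 (sq_nonneg ε)
  have hA0 : 0 ≤ algebraMap F ℝ (σ (4 * B r r' ^ 2 / (B r r * B r' r'))) := by
    simp only [map_div₀, map_mul, map_pow, map_ofNat]
    positivity
  have hA4 : algebraMap F ℝ (σ (4 * B r r' ^ 2 / (B r r * B r' r'))) < 4 := by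
    simp only [map_div₀, map_mul, map_pow, map_ofNat]
    rw [div_lt_iff₀ hpp]
    simp only [map_sub, map_mul, map_pow] at hcs
    linarith
  rw [hA] at hut ⊢
  have hA0' : 0 ≤ algebraMap F ℝ (4 * B r r' ^ 2 / (B r r * B r' r')) := by
    rw [← hA]; positivity
  -- The number is in `[0, M]` and its conjugate in `[0, 4)`, and `4 ≤ M`, so they differ by at most
  -- `M`.
  obtain ⟨m, hm⟩ := hσ.eq_int_of_close (hr.isIntegral hB hr') (M := M) (by
    rw [abs_le]; constructor <;> linarith) hMd
  rw [hm, map_intCast, map_intCast] at hA0 hA4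
  refine ⟨m, by exact_mod_cast hA0, ?_, by rw [hm, map_intCast]⟩
  have : m < 4 := by exact_mod_cast hA4
  omega

/-- No three roots with such inner products are linearly independent. -/
theorem no_triangle (hσ : IsConj d s σ) (hd : 27 < d) (hB : B.IsSymm)
    (hε : ∀ v : V, v ≠ 0 → 0 < ε * algebraMap F ℝ (σ (B v v)))
    {e : Module.Basis (Fin 3) ℝ (RealSpace F V)} (he : IsLorentzBasis (realForm B) e)
    {u₁ u₂ u₃ : RealSpace F V} (h₁ : u₁ ∈ unitRoots B L) (h₂ : u₂ ∈ unitRoots B L)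
    (h₃ : u₃ ∈ unitRoots B L) (hvol : vol e u₁ u₂ u₃ ≠ 0)
    (h₁₂ : ∃ m : ℤ, 0 ≤ m ∧ m ≤ 3 ∧ 4 * realForm B u₁ u₂ ^ 2 = m)
    (h₂₃ : ∃ m : ℤ, 0 ≤ m ∧ m ≤ 3 ∧ 4 * realForm B u₂ u₃ ^ 2 = m)
    (h₁₃ : ∃ m : ℤ, 0 ≤ m ∧ m ≤ 3 ∧ 4 * realForm B u₁ u₃ ^ 2 = m) : False := by
  obtain ⟨h11, r₁, -, c₁, hc₁⟩ := h₁
  obtain ⟨h22, r₂, -, c₂, hc₂⟩ := h₂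
  obtain ⟨h33, r₃, -, c₃, hc₃⟩ := h₃
  have hgram := he.gram u₁ u₂ u₃
  rw [h11, h22, h33] at hgram
  have hr0₁ := (unit_ne_zero h11 hc₁).2
  have hr0₂ := (unit_ne_zero h22 hc₂).2
  have hr0₃ := (unit_ne_zero h33 hc₃).2
  have f12 : realForm B u₁ u₂ = c₁ * c₂ * algebraMap F ℝ (B r₁ r₂) := by rw [hc₁, hc₂, form_smul]
  have f23 : realForm B u₂ u₃ = c₂ * c₃ * algebraMap F ℝ (B r₂ r₃) := by rw [hc₂, hc₃, form_smul]
  have f13 : realForm B u₁ u₃ = c₁ * c₃ * algebraMap F ℝ (B r₁ r₃) := by rw [hc₁, hc₃, form_smul]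
  obtain ⟨γ, hγσ, hγ0, hG, hD0⟩ := hσ.exists_gram hd hr0₁ hr0₂ hr0₃ (unit_mul h11 hc₁)
    (unit_mul h22 hc₂) (unit_mul h33 hc₃) f12 f23 f13 h₁₂ h₂₃ h₁₃ hvol (by linarith)
  have hγne : γ ≠ 0 := by rintro rfl; rw [map_zero] at hγ0; exact lt_irrefl _ hγ0
  have hεG := conj_gram hB hε rfl hD0 hG
    (mul_ne_zero hγne (mul_ne_zero (mul_ne_zero hr0₁ hr0₂) hr0₃))
  have hpos := mul_pos (mul_pos (hε r₁ (by rintro rfl; simp at hr0₁))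
    (hε r₂ (by rintro rfl; simp at hr0₂))) (hε r₃ (by rintro rfl; simp at hr0₃))
  -- Since `σ γ = γ < 0`, this positive product is `γ` times the square of a real number.
  have h1 := mul_pos hεG hpos
  simp only [map_mul, hγσ] at h1
  generalize algebraMap F ℝ (σ (B r₁ r₁)) = x at h1
  generalize algebraMap F ℝ (σ (B r₂ r₂)) = y at h1
  generalize algebraMap F ℝ (σ (B r₃ r₃)) = z at h1
  nlinarith [mul_nonneg (neg_nonneg.mpr hγ0.le) (sq_nonneg (ε ^ 2 * x * y * z))]

end Roots

end QuadLattice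

/-! ### The order `ℤ[√d]`, used to avoid half-integers. -/

namespace QuadField.IsConj

variable {F : Type*} [Field F] [NumberField F] {d : ℕ} {s : F} {σ : F ≃ₐ[ℚ] F}

/-- The order `ℤ[√d]`. -/
def order (h : IsConj d s σ) : Subring F where
  carrier := {x | ∃ m n : ℤ, x = m + n * s}
  mul_mem' := by
    rintro _ _ ⟨m, n, rfl⟩ ⟨m', n', rfl⟩
    refine ⟨m * m' + d * (n * n'), m * n' + n * m', ?_⟩
    push_cast
    rw [← h.sq]; ring
  one_mem' := ⟨1, 0, by simp⟩
  add_mem' := by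
    rintro _ _ ⟨m, n, rfl⟩ ⟨m', n', rfl⟩
    exact ⟨m + m', n + n', by push_cast; ring⟩
  zero_mem' := ⟨0, 0, by simp⟩
  neg_mem' := by
    rintro _ ⟨m, n, rfl⟩
    exact ⟨-m, -n, by push_cast; ring⟩

theorem isIntegral_of_mem_order (h : IsConj d s σ) {x : F} (hx : x ∈ h.order) :
    IsIntegral ℤ x := by
  obtain ⟨m, n, rfl⟩ := hx
  have hs : IsIntegral ℤ s := by
    refine IsIntegral.of_pow two_pos ?_
    rw [h.sq]
    exact isIntegral_algebraMap (R := ℤ) (x := (d : ℤ)) |> fun h => by simpa using h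
  have hint : ∀ k : ℤ, IsIntegral ℤ (k : F) := fun k => by
    simpa using isIntegral_algebraMap (R := ℤ) (A := F) (x := k)
  exact (hint m).add ((hint n).mul hs)

theorem two_mul_mem_order (h : IsConj d s σ) {x : F} (hx : IsIntegral ℤ x) :
    2 * x ∈ h.order := by
  obtain ⟨m, n, -, h1, -⟩ := h.integer_form hx
  exact ⟨m, n, h1⟩

theorem exists_mul_mem_order (h : IsConj d s σ) (x : F) :
    ∃ n : ℤ, n ≠ 0 ∧ (n : F) * x ∈ h.order := by
  obtain ⟨p, q, rfl⟩ := h.gen x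
  refine ⟨p.den * q.den, by simp, p.num * q.den, q.num * p.den, ?_⟩
  have hp : ((p.den : ℤ) : F) * p = p.num := by
    have : (p.den : ℚ) * p = p.num := Rat.den_mul_eq_num p
    exact_mod_cast congrArg (fun r : ℚ => (r : F)) this
  have hq : ((q.den : ℤ) : F) * q = q.num := by
    have : (q.den : ℚ) * q = q.num := Rat.den_mul_eq_num q
    exact_mod_cast congrArg (fun r : ℚ => (r : F)) this
  push_cast at hp hq ⊢
  rw [← hp, ← hq]; ring

theorem intCast_mem_order (h : IsConj d s σ) (n : ℤ) : (n : F) ∈ h.order := ⟨n, 0, by simp⟩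

theorem exists_common_mul_mem_order (h : IsConj d s σ) {X : Set F} (hX : X.Finite) :
    ∃ n : ℤ, n ≠ 0 ∧ ∀ x ∈ X, (n : F) * x ∈ h.order := by
  induction X, hX using Set.Finite.induction_on with
  | empty => exact ⟨1, one_ne_zero, by simp⟩
  | insert _ _ ih =>
    rename_i a S _ _
    obtain ⟨n, hn, hS⟩ := ih
    obtain ⟨k, hk, ha⟩ := h.exists_mul_mem_order a
    refine ⟨k * n, mul_ne_zero hk hn, ?_⟩
    intro x hx
    rcases Set.mem_insert_iff.mp hx with rfl | hx
    · push_cast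
      rw [mul_comm (k : F), mul_assoc]
      exact mul_mem (h.intCast_mem_order n) ha
    · push_cast
      rw [mul_assoc]
      exact mul_mem (h.intCast_mem_order k) (hS x hx)

/-- For `x = m + n s` one has `x² + σ(x)² = 2(m² + d n²)`. -/
theorem finite_order [Algebra F ℝ] (h : IsConj d s σ) (C C' : ℝ) :
    {x | x ∈ h.order ∧ algebraMap F ℝ x ^ 2 ≤ C ∧ algebraMap F ℝ (σ x) ^ 2 ≤ C'}.Finite := by
  obtain ⟨N, hN⟩ := exists_nat_ge (C + C')
  refine ((Set.finite_Icc (-(N : ℤ)) N).prod (Set.finite_Icc (-(N : ℤ)) N)).image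
    (fun p : ℤ × ℤ => (p.1 : F) + p.2 * s) |>.subset ?_
  rintro x ⟨⟨m, n, rfl⟩, h1, h2⟩
  refine ⟨(m, n), ?_, rfl⟩
  simp only [map_add, map_mul, h.map, map_intCast, map_neg] at h1 h2
  have hs := h.real_sq
  have hd : (1 : ℝ) ≤ d := by exact_mod_cast h.one_lt.le
  have h3 : (m : ℝ) ^ 2 + (n : ℝ) ^ 2 ≤ N := by
    nlinarith [sq_nonneg (n : ℝ), sq_nonneg (m : ℝ)]
  have h4 : m ^ 2 + n ^ 2 ≤ N := by exact_mod_cast h3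
  have hm : |m| ≤ N := by
    rcases eq_or_ne m 0 with rfl | hm
    · simp
    · nlinarith [sq_abs m, Int.one_le_abs hm, sq_nonneg n]
  have hn : |n| ≤ N := by
    rcases eq_or_ne n 0 with rfl | hn
    · simp
    · nlinarith [sq_abs n, Int.one_le_abs hn, sq_nonneg m]
  simp only [Set.mem_prod, Set.mem_Icc]
  exact ⟨abs_le.mp hm, abs_le.mp hn⟩

end QuadField.IsConj

/-! ### Orthogonal bases adapted to the lattice. -/

namespace QuadLattice

open Minkowski QuadField

section Orthogonal

variable {F : Type*} [Field F] [NumberField F] {d : ℕ} {s : F} {σ : F ≃ₐ[ℚ] F}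
variable {V : Type*} [AddCommGroup V] [Module F V] [Module (𝓞 F) V] [IsScalarTower (𝓞 F) F V]

theorem order_smul_mem (h : IsConj d s σ) {L : Submodule (𝓞 F) V} {x : F} (hx : x ∈ h.order)
    {v : V} (hv : v ∈ L) : x • v ∈ L := by
  obtain ⟨a, rfl⟩ : ∃ a : 𝓞 F, algebraMap (𝓞 F) F a = x :=
    ⟨⟨x, h.isIntegral_of_mem_order hx⟩, rfl⟩
  rw [IsScalarTower.algebraMap_smul]
  exact L.smul_mem a hv

theorem int_smul_mem_lattice (h : IsConj d s σ) (L : Submodule (𝓞 F) V) [Submodule.IsLattice F L]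
    (v : V) : ∃ n : ℤ, n ≠ 0 ∧ (n : F) • v ∈ L := by
  have hv : v ∈ Submodule.span F (L : Set V) := by
    rw [Submodule.IsLattice.span_eq_top]; trivial
  induction hv using Submodule.span_induction with
  | mem x hx => exact ⟨1, one_ne_zero, by simpa using hx⟩
  | zero => exact ⟨1, one_ne_zero, by simp⟩
  | add x y _ _ hx hy =>
    obtain ⟨n, hn, hx⟩ := hx
    obtain ⟨k, hk, hy⟩ := hy
    refine ⟨k * n, mul_ne_zero hk hn, ?_⟩
    rw [smul_add]
    refine add_mem ?_ ?_
    · push_cast; rw [mul_smul]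
      exact order_smul_mem h (h.intCast_mem_order k) hx
    · push_cast; rw [mul_comm, mul_smul]
      exact order_smul_mem h (h.intCast_mem_order n) hy
  | smul a x _ hx =>
    obtain ⟨n, hn, hx⟩ := hx
    obtain ⟨k, hk, ha⟩ := h.exists_mul_mem_order a
    refine ⟨k * n, mul_ne_zero hk hn, ?_⟩
    have : ((k * n : ℤ) : F) • a • x = ((k : F) * a) • (n : F) • x := by
      rw [smul_smul, smul_smul]; push_cast; congr 1; ring
    rw [this]
    exact order_smul_mem h ha hx

/-- An orthogonal basis of `V` whose norms are integral and that generates a lattice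
commensurable to `L`. -/
structure IsAdapted (h : IsConj d s σ) (B : LinearMap.BilinForm F V) (L : Submodule (𝓞 F) V)
    (f : Module.Basis (Fin 3) F V) (m : ℤ) : Prop where
  ortho : ∀ i j, i ≠ j → B (f i) (f j) = 0
  norm_mem : ∀ i, B (f i) (f i) ∈ h.order
  ne_zero : m ≠ 0
  smul_mem : ∀ i, (m : F) • f i ∈ L
  repr_mem : ∀ v ∈ L, ∀ i, (m : F) * f.repr v i ∈ h.order

theorem exists_isAdapted (h : IsConj d s σ) {B : LinearMap.BilinForm F V} (hB : B.IsSymm)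
    (hdim : Module.finrank F V = 3) (L : Submodule (𝓞 F) V) [Submodule.IsLattice F L] :
    ∃ (f : Module.Basis (Fin 3) F V) (m : ℤ), IsAdapted h B L f m := by
  have : Module.Finite F V := Module.finite_of_finrank_pos (by omega)
  let _ : Invertible (2 : F) := invertibleOfNonzero two_ne_zero
  obtain ⟨g, hg⟩ := LinearMap.BilinForm.exists_orthogonal_basis (B := B) ⟨hB.eq⟩
  let g' : Module.Basis (Fin 3) F V := g.reindex (finCongr hdim)
  have hg' : ∀ i j, i ≠ j → B (g' i) (g' j) = 0 := by
    intro i j hij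
    have := hg (i := (finCongr hdim).symm i) (j := (finCongr hdim).symm j) (by simpa using hij)
    simpa [g', Module.Basis.reindex_apply, LinearMap.BilinForm.iIsOrtho_def] using this
  obtain ⟨n, hn, hna⟩ := h.exists_common_mul_mem_order
    (Set.finite_range fun i => B (g' i) (g' i))
  have hnF : (n : F) ≠ 0 := by exact_mod_cast hn
  let f : Module.Basis (Fin 3) F V := g'.unitsSMul fun _ => Units.mk0 (n : F) hnF
  have hf : ∀ i, f i = (n : F) • g' i := fun i => by
    simp [f, Module.Basis.unitsSMul_apply, Units.smul_def]
  obtain ⟨X, hX⟩ := Submodule.IsLattice.fg (M := L)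
  obtain ⟨k, hk, hkX⟩ := h.exists_common_mul_mem_order (X := (fun p : V × Fin 3 => f.repr p.1 p.2) ''
    ((X : Set V) ×ˢ Set.univ)) ((X.finite_toSet.prod Set.finite_univ).image _)
  choose l hl hlL using fun i => int_smul_mem_lattice h L (f i)
  have hprod : (∏ i, l i) ≠ 0 := Finset.prod_ne_zero_iff.mpr fun i _ => hl i
  -- `k` makes the coordinates of the generators of `L` integral, `2` brings algebraic integers into
  -- `ℤ[√d]`, and the product of the `l i` brings the basis into `L`.
  refine ⟨f, 2 * k * ∏ i, l i, ?_, ?_, ?_, ?_, ?_⟩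
  · intro i j hij
    rw [hf, hf]
    simp [hg' i j hij]
  · intro i
    rw [hf]
    simp only [map_smul, LinearMap.smul_apply, smul_eq_mul]
    exact mul_mem (h.intCast_mem_order n) (hna _ ⟨i, rfl⟩)
  · exact mul_ne_zero (mul_ne_zero two_ne_zero hk) hprod
  · intro i
    have h1 : (2 * k * ∏ i, l i) = (2 * k * ∏ j ∈ Finset.univ.erase i, l j) * l i := by
      rw [mul_assoc (2 * k), Finset.prod_erase_mul _ _ (Finset.mem_univ i)]
    rw [h1, Int.cast_mul, mul_smul]
    exact order_smul_mem h (h.intCast_mem_order _) (hlL i)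
  · intro v hv i
    have h2 : IsIntegral ℤ ((k : F) * f.repr v i) := by
      rw [← hX] at hv
      induction hv using Submodule.span_induction with
      | mem x hx => exact h.isIntegral_of_mem_order (hkX _ ⟨(x, i), ⟨hx, trivial⟩, rfl⟩)
      | zero => simpa using isIntegral_zero
      | add x y _ _ hx hy =>
        rw [map_add, Finsupp.add_apply, mul_add]
        exact hx.add hy
      | smul a x _ hx =>
        rw [← IsScalarTower.algebraMap_smul F a x, map_smul, Finsupp.smul_apply, smul_eq_mul,
          mul_left_comm]
        exact (NumberField.RingOfIntegers.isIntegral_coe a).mul hx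
    have h4 : ((2 * k * ∏ i, l i : ℤ) : F) * f.repr v i =
        ((∏ i, l i : ℤ) : F) * (2 * ((k : F) * f.repr v i)) := by push_cast; ring
    rw [h4]
    exact mul_mem (h.intCast_mem_order _) (h.two_mul_mem_order h2)

end Orthogonal

end QuadLattice

/-! ### Isometries, reflections and their action on the real space. -/

namespace QuadLattice

open Minkowski QuadField

section RealAction

variable {F : Type*} [Field F] [Algebra F ℝ] {V : Type*} [AddCommGroup V] [Module F V]
  {B : LinearMap.BilinForm F V}

/-- The action of an automorphism of `V` on the real space. -/
noncomputable def realAct (g : V ≃ₗ[F] V) : RealSpace F V →ₗ[ℝ] RealSpace F V :=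
  (g : V →ₗ[F] V).baseChange ℝ

theorem realAct_toReal (g : V ≃ₗ[F] V) (v : V) : realAct g (toReal v) = toReal (g v) := by
  simp [realAct, toReal]

/-- A linear map out of the real space is determined by the vectors of `V`. -/
theorem realSpace_induction {P : RealSpace F V → Prop} (h0 : P 0)
    (hadd : ∀ x y, P x → P y → P (x + y)) (h1 : ∀ (c : ℝ) (v : V), P (c • toReal v))
    (x : RealSpace F V) : P x := by
  induction x using TensorProduct.induction_on with
  | zero => exact h0
  | tmul c v =>
    have := h1 c v
    rwa [toReal, TensorProduct.smul_tmul', smul_eq_mul, mul_one] at this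
  | add x y hx hy => exact hadd x y hx hy

theorem realAct_mul (g h : V ≃ₗ[F] V) (x : RealSpace F V) :
    realAct (g * h) x = realAct g (realAct h x) := by
  induction x using realSpace_induction with
  | h0 => simp
  | hadd x y hx hy => simp only [map_add, hx, hy]
  | h1 c v => simp only [map_smul, realAct_toReal, LinearEquiv.mul_apply]

theorem realAct_one (x : RealSpace F V) : realAct (1 : V ≃ₗ[F] V) x = x := by
  induction x using realSpace_induction with
  | h0 => simp
  | hadd x y hx hy => simp only [map_add, hx, hy]
  | h1 c v => simp only [map_smul, realAct_toReal, LinearEquiv.coe_one, id]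

theorem realAct_inv_apply (g : V ≃ₗ[F] V) (x : RealSpace F V) :
    realAct g⁻¹ (realAct g x) = x := by
  rw [← realAct_mul, inv_mul_cancel, realAct_one]

theorem realAct_apply_inv (g : V ≃ₗ[F] V) (x : RealSpace F V) :
    realAct g (realAct g⁻¹ x) = x := by
  rw [← realAct_mul, mul_inv_cancel, realAct_one]

theorem realAct_isometry {g : V ≃ₗ[F] V} (hg : ∀ v w, B (g v) (g w) = B v w)
    (x y : RealSpace F V) : realForm B (realAct g x) (realAct g y) = realForm B x y := by
  induction x using realSpace_induction with
  | h0 => simp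
  | hadd x x' hx hy => simp only [map_add, LinearMap.add_apply, hx, hy]
  | h1 c v =>
    induction y using realSpace_induction with
    | h0 => simp
    | hadd x y hx hy => simp only [map_add, hx, hy]
    | h1 c' w =>
      simp only [map_smul, LinearMap.smul_apply, realAct_toReal, realForm_toReal, hg]

theorem toReal_add (v w : V) : (toReal (v + w) : RealSpace F V) = toReal v + toReal w :=
  TensorProduct.tmul_add _ _ _

theorem toReal_smul (a : F) (v : V) :
    (toReal (a • v) : RealSpace F V) = algebraMap F ℝ a • toReal v := by
  simp only [toReal, TensorProduct.tmul_smul]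
  rw [Algebra.algebraMap_eq_smul_one, TensorProduct.smul_tmul', TensorProduct.smul_tmul',
        smul_eq_mul, mul_one]

theorem realAct_eq_refl {g : V ≃ₗ[F] V} {r : V} (hg : ∀ v, g v = v - (2 * B r v / B r r) • r)
    {u : RealSpace F V} {c : ℝ} (hu : realForm B u u = 1) (hc : u = c • toReal r)
    (x : RealSpace F V) : realAct g x = hypRefl (realForm B) u x := by
  have h1 := unit_mul hu hc
  obtain ⟨hc0, hr0⟩ := unit_ne_zero hu hc
  have hr0' : algebraMap F ℝ (B r r) ≠ 0 := by simpa using hr0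
  induction x using realSpace_induction with
  | h0 => simp [hypRefl]
  | hadd x y hx hy => rw [map_add, hx, hy, hypRefl_add]
  | h1 c' v =>
    rw [map_smul, realAct_toReal, hypRefl_smul, hg, sub_eq_add_neg, ← neg_smul, toReal_add,
      toReal_smul, hypRefl, hc, sub_eq_add_neg, smul_smul, ← neg_smul]
    congr 3
    have h2 : realForm B (c • toReal r) (toReal v) = c * algebraMap F ℝ (B r v) := by
      rw [map_smul, LinearMap.smul_apply, realForm_toReal, smul_eq_mul]
    rw [h2, map_neg, map_div₀, map_mul, map_ofNat]
    have h3 : c ^ 2 = (algebraMap F ℝ (B r r))⁻¹ := eq_inv_of_mul_eq_one_left h1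
    have h4 : 2 * (c * algebraMap F ℝ (B r v)) * c = 2 * c ^ 2 * algebraMap F ℝ (B r v) := by ring
    rw [h4, h3]
    field_simp

end RealAction

section Automorphisms

variable {F : Type*} [Field F] [Algebra F ℝ]
variable {V : Type*} [AddCommGroup V] [Module F V] [Module (𝓞 F) V]
variable {B : LinearMap.BilinForm F V} {L : Submodule (𝓞 F) V} {p : RealSpace F V}
  {e : Module.Basis (Fin 3) ℝ (RealSpace F V)}

/-- An isometry permutes the two components of the time-like vectors, so one time-like `o` that
stays in its component suffices, in whichever cone it lies. -/
theorem mem_autGroup_of_isometry (he : IsLorentzBasis (realForm B) e)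
    (hp : realForm B p p < 0) {g : V ≃ₗ[F] V} (h1 : ∀ v w, B (g v) (g w) = B v w)
    (h2 : ∀ v, g v ∈ L ↔ v ∈ L) {o : RealSpace F V} (ho : realForm B o o < 0)
    (ho' : realForm B o (realAct g o) < 0) : g ∈ autGroup B L p := by
  have hiso := realAct_isometry h1
  -- both cones are preserved
  have key : ∀ x y, realForm B x x < 0 → realForm B y y < 0 → realForm B x y < 0 →
      realForm B (realAct g x) y < 0 := by
    have h3 : ∀ x, realForm B x x < 0 → realForm B o x < 0 → realForm B (realAct g x) o < 0 := by
      intro x hx hox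
      refine he.neg_of_future (p := realAct g o) (by rw [hiso]; exact ho)
        (by rw [hiso]; exact hx) ho ?_ ho'
      rw [hiso, he.symm]; exact hox
    intro x y hx hy hxy
    rcases lt_or_gt_of_ne (he.ne_zero_of_timelike ho hx) with h | h
    · refine he.neg_of_future ho (by rw [hiso]; exact hx) hy (h3 x hx h) ?_
      exact he.neg_of_future hx hy ho (by rw [he.symm]; exact hxy) h
    · have h5 := h3 (-x) (by simpa using hx) (by simpa using h)
      have h4 := he.neg_of_future (x := realAct g (-x)) (y := -y) ho
        (by rw [hiso]; simpa using hx) (by simpa using hy) h5 (by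
          refine he.neg_of_future (p := -x) (by simpa using hx) (by simpa using hy) ho ?_
            (by simpa using h)
          rw [he.symm]; simpa using hxy)
      simpa using h4
  refine ⟨h1, h2, fun x => ⟨?_, ?_⟩⟩
  · rintro ⟨hx1, hx2⟩
    change realForm B (realAct g x) (realAct g x) < 0 at hx1
    change realForm B (realAct g x) p < 0 at hx2
    rw [hiso] at hx1
    refine ⟨hx1, ?_⟩
    by_contra hcon
    rcases lt_or_gt_of_ne (he.ne_zero_of_timelike hx1 hp) with h | h
    · exact hcon h
    · have := key (-x) p (by simpa using hx1) hp (by simpa using h)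
      simp at this
      linarith
  · rintro ⟨hx1, hx2⟩
    exact ⟨by change realForm B (realAct g x) (realAct g x) < 0; rw [hiso]; exact hx1,
      key x p hx1 hp hx2⟩

theorem future_of_mem_autGroup {g : V ≃ₗ[F] V} (hg : g ∈ autGroup B L p) {x : RealSpace F V} :
    realAct g x ∈ futureCone (realForm B) p ↔ x ∈ futureCone (realForm B) p := hg.2.2 x

variable [NumberField F] [IsScalarTower (𝓞 F) F V]

/-- The reflection in a root is an automorphism of the lattice. -/
theorem IsRoot.exists_reflection (he : IsLorentzBasis (realForm B) e) (hB : B.IsSymm)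
    (hp : realForm B p p < 0) {r : V} (hr : IsRoot B L r) :
    ∃ g ∈ autGroup B L p, ∀ v, g v = v - (2 * B r v / B r r) • r := by
  have hr0 : B r r ≠ 0 := by intro h; have := hr.2.1; rw [h] at this; simp at this
  have hr0' : algebraMap F ℝ (B r r) ≠ 0 := by simpa using hr0
  let f : V →ₗ[F] F := (2 / B r r) • B r
  have hf : ∀ v, f v = 2 * B r v / B r r := fun v => by
    simp only [f, LinearMap.smul_apply, smul_eq_mul]; ring
  have hfr : f r = 2 := by rw [hf]; field_simp
  let g : V ≃ₗ[F] V := Module.reflection hfr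
  have hg : ∀ v, g v = v - (2 * B r v / B r r) • r := fun v => by
    rw [← hf]; exact Module.reflection_apply v hfr
  have hgg : ∀ v, g (g v) = v := Module.involutive_reflection hfr
  have hiso : ∀ v w, B (g v) (g w) = B v w := by
    intro v w
    rw [hg, hg]
    simp only [map_sub, map_smul, LinearMap.sub_apply, LinearMap.smul_apply, smul_eq_mul]
    rw [hB.eq v r]
    field_simp
    ring
  have hL : ∀ v ∈ L, g v ∈ L := by
    intro v hv
    obtain ⟨a, ha⟩ := hr.2.2 v hv
    have h1 : 2 * B r v / B r r = algebraMap (𝓞 F) F a := by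
      rw [ha]; field_simp
    rw [hg, h1, IsScalarTower.algebraMap_smul]
    exact sub_mem hv (L.smul_mem a hr.1.1)
  refine ⟨g, ?_, hg⟩
  refine mem_autGroup_of_isometry he hp hiso
    (fun v => ⟨fun h => by rw [← hgg v]; exact hL _ h, hL v⟩) hp ?_
  -- a space-like reflection preserves the cones
  obtain ⟨c, hc⟩ : ∃ c : ℝ, c ^ 2 * algebraMap F ℝ (B r r) = 1 := by
    refine ⟨Real.sqrt (algebraMap F ℝ (B r r))⁻¹, ?_⟩
    rw [Real.sq_sqrt (inv_nonneg.mpr hr.2.1.le), inv_mul_cancel₀ hr0']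
  obtain ⟨u, hcu⟩ : ∃ u : RealSpace F V, u = c • toReal r := ⟨_, rfl⟩
  have hu : realForm B u u = 1 := by
    rw [hcu, form_smul, ← hc]; ring
  rw [realAct_eq_refl hg hu hcu, hypRefl]
  simp only [map_sub, map_smul, smul_eq_mul]
  rw [he.symm p u]
  nlinarith [sq_nonneg (realForm B u p)]

theorem isRoot_map {g : V ≃ₗ[F] V} (hg : g ∈ autGroup B L p) {r : V} (hr : IsRoot B L r) :
    IsRoot B L (g r) := by
  obtain ⟨h1, h2, -⟩ := hg
  have hinv : ∀ v, g (g⁻¹ v) = v := fun v => g.apply_symm_apply v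
  refine ⟨⟨(h2 r).mpr hr.1.1, fun a w hw h => hr.1.2 a (g⁻¹ w) ?_ ?_⟩, by rw [h1]; exact hr.2.1, ?_⟩
  · rw [← h2, hinv]; exact hw
  · apply g.injective
    rw [h, ← IsScalarTower.algebraMap_smul F a w, ← IsScalarTower.algebraMap_smul F a (g⁻¹ w),
      map_smul, hinv]
  · intro v hv
    obtain ⟨a, ha⟩ := hr.2.2 (g⁻¹ v) (by rw [← h2, hinv]; exact hv)
    refine ⟨a, ?_⟩
    rw [h1, ← ha, ← h1 r (g⁻¹ v), hinv]

theorem unitRoots_map {g : V ≃ₗ[F] V} (hg : g ∈ autGroup B L p) {u : RealSpace F V}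
    (hu : u ∈ unitRoots B L) : realAct g u ∈ unitRoots B L := by
  obtain ⟨h1, r, hr, c, rfl⟩ := hu
  refine ⟨by rw [realAct_isometry hg.1]; exact h1, g r, isRoot_map hg hr, c, ?_⟩
  rw [map_smul, realAct_toReal]

theorem unitRoots_neg {u : RealSpace F V} (hu : u ∈ unitRoots B L) : -u ∈ unitRoots B L := by
  obtain ⟨h1, r, hr, c, rfl⟩ := hu
  exact ⟨by simpa using h1, r, hr, -c, (neg_smul c (toReal r : RealSpace F V)).symm⟩

theorem unitRoots_reflection (he : IsLorentzBasis (realForm B) e) (hB : B.IsSymm)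
    (hp : realForm B p p < 0) {u : RealSpace F V} (hu : u ∈ unitRoots B L) :
    ∃ g ∈ autGroup B L p, ∀ x, realAct g x = hypRefl (realForm B) u x := by
  obtain ⟨h1, r, hr, c, hc⟩ := hu
  obtain ⟨g, hg, hgr⟩ := hr.exists_reflection he hB hp
  exact ⟨g, hg, realAct_eq_refl hgr h1 hc⟩

theorem unitRoots_refl (he : IsLorentzBasis (realForm B) e) (hB : B.IsSymm)
    (hp : realForm B p p < 0) {u t : RealSpace F V} (hu : u ∈ unitRoots B L)
    (ht : t ∈ unitRoots B L) : hypRefl (realForm B) u t ∈ unitRoots B L := by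
  obtain ⟨g, hg, h⟩ := unitRoots_reflection he hB hp hu
  rw [← h]
  exact unitRoots_map hg ht

end Automorphisms

/-! ### Discreteness of the automorphism group and of the set of mirrors. -/

section Discrete

variable {F : Type*} [Field F] [NumberField F] [Algebra F ℝ]
variable {V : Type*} [AddCommGroup V] [Module F V] [Module (𝓞 F) V] [IsScalarTower (𝓞 F) F V]
variable {B : LinearMap.BilinForm F V} {L : Submodule (𝓞 F) V} {p : RealSpace F V}
  {e : Module.Basis (Fin 3) ℝ (RealSpace F V)} {d : ℕ} {s : F} {σ : F ≃ₐ[ℚ] F} {ε : ℝ}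
  {h : IsConj d s σ} {f : Module.Basis (Fin 3) F V} {m : ℤ}

/-- Cauchy-Schwarz for the positive semidefinite form `a·b + (a·o)(b·o)`, after splitting off
`(a·o)(b·o)`; the constant is not sharp. -/
theorem _root_.Minkowski.IsLorentzBasis.sq_le {W : Type*} [AddCommGroup W] [Module ℝ W]
    {β : LinearMap.BilinForm ℝ W} {e : Module.Basis (Fin 3) ℝ W} (he : IsLorentzBasis β e) {o : W}
    (ho : β o o = -1) (a b : W) :
    β a b ^ 2 ≤ 4 * ((|β a a| + β a o ^ 2) * (|β b b| + β b o ^ 2)) := by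
  have h1 := he.cauchy_at ho a b
  have h2 : (β a a + β a o ^ 2) * (β b b + β b o ^ 2) ≤
      (|β a a| + β a o ^ 2) * (|β b b| + β b o ^ 2) :=
    mul_le_mul (by linarith [le_abs_self (β a a)]) (by linarith [le_abs_self (β b b)])
      (he.add_sq_nonneg ho b) (by positivity)
  have h3 : (β a o * β b o) ^ 2 ≤ (|β a a| + β a o ^ 2) * (|β b b| + β b o ^ 2) := by
    rw [mul_pow]
    exact mul_le_mul (by linarith [abs_nonneg (β a a)]) (by linarith [abs_nonneg (β b b)])
      (sq_nonneg _) (by positivity)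
  nlinarith [sq_nonneg (β a b + 2 * (β a o * β b o))]

theorem IsAdapted.form_repr (hf : IsAdapted h B L f m) (v : V) (i : Fin 3) :
    B (f i) v = B (f i) (f i) * f.repr v i := by
  conv_lhs => rw [← f.sum_repr v]
  rw [map_sum, Finset.sum_eq_single i]
  · rw [map_smul, smul_eq_mul, mul_comm]
  · intro j _ hj
    rw [map_smul, hf.ortho i j hj.symm, smul_zero]
  · simp

theorem IsAdapted.form_self (hf : IsAdapted h B L f m) (v : V) :
    B v v = ∑ i, B (f i) (f i) * f.repr v i ^ 2 := by
  have key : ∀ w, B w v = ∑ i, f.repr w i * B (f i) v := fun w => by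
    conv_lhs => rw [← f.sum_repr w]
    rw [map_sum, LinearMap.sum_apply]
    simp only [map_smul, LinearMap.smul_apply, smul_eq_mul]
  rw [key]
  refine Finset.sum_congr rfl fun i _ => ?_
  rw [hf.form_repr]
  ring

/-- The matrix of `g` in the adapted basis, times `m²`, has entries in `ℤ[√d]`. The displacement of
`o` bounds them at the given embedding, definiteness at the conjugate one. -/
theorem finite_autGroup (he : IsLorentzBasis (realForm B) e)
    (hε : ∀ v : V, v ≠ 0 → 0 < ε * algebraMap F ℝ (σ (B v v)))
    (hf : IsAdapted h B L f m) {o : RealSpace F V} (ho : realForm B o o = -1) (C : ℝ) :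
    {g | g ∈ autGroup B L p ∧ realForm B o (realAct g o) ^ 2 ≤ C}.Finite := by
  set α : Fin 3 → ℝ := fun i => algebraMap F ℝ (B (f i) (f i)) with hα
  set α' : Fin 3 → ℝ := fun i => algebraMap F ℝ (σ (B (f i) (f i))) with hα'
  have hεα : ∀ i, 0 < ε * α' i := fun i => hε (f i) (f.ne_zero i)
  have hα0' : ∀ i, α' i ≠ 0 := fun i h0 => by have := hεα i; rw [h0] at this; simp at this
  have hα0 : ∀ i, α i ≠ 0 := fun i h0 => by
    apply hα0' i
    have : B (f i) (f i) = 0 := by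
      have h1 : algebraMap F ℝ (B (f i) (f i)) = 0 := h0
      simpa using h1
    simp [hα', this]
  set P : Fin 3 → ℝ := fun i => |α i| + realForm B (toReal (f i)) o ^ 2 with hP
  set K : Fin 3 → Fin 3 → ℝ := fun i j =>
    ((m : ℝ) ^ 2) ^ 2 * (4 * (P i * (|α j| + 4 * (P j * (1 + C)))) / α i ^ 2) with hK
  set K' : Fin 3 → Fin 3 → ℝ := fun i j => ((m : ℝ) ^ 2) ^ 2 * (α' j / α' i) with hK'
  have hfin := Set.Finite.pi fun ij : Fin 3 × Fin 3 =>
    h.finite_order (K ij.1 ij.2) (K' ij.1 ij.2)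
  refine Set.Finite.of_finite_image (f := fun g : V ≃ₗ[F] V => fun ij : Fin 3 × Fin 3 =>
    (m : F) ^ 2 * f.repr (g (f ij.2)) ij.1) (hfin.subset ?_) ?_
  · rintro _ ⟨g, ⟨hg, hgC⟩, rfl⟩
    simp only [Set.mem_pi, Set.mem_univ, true_imp_iff, Set.mem_ofPred_eq]
    rintro ⟨i, j⟩
    refine ⟨?_, ?_, ?_⟩
    · have h1 := hf.repr_mem _ ((hg.2.1 _).mpr (hf.smul_mem j)) i
      rw [map_smul, map_smul, Finsupp.smul_apply, smul_eq_mul, ← mul_assoc, ← pow_two] at h1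
      exact h1
    · have h1 : realForm B (toReal (f i)) (realAct g (toReal (f j))) =
          α i * algebraMap F ℝ (f.repr (g (f j)) i) := by
        rw [realAct_toReal, realForm_toReal, hf.form_repr, map_mul]
      have h2 := he.sq_le ho (toReal (f i)) (realAct g (toReal (f j)))
      rw [h1, realAct_isometry hg.1, realForm_toReal, realForm_toReal] at h2
      have h3 : realForm B (realAct g (toReal (f j))) o =
          realForm B (toReal (f j)) (realAct g⁻¹ o) := by
        conv_lhs => rw [← realAct_apply_inv g o]
        rw [realAct_isometry hg.1]
      have h4 := he.sq_le ho (toReal (f j)) (realAct g⁻¹ o)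
      have h5 : realForm B (realAct g⁻¹ o) (realAct g⁻¹ o) = -1 := by
        rw [← realAct_isometry hg.1, realAct_apply_inv, ho]
      have h6 : realForm B (realAct g⁻¹ o) o = realForm B o (realAct g o) := by
        rw [← realAct_isometry hg.1, realAct_apply_inv]
      rw [h5, h6, realForm_toReal, abs_neg, abs_one] at h4
      rw [h3] at h2
      have hPnn : ∀ i, 0 ≤ P i := fun i => by positivity
      have h7 : realForm B (toReal (f j)) (realAct g⁻¹ o) ^ 2 ≤ 4 * (P j * (1 + C)) := by
        refine h4.trans ?_
        exact mul_le_mul_of_nonneg_left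
          (mul_le_mul_of_nonneg_left (by linarith) (hPnn j)) (by norm_num)
      have h8 : (α i * algebraMap F ℝ (f.repr (g (f j)) i)) ^ 2 ≤
          4 * (P i * (|α j| + 4 * (P j * (1 + C)))) := by
        refine h2.trans ?_
        exact mul_le_mul_of_nonneg_left
          (mul_le_mul_of_nonneg_left (by linarith) (hPnn i)) (by norm_num)
      have h9 : algebraMap F ℝ (f.repr (g (f j)) i) ^ 2 ≤
          4 * (P i * (|α j| + 4 * (P j * (1 + C)))) / α i ^ 2 := by
        have := hα0 i
        rw [le_div_iff₀ (by positivity)]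
        linarith [mul_pow (α i) (algebraMap F ℝ (f.repr (g (f j)) i)) 2]
      rw [map_mul, map_pow, map_intCast, mul_pow]
      exact mul_le_mul_of_nonneg_left h9 (by positivity)
    · have h1 := congrArg (fun x => ε * algebraMap F ℝ (σ x)) (hf.form_self (g (f j)))
      rw [hg.1] at h1
      simp only [map_sum, map_mul, map_pow, Finset.mul_sum] at h1
      have h2 : ε * (α' i * algebraMap F ℝ (σ (f.repr (g (f j)) i)) ^ 2) ≤ ε * α' j := by
        rw [hα', h1]
        refine Finset.single_le_sum (f := fun i => ε * (algebraMap F ℝ (σ (B (f i) (f i))) *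
          algebraMap F ℝ (σ (f.repr (g (f j)) i)) ^ 2)) (fun k _ => ?_) (Finset.mem_univ i)
        rw [← mul_assoc]
        exact mul_nonneg (hεα k).le (sq_nonneg _)
      have h3 : algebraMap F ℝ (σ (f.repr (g (f j)) i)) ^ 2 ≤ α' j / α' i := by
        have hε0 : ε ≠ 0 := by intro h0; have := hεα i; rw [h0] at this; simp at this
        rw [← mul_div_mul_left (α' j) (α' i) hε0, le_div_iff₀ (hεα i)]
        linarith
      rw [map_mul, map_mul, map_pow, map_pow, map_intCast, map_intCast, mul_pow]
      exact mul_le_mul_of_nonneg_left h3 (by positivity)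
  · intro g _ g' _ hgg
    have hm : (m : F) ≠ 0 := by exact_mod_cast hf.ne_zero
    apply LinearEquiv.toLinearMap_injective
    refine f.ext fun j => ?_
    apply f.repr.injective
    ext i
    exact mul_left_cancel₀ (pow_ne_zero 2 hm) (congrFun hgg (i, j))

/-- Only finitely many mirrors of roots meet a given bounded set. -/
theorem finite_unitRoots (he : IsLorentzBasis (realForm B) e) (hB : B.IsSymm)
    (hε : ∀ v : V, v ≠ 0 → 0 < ε * algebraMap F ℝ (σ (B v v)))
    (hf : IsAdapted h B L f m) {o : RealSpace F V} (ho : realForm B o o = -1) (C : ℝ) :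
    {u ∈ unitRoots B L | |realForm B u o| ≤ C}.Finite := by
  have hfin := finite_autGroup (p := o) he hε hf ho ((1 + 2 * C ^ 2) ^ 2)
  -- The reflection in such a `u` moves `o` by a bounded amount and determines `u` up to sign.
  refine (hfin.biUnion (t := fun g => {u | realForm B u u = 1 ∧
    ∀ x, realAct g x = hypRefl (realForm B) u x}) fun g _ => ?_).subset ?_
  · by_cases hne : ∃ t, realForm B t t = 1 ∧ ∀ x, realAct g x = hypRefl (realForm B) t x
    · obtain ⟨t, ht1, ht⟩ := hne
      refine (Set.toFinite {t, -t}).subset ?_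
      rintro u ⟨hu1, hu⟩
      have h1 : hypRefl (realForm B) u u = hypRefl (realForm B) t u := by rw [← hu, ← ht]
      rw [refl_self hu1, hypRefl] at h1
      have h2 : u = realForm B t u • t := by
        have h3 : (2 : ℝ) • u = (2 : ℝ) • (realForm B t u • t) := by
          rw [smul_smul, two_smul]
          exact (neg_add_eq_iff_eq_add.mp (eq_sub_iff_add_eq.mp h1)).symm
        exact smul_right_injective _ (two_ne_zero (α := ℝ)) h3
      have h4 : realForm B t u * realForm B t u = 1 := by
        have h5 := hu1
        rw [h2] at h5
        simp only [map_smul, LinearMap.smul_apply, smul_eq_mul, ht1] at h5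
        linarith
      rcases mul_self_eq_one_iff.mp h4 with h5 | h5
      · left; rw [h2, h5]; exact one_smul ℝ t
      · right; rw [h2, h5]; exact neg_one_smul ℝ t
    · convert Set.finite_empty
      rw [Set.eq_empty_iff_forall_notMem]
      intro u hu
      exact hne ⟨u, hu⟩
  · rintro u ⟨hu, huC⟩
    obtain ⟨g, hg, hgu⟩ := unitRoots_reflection he hB (p := o) (by rw [ho]; norm_num) hu
    simp only [Set.mem_iUnion]
    refine ⟨g, ⟨hg, ?_⟩, hu.1, hgu⟩
    rw [hgu, hypRefl]
    simp only [map_sub, map_smul, smul_eq_mul, ho]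
    rw [he.symm o u]
    have h1 : realForm B u o ^ 2 ≤ C ^ 2 := by
      rw [← sq_abs]; exact pow_le_pow_left₀ (abs_nonneg _) huC 2
    have h2 : (-1 - 2 * realForm B u o * realForm B u o) ^ 2 =
      (1 + 2 * realForm B u o ^ 2) ^ 2 := by ring
    rw [h2]
    exact pow_le_pow_left₀ (by positivity) (by linarith) 2

end Discrete

end QuadLattice

/-! ### Quaternions as rotations of a ternary diagonal form. -/

/-- The quaternion algebra that is the even part of the Clifford algebra of the quadratic form
`a₀x₀² + a₁x₁² + a₂x₂²`. -/
abbrev CliffordQuat {K : Type*} [Field K] (a : Fin 3 → K) : Type _ :=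
  QuaternionAlgebra K (-(a 1 * a 2)) 0 (-(a 0 * a 2))

namespace CliffordQuat

variable {K : Type*} [Field K] {a : Fin 3 → K}

/-- The diagonal bilinear form. -/
def diagForm (a v w : Fin 3 → K) : K := a 0 * v 0 * w 0 + a 1 * v 1 * w 1 + a 2 * v 2 * w 2

/-- The quaternion norm. -/
def nrm (z : CliffordQuat a) : K :=
  z.re ^ 2 + a 1 * a 2 * z.imI ^ 2 + a 0 * a 2 * z.imJ ^ 2 + a 0 * a 1 * a 2 ^ 2 * z.imK ^ 2

theorem mul_star_self (z : CliffordQuat a) : z * star z = (nrm z : K) := by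
  change _ = (⟨nrm z, 0, 0, 0⟩ : CliffordQuat a)
  ext <;> simp [nrm] <;> ring

theorem star_mul_self' (z : CliffordQuat a) : star z * z = (nrm z : K) := by
  change _ = (⟨nrm z, 0, 0, 0⟩ : CliffordQuat a)
  ext <;> simp [nrm] <;> ring

theorem nrm_mul (z w : CliffordQuat a) : nrm (z * w) = nrm z * nrm w := by
  simp [nrm]; ring

theorem nrm_star (z : CliffordQuat a) : nrm (star z) = nrm z := by simp [nrm]

/-- The vectors as pure quaternions. -/
def vec (a v : Fin 3 → K) : CliffordQuat a := ⟨0, a 0 * v 0, a 1 * v 1, -v 2⟩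

/-- The rotation by a quaternion, multiplied by its norm. -/
def rot (z : CliffordQuat a) : (Fin 3 → K) →ₗ[K] (Fin 3 → K) where
  toFun v := ![(z * vec a v * star z).imI / a 0, (z * vec a v * star z).imJ / a 1,
    -(z * vec a v * star z).imK]
  map_add' v w := by
    ext i
    fin_cases i <;> simp [vec] <;> ring
  map_smul' c v := by
    ext i
    fin_cases i <;> simp [vec] <;> ring

theorem rot_apply (z : CliffordQuat a) (v : Fin 3 → K) : rot z v =
    ![(z * vec a v * star z).imI / a 0, (z * vec a v * star z).imJ / a 1,
    -(z * vec a v * star z).imK] := rfl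

theorem vec_rot (ha : ∀ i, a i ≠ 0) (z : CliffordQuat a) (v : Fin 3 → K) :
    vec a (rot z v) = z * vec a v * star z := by
  have h0 := ha 0
  have h1 := ha 1
  have hre : (z * vec a v * star z).re = 0 := by simp [vec]; ring
  ext
  · rw [hre]; simp [vec]
  · simp only [vec, rot_apply, Matrix.cons_val_zero]; field_simp
  · simp only [vec, rot_apply, Matrix.cons_val_one, Matrix.cons_val_zero]; field_simp
  · simp [vec, rot_apply]

theorem vec_injective (ha : ∀ i, a i ≠ 0) : Function.Injective (vec a) := by
  intro v w h
  have h0 := ha 0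
  have h1 := ha 1
  ext i
  have e1 := congrArg QuaternionAlgebra.imI h
  have e2 := congrArg QuaternionAlgebra.imJ h
  have e3 := congrArg QuaternionAlgebra.imK h
  simp only [vec] at e1 e2 e3
  fin_cases i
  · exact mul_left_cancel₀ h0 e1
  · exact mul_left_cancel₀ h1 e2
  · exact neg_injective e3

theorem rot_mul (ha : ∀ i, a i ≠ 0) (z w : CliffordQuat a) (v : Fin 3 → K) :
    rot (z * w) v = rot z (rot w v) := by
  apply vec_injective ha
  rw [vec_rot ha, vec_rot ha, vec_rot ha, star_mul]
  simp only [mul_assoc]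

theorem rot_coe (ha : ∀ i, a i ≠ 0) (c : K) (v : Fin 3 → K) :
    rot (c : CliffordQuat a) v = c ^ 2 • v := by
  have h0 := ha 0
  have h1 := ha 1
  ext i
  fin_cases i
  · simp [rot_apply, vec]; field_simp
  · simp [rot_apply, vec]; field_simp
  · simp [rot_apply, vec]; ring

theorem rot_star_rot (ha : ∀ i, a i ≠ 0) (z : CliffordQuat a) (v : Fin 3 → K) :
    rot (star z) (rot z v) = nrm z ^ 2 • v := by
  rw [← rot_mul ha, star_mul_self', rot_coe ha]

theorem rot_rot_star (ha : ∀ i, a i ≠ 0) (z : CliffordQuat a) (v : Fin 3 → K) :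
    rot z (rot (star z) v) = nrm z ^ 2 • v := by
  rw [← rot_mul ha, mul_star_self, rot_coe ha]

/-- The coordinates of `vec` are scaled so that the quaternion norm is `a₀a₁a₂` times the form; this
is the polarized identity. -/
theorem vec_mul_star_vec (v w : Fin 3 → K) : vec a v * star (vec a w) + vec a w * star (vec a v) =
    ((2 * (a 0 * a 1 * a 2) * diagForm a v w : K) : CliffordQuat a) := by
  change _ = (⟨2 * (a 0 * a 1 * a 2) * diagForm a v w, 0, 0, 0⟩ : CliffordQuat a)
  ext <;> simp [vec, diagForm] <;> ring

theorem nrm_vec (v : Fin 3 → K) : nrm (vec a v) = a 0 * a 1 * a 2 * diagForm a v v := by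
  simp [nrm, vec, diagForm]; ring

/-- In the polarized norm of `z v z̄` and `z w z̄` the inner factors `z̄ z` are scalars and can be
pulled out, as can the outer `z z̄`. -/
theorem diagForm_rot [NeZero (2 : K)] (ha : ∀ i, a i ≠ 0) (z : CliffordQuat a) (v w : Fin 3 → K) :
    diagForm a (rot z v) (rot z w) = nrm z ^ 2 * diagForm a v w := by
  have h1 := vec_mul_star_vec (a := a) (rot z v) (rot z w)
  rw [vec_rot ha, vec_rot ha] at h1
  have h2 : z * vec a v * star z * star (z * vec a w * star z) +
      z * vec a w * star z * star (z * vec a v * star z) =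
      z * (vec a v * ((nrm z : K) : CliffordQuat a) * star (vec a w) +
        vec a w * ((nrm z : K) : CliffordQuat a) * star (vec a v)) * star z := by
    rw [← star_mul_self' z]
    simp only [star_mul, star_star, mul_add, add_mul, mul_assoc]
  rw [h2, QuaternionAlgebra.mul_coe_eq_smul, QuaternionAlgebra.mul_coe_eq_smul, smul_mul_assoc,
    smul_mul_assoc, ← smul_add, vec_mul_star_vec, ← QuaternionAlgebra.coe_mul_eq_smul,
    ← QuaternionAlgebra.coe_mul, QuaternionAlgebra.mul_coe_eq_smul, smul_mul_assoc, mul_star_self,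
    ← QuaternionAlgebra.coe_mul_eq_smul, ← QuaternionAlgebra.coe_mul] at h1
  have h3 := QuaternionAlgebra.coe_injective h1
  have h4 : (2 * (a 0 * a 1 * a 2) : K) ≠ 0 :=
    mul_ne_zero two_ne_zero (mul_ne_zero (mul_ne_zero (ha 0) (ha 1)) (ha 2))
  apply mul_left_cancel₀ h4
  rw [← h3]; ring

/-- The rotation by a vector is a half-turn. -/
theorem rot_vec (ha : ∀ i, a i ≠ 0) (w v : Fin 3 → K) : rot (vec a w) v =
    (a 0 * a 1 * a 2) • ((2 * diagForm a w v) • w - diagForm a w w • v) := by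
  have h0 := ha 0
  have h1 := ha 1
  ext i
  fin_cases i
  · simp [rot_apply, vec, diagForm]; field_simp; ring
  · simp [rot_apply, vec, diagForm]; field_simp; ring
  · simp [rot_apply, vec, diagForm]; ring

theorem vec_mul_self (w : Fin 3 → K) :
    vec a w * vec a w = ((-nrm (vec a w) : K) : CliffordQuat a) := by
  change _ = (⟨-nrm (vec a w), 0, 0, 0⟩ : CliffordQuat a)
  ext <;> simp [vec, nrm] <;> ring

/-- The image of a quaternion under a field homomorphism. -/
def map {K' : Type*} [Field K'] (f : K →+* K') (z : CliffordQuat a) :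
    CliffordQuat (fun i => f (a i)) := ⟨f z.re, f z.imI, f z.imJ, f z.imK⟩

section Map

variable {K' : Type*} [Field K'] (f : K →+* K')

theorem map_mul' (z w : CliffordQuat a) : map f (z * w) = map f z * map f w := by
  ext <;> simp [map]

theorem map_star' (z : CliffordQuat a) : map f (star z) = star (map f z) := by
  ext <;> simp [map]

theorem nrm_map (z : CliffordQuat a) : nrm (map f z) = f (nrm z) := by
  simp [nrm, map]

theorem rot_map (z : CliffordQuat a) (v : Fin 3 → K) :
    rot (map f z) (fun i => f (v i)) = fun i => f (rot z v i) := by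
  have h : vec (fun i => f (a i)) (fun i => f (v i)) = map f (vec a v) := by
    ext <;> simp [vec, map]
  rw [rot_apply, rot_apply, h, ← map_star', ← map_mul', ← map_mul']
  ext i
  fin_cases i <;> simp [map]

end Map

/-- The quaternions with coordinates in a subring. -/
def coordsIn (R : Subring K) : Set (CliffordQuat a) :=
  {z | z.re ∈ R ∧ z.imI ∈ R ∧ z.imJ ∈ R ∧ z.imK ∈ R}

theorem mul_mem_coordsIn {R : Subring K} (ha : ∀ i, a i ∈ R) {z w : CliffordQuat a}
    (hz : z ∈ coordsIn R) (hw : w ∈ coordsIn R) : z * w ∈ coordsIn R := by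
  obtain ⟨h1, h2, h3, h4⟩ := hz
  obtain ⟨k1, k2, k3, k4⟩ := hw
  have e1 := neg_mem (mul_mem (ha 1) (ha 2))
  have e2 := neg_mem (mul_mem (ha 0) (ha 2))
  refine ⟨?_, ?_, ?_, ?_⟩
  · rw [QuaternionAlgebra.re_mul]
    simp only [zero_mul, add_zero]
    exact sub_mem (add_mem (add_mem (mul_mem h1 k1) (mul_mem (mul_mem e1 h2) k2))
        (mul_mem (mul_mem e2 h3) k3)) (mul_mem (mul_mem (mul_mem e1 e2) h4) k4)
  · rw [QuaternionAlgebra.imI_mul]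
    simp only [zero_mul, add_zero]
    exact add_mem (sub_mem (add_mem (mul_mem h1 k2) (mul_mem h2 k1))
      (mul_mem (mul_mem e2 h3) k4)) (mul_mem (mul_mem e2 h4) k3)
  · rw [QuaternionAlgebra.imJ_mul]
    simp only [zero_mul, add_zero]
    exact sub_mem (add_mem (add_mem (mul_mem h1 k3) (mul_mem (mul_mem e1 h2) k4))
      (mul_mem h3 k1)) (mul_mem (mul_mem e1 h4) k2)
  · rw [QuaternionAlgebra.imK_mul]
    simp only [zero_mul, add_zero]
    exact add_mem (sub_mem (add_mem (mul_mem h1 k4) (mul_mem h2 k3)) (mul_mem h3 k2))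
      (mul_mem h4 k1)

theorem star_mem_coordsIn {R : Subring K} {z : CliffordQuat a} (hz : z ∈ coordsIn R) :
    star z ∈ coordsIn R := by
  obtain ⟨h1, h2, h3, h4⟩ := hz
  refine ⟨?_, ?_, ?_, ?_⟩
  · simpa using h1
  · simpa using h2
  · simpa using h3
  · simpa using h4

theorem add_mem_coordsIn {R : Subring K} {z w : CliffordQuat a}
    (hz : z ∈ coordsIn R) (hw : w ∈ coordsIn R) : z + w ∈ coordsIn R :=
  ⟨add_mem hz.1 hw.1, add_mem hz.2.1 hw.2.1, add_mem hz.2.2.1 hw.2.2.1, add_mem hz.2.2.2 hw.2.2.2⟩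

theorem smul_mem_coordsIn {R : Subring K} {z : CliffordQuat a} {c : K} (hc : c ∈ R)
    (hz : z ∈ coordsIn R) : c • z ∈ coordsIn R :=
  ⟨mul_mem hc hz.1, mul_mem hc hz.2.1, mul_mem hc hz.2.2.1, mul_mem hc hz.2.2.2⟩

theorem nrm_mem {R : Subring K} (ha : ∀ i, a i ∈ R) {z : CliffordQuat a} (hz : z ∈ coordsIn R) :
    nrm z ∈ R := by
  obtain ⟨h1, h2, h3, h4⟩ := hz
  exact add_mem (add_mem (add_mem (pow_mem h1 2) (mul_mem (mul_mem (ha 1) (ha 2)) (pow_mem h2 2)))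
    (mul_mem (mul_mem (ha 0) (ha 2)) (pow_mem h3 2)))
    (mul_mem (mul_mem (mul_mem (ha 0) (ha 1)) (pow_mem (ha 2) 2)) (pow_mem h4 2))

/-- The rotation by a quaternion that is congruent to `1` moves an integral vector by a multiple of
the modulus. -/
theorem rot_one_add (ha : ∀ i, a i ≠ 0) {R : Subring K} (haR : ∀ i, a i ∈ R) {m n : K}
    (hm0 : m ≠ 0) (hm : m ∈ R) (hn : n ∈ R) (hna : ∀ i, n * (a i)⁻¹ ∈ R)
    {x : CliffordQuat a} (hx : x ∈ coordsIn R) {v : Fin 3 → K} (hv : ∀ i, m * v i ∈ R)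
    (i : Fin 3) : ∃ c ∈ R, rot (1 + (m ^ 2 * n) • x) v i = v i + m * c := by
  have hy : m • vec a v ∈ coordsIn (a := a) R := by
    refine ⟨?_, ?_, ?_, ?_⟩
    · simp [vec]
    · have : (m • vec a v).imI = a 0 * (m * v 0) := by simp [vec]; ring
      rw [this]; exact mul_mem (haR 0) (hv 0)
    · have : (m • vec a v).imJ = a 1 * (m * v 1) := by simp [vec]; ring
      rw [this]; exact mul_mem (haR 1) (hv 1)
    · have : (m • vec a v).imK = -(m * v 2) := by simp [vec]
      rw [this]; exact neg_mem (hv 2)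
  set y : CliffordQuat a := m • vec a v with hyd
  obtain ⟨w, hwd⟩ : ∃ w, w = x * y + y * star x + (m ^ 2 * n) • (x * y * star x) := ⟨_, rfl⟩
  have hw : w ∈ coordsIn R := by
    have hxs := star_mem_coordsIn hx
    rw [hwd]
    exact add_mem_coordsIn (add_mem_coordsIn (mul_mem_coordsIn haR hx hy)
      (mul_mem_coordsIn haR hy hxs)) (smul_mem_coordsIn (mul_mem (pow_mem hm 2) hn)
      (mul_mem_coordsIn haR (mul_mem_coordsIn haR hx hy) hxs))
  have key : m • vec a (rot (1 + (m ^ 2 * n) • x) v) = m • vec a v + (m ^ 2 * n) • w := by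
    rw [vec_rot ha, ← smul_mul_assoc, ← mul_smul_comm, ← hyd, hwd]
    simp only [star_add, star_one, QuaternionAlgebra.star_smul', add_mul, mul_add, one_mul, mul_one,
      smul_mul_assoc, mul_smul_comm, smul_add, smul_smul]
    abel
  have h0 := ha 0
  have h1 := ha 1
  have e1 := congrArg QuaternionAlgebra.imI key
  have e2 := congrArg QuaternionAlgebra.imJ key
  have e3 := congrArg QuaternionAlgebra.imK key
  simp only [vec, QuaternionAlgebra.imI_smul, QuaternionAlgebra.imJ_smul,
    QuaternionAlgebra.imK_smul, QuaternionAlgebra.imI_add, QuaternionAlgebra.imJ_add,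
    QuaternionAlgebra.imK_add, smul_eq_mul] at e1 e2 e3
  fin_cases i
  · refine ⟨n * (a 0)⁻¹ * w.imI, mul_mem (hna 0) hw.2.1, mul_left_cancel₀ (mul_ne_zero hm0 h0) ?_⟩
    simp only [Fin.zero_eta]
    rw [mul_assoc, e1]; field_simp
  · refine ⟨n * (a 1)⁻¹ * w.imJ, mul_mem (hna 1) hw.2.2.1,
      mul_left_cancel₀ (mul_ne_zero hm0 h1) ?_⟩
    simp only [Fin.mk_one]
    rw [mul_assoc, e2]; field_simp
  · refine ⟨-(n * w.imK), neg_mem (mul_mem hn hw.2.2.2), mul_left_cancel₀ (neg_ne_zero.mpr hm0) ?_⟩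
    simp only [Fin.reduceFinMk]
    linear_combination e3

end CliffordQuat

/-! ### Minkowski's convex body theorem. -/

open MeasureTheory in
/-- Minkowski's theorem on linear forms, without the optimal constant: the lattice vectors that
are mapped into a ball of fixed radius by a given unimodular map. -/
theorem exists_int_vector_norm_lt {ι E : Type*} [Fintype ι] [NormedAddCommGroup E] [NormedSpace ℝ E]
    [FiniteDimensional ℝ E] [Nontrivial E] (Φ : (ι → ℝ) ≃ₗ[ℝ] E) :
    ∃ R : ℝ, ∀ T : E →ₗ[ℝ] E, |LinearMap.det T| = 1 →
      ∃ k : ι → ℤ, k ≠ 0 ∧ ‖T (Φ fun i => (k i : ℝ))‖ < R := by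
  classical
  let _ : MeasurableSpace E := borel E
  have : BorelSpace E := ⟨rfl⟩
  let μ : Measure E := Measure.addHaar
  let b : Module.Basis ι ℝ E := Module.Basis.ofEquivFun Φ.symm
  have hfund := ZSpan.isAddFundamentalDomain' b μ
  have hcount : Countable (Submodule.span ℤ (Set.range b)).toAddSubgroup := by
    change Countable (Submodule.span ℤ (Set.range b))
    infer_instance
  have hlt : μ (ZSpan.fundamentalDomain b) * 2 ^ Module.finrank ℝ E < ⊤ :=
    ENNReal.mul_lt_top (ZSpan.fundamentalDomain_isBounded b).measure_lt_top (by simp)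
  have hball : μ (Metric.ball 0 1) ≠ 0 := (Metric.measure_ball_pos μ 0 one_pos).ne'
  -- The radius depends only on the covolume. It serves every `T` at once, because `|det T| = 1`
  -- preserves the volume of the ball.
  obtain ⟨r, hr0, hr⟩ : ∃ r : ℝ, 0 < r ∧
      μ (ZSpan.fundamentalDomain b) * 2 ^ Module.finrank ℝ E < μ (Metric.ball 0 r) := by
    have hdim : Module.finrank ℝ E ≠ 0 := Module.finrank_pos.ne'
    set A := μ (ZSpan.fundamentalDomain b) * 2 ^ Module.finrank ℝ E
    have hq : A / μ (Metric.ball 0 1) ≠ ⊤ := (ENNReal.div_lt_top hlt.ne hball).ne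
    refine ⟨(A / μ (Metric.ball 0 1)).toReal + 1, by positivity, ?_⟩
    rw [Measure.addHaar_ball_of_pos μ 0 (by positivity)]
    have h1 : (A / μ (Metric.ball 0 1)).toReal <
        ((A / μ (Metric.ball 0 1)).toReal + 1) ^ Module.finrank ℝ E := by
      refine lt_of_lt_of_le (lt_add_one _) (le_self_pow₀ ?_ hdim)
      linarith [ENNReal.toReal_nonneg (a := A / μ (Metric.ball 0 1))]
    have h2 := (ENNReal.lt_ofReal_iff_toReal_lt hq).mpr h1
    exact (ENNReal.div_lt_iff (Or.inl hball)
      (Or.inl Metric.isBounded_ball.measure_lt_top.ne)).mp h2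
  refine ⟨r, fun T hT => ?_⟩
  have hT0 : LinearMap.det T ≠ 0 := by intro h; rw [h] at hT; simp at hT
  have hvol : μ (T ⁻¹' Metric.ball 0 r) = μ (Metric.ball 0 r) := by
    rw [Measure.addHaar_preimage_linearMap μ hT0, abs_inv, hT]; simp
  obtain ⟨⟨x, hx⟩, hx0, hxT⟩ := exists_ne_zero_mem_lattice_of_measure_mul_two_pow_lt_measure
    (s := T ⁻¹' Metric.ball 0 r) hfund (fun x hx => by simpa using hx)
    ((convex_ball 0 r).linear_preimage T) (by rw [hvol]; exact hr)
  have hx' : x ∈ Submodule.span ℤ (Set.range b) := hx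
  rw [b.mem_span_iff_repr_mem ℤ] at hx'
  choose k hk using hx'
  have hxk : x = Φ fun i => (k i : ℝ) := by
    rw [← Φ.symm_apply_eq]
    ext i
    have := hk i
    simp only [algebraMap_int_eq, eq_intCast] at this
    rw [this]
    rfl
  refine ⟨k, ?_, ?_⟩
  · rintro rfl
    apply hx0
    ext
    simp only [hxk]
    simp [← Pi.zero_def]
  · rw [← hxk]; simpa using hxT

/-- The pairs `(x + ty, x - ty)`. -/
noncomputable def sumDiffEquiv (n : ℕ) {t : ℝ} (ht : t ≠ 0) :
    (Fin n ⊕ Fin n → ℝ) ≃ₗ[ℝ] (Fin n → ℝ) × (Fin n → ℝ) where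
  toFun k := (fun i => k (.inl i) + t * k (.inr i), fun i => k (.inl i) - t * k (.inr i))
  invFun x := Sum.elim (fun i => (x.1 i + x.2 i) / 2) (fun i => (x.1 i - x.2 i) / (2 * t))
  map_add' x y := by ext i <;> simp <;> ring
  map_smul' c x := by ext i <;> simp <;> ring
  left_inv x := by
    ext (i | i)
    · simp
    · simp only [Sum.elim_inr]; field_simp; ring
  right_inv x := by
    ext i
    · simp only [Sum.elim_inl, Sum.elim_inr]; field_simp; ring
    · simp only [Sum.elim_inl, Sum.elim_inr]; field_simp; ring

theorem Set.Finite.exists_finite_reps {X Y : Type*} {S : Set X} (f : X → Y)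
    (h : (f '' S).Finite) : ∃ Z ⊆ S, Z.Finite ∧ ∀ x ∈ S, ∃ z ∈ Z, f x = f z := by
  obtain ⟨Z, hZ, hb⟩ := exists_subset_bijOn S f
  refine ⟨Z, hZ, ?_, fun x hx => ?_⟩
  · exact Set.Finite.of_finite_image (hb.image_eq ▸ h) hb.injOn
  · obtain ⟨z, hz, h⟩ := hb.surjOn (Set.mem_image_of_mem f hx)
    exact ⟨z, hz, h.symm⟩

/-! ### Residue classes of integral quaternions. -/

namespace QuadField.IsConj

variable {F : Type*} [Field F] [NumberField F] {d : ℕ} {s : F} {σ : F ≃ₐ[ℚ] F}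

theorem exists_residues (h : IsConj d s σ) {Q : ℤ} (hQ : Q ≠ 0) :
    ∃ T : Set F, T.Finite ∧ ∀ x ∈ h.order, ∃ t ∈ T, ∃ y ∈ h.order, x = t + (Q : F) * y := by
  refine ⟨(fun q : ℤ × ℤ => (q.1 : F) + q.2 * s) '' (Set.Icc 0 |Q| ×ˢ Set.Icc 0 |Q|),
    ((Set.finite_Icc _ _).prod (Set.finite_Icc _ _)).image _, ?_⟩
  rintro _ ⟨k, l, rfl⟩
  refine ⟨_, ⟨(k % Q, l % Q), ⟨⟨Int.emod_nonneg _ hQ, (Int.emod_lt_abs _ hQ).le⟩,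
    Int.emod_nonneg _ hQ, (Int.emod_lt_abs _ hQ).le⟩, rfl⟩, _, ⟨k / Q, l / Q, rfl⟩, ?_⟩
  have h1 : (k : F) = (k % Q : ℤ) + Q * (k / Q : ℤ) := by
    exact_mod_cast (Int.emod_add_mul_ediv k Q).symm
  have h2 : (l : F) = (l % Q : ℤ) + Q * (l / Q : ℤ) := by
    exact_mod_cast (Int.emod_add_mul_ediv l Q).symm
  conv_lhs => rw [h1, h2]
  ring

end QuadField.IsConj

namespace CliffordQuat

open QuadField

section Residues

variable {F : Type*} [Field F] [NumberField F] {d : ℕ} {s : F} {σ : F ≃ₐ[ℚ] F} {a : Fin 3 → F}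

/-- Finitely many residue classes of quaternions with norms in a finite set. -/
theorem exists_reps (h : IsConj d s σ) {Q : ℤ} (hQ : Q ≠ 0) {N : Set F} (hN : N.Finite) :
    ∃ Z : Set (CliffordQuat a), Z.Finite ∧ (∀ z ∈ Z, z ∈ coordsIn h.order) ∧
      ∀ z ∈ coordsIn (a := a) h.order, nrm z ∈ N → ∃ z₀ ∈ Z, nrm z₀ = nrm z ∧
        ∃ y ∈ coordsIn (a := a) h.order, z = z₀ + (Q : F) • y := by
  classical
  obtain ⟨T, hT, hres⟩ := h.exists_residues hQ
  choose! r hrT w hw hrw using hres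
  let c : CliffordQuat a → F × F × F × F × F := fun z =>
    (nrm z, r z.re, r z.imI, r z.imJ, r z.imK)
  have hfin : (c '' {z | z ∈ coordsIn (a := a) h.order ∧ nrm z ∈ N}).Finite := by
    refine (hN.prod (hT.prod (hT.prod (hT.prod hT)))).subset ?_
    rintro _ ⟨z, ⟨⟨h1, h2, h3, h4⟩, hz⟩, rfl⟩
    exact ⟨hz, hrT _ h1, hrT _ h2, hrT _ h3, hrT _ h4⟩
  obtain ⟨Z, hZ, hZf, hZr⟩ := hfin.exists_finite_reps
  refine ⟨Z, hZf, fun z hz => (hZ hz).1, fun z hz hzN => ?_⟩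
  obtain ⟨z₀, hz₀, heq⟩ := hZr z ⟨hz, hzN⟩
  obtain ⟨h1, h2, h3, h4⟩ := hz
  obtain ⟨k1, k2, k3, k4⟩ := (hZ hz₀).1
  simp only [c, Prod.mk.injEq] at heq
  obtain ⟨e0, e1, e2, e3, e4⟩ := heq
  have key : ∀ x ∈ h.order, ∀ y ∈ h.order, r x = r y → x = y + Q * (w x - w y) := by
    intro x hx y hy hxy
    conv_lhs => rw [hrw x hx, hxy]
    conv_rhs => enter [1]; rw [hrw y hy]
    ring
  exact ⟨z₀, hz₀, e0.symm, ⟨w z.re - w z₀.re, w z.imI - w z₀.imI, w z.imJ - w z₀.imJ,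
    w z.imK - w z₀.imK⟩, ⟨sub_mem (hw _ h1) (hw _ k1), sub_mem (hw _ h2) (hw _ k2),
    sub_mem (hw _ h3) (hw _ k3), sub_mem (hw _ h4) (hw _ k4)⟩,
    QuaternionAlgebra.ext (key _ h1 _ k1 e1) (key _ h2 _ k2 e2) (key _ h3 _ k3 e3)
      (key _ h4 _ k4 e4)⟩

/-- Two congruent quaternions of the same norm differ by a quaternion of norm `1` that is
congruent to `1`. -/
theorem exists_unit_of_congruent {R : Subring F} (haR : ∀ i, a i ∈ R) {z z₀ y : CliffordQuat a}
    (hz₀ : z₀ ∈ coordsIn R) (hy : y ∈ coordsIn R) {k n : F} (hn : n * (nrm z)⁻¹ ∈ R)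
    (hn0 : nrm z ≠ 0) (heq : nrm z₀ = nrm z) (hzy : z = z₀ + (k * n) • y) :
    ∃ x ∈ coordsIn (a := a) R, nrm (1 + k • x) = 1 ∧ (1 + k • x) * z₀ = z := by
  -- The quotient `z z₀⁻¹ = (nrm z)⁻¹ z z̄₀` is the unit sought; the extra factor `n` in the modulus
  -- absorbs the division by the norm.
  have h1 : (1 : CliffordQuat a) + k • ((n * (nrm z)⁻¹) • (y * star z₀)) =
      (nrm z)⁻¹ • (z * star z₀) := by
    rw [hzy, add_mul, mul_star_self, heq, ← hzy, ← QuaternionAlgebra.coe_one, smul_add,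
      QuaternionAlgebra.smul_coe, inv_mul_cancel₀ hn0, smul_mul_assoc, smul_smul, smul_smul]
    congr 2
    ring
  refine ⟨_, smul_mem_coordsIn hn (mul_mem_coordsIn haR hy (star_mem_coordsIn hz₀)), ?_, ?_⟩
  · rw [h1]
    have h2 : ∀ (c : F) (w : CliffordQuat a), nrm (c • w) = c ^ 2 * nrm w := by
      intro c w; simp [nrm]; ring
    rw [h2, nrm_mul, nrm_star, heq]
    field_simp
  · rw [h1, smul_mul_assoc, mul_assoc, star_mul_self', heq, QuaternionAlgebra.mul_coe_eq_smul,
      smul_smul, inv_mul_cancel₀ hn0, one_smul]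

end Residues

end CliffordQuat

/-! ### Moving any point near the base point by an integral quaternion. -/

namespace CliffordQuat

open QuadField

/-- The coordinates of a quaternion. -/
noncomputable def coord {K : Type*} [Field K] (a : Fin 3 → K) : CliffordQuat a ≃ₗ[K] (Fin 4 → K) :=
  QuaternionAlgebra.linearEquivTuple _ _ _

theorem coord_zero {K : Type*} [Field K] {a : Fin 3 → K} (z : CliffordQuat a) :
    coord a z 0 = z.re := rfl

theorem coord_one {K : Type*} [Field K] {a : Fin 3 → K} (z : CliffordQuat a) :
    coord a z 1 = z.imI := rfl

theorem coord_two {K : Type*} [Field K] {a : Fin 3 → K} (z : CliffordQuat a) :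
    coord a z 2 = z.imJ := rfl

theorem coord_three {K : Type*} [Field K] {a : Fin 3 → K} (z : CliffordQuat a) :
    coord a z 3 = z.imK := rfl

section Real

variable {α : Fin 3 → ℝ}

theorem abs_nrm_le (z : CliffordQuat α) {R : ℝ} (hz : ‖coord α z‖ ≤ R) :
    |nrm z| ≤ (1 + |α 1 * α 2| + |α 0 * α 2| + |α 0 * α 1 * α 2 ^ 2|) * R ^ 2 := by
  have hi : ∀ i, coord α z i ^ 2 ≤ R ^ 2 := fun i => by
    rw [← sq_abs]
    exact pow_le_pow_left₀ (abs_nonneg _) ((norm_le_pi_norm (coord α z) i).trans hz) 2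
  have h0 := hi 0
  have h1 := hi 1
  have h2 := hi 2
  have h3 := hi 3
  rw [coord_zero] at h0
  rw [coord_one] at h1
  rw [coord_two] at h2
  rw [coord_three] at h3
  have key : ∀ c x : ℝ, x ^ 2 ≤ R ^ 2 → |c * x ^ 2| ≤ |c| * R ^ 2 := fun c x hx => by
    rw [abs_mul, abs_of_nonneg (sq_nonneg x)]
    exact mul_le_mul_of_nonneg_left hx (abs_nonneg c)
  have k1 := key (α 1 * α 2) _ h1
  have k2 := key (α 0 * α 2) _ h2
  have k3 := key (α 0 * α 1 * α 2 ^ 2) _ h3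
  rw [nrm]
  refine (abs_add_le _ _).trans ?_
  have t1 := abs_add_le (z.re ^ 2) (α 1 * α 2 * z.imI ^ 2)
  have t2 := abs_add_le (z.re ^ 2 + α 1 * α 2 * z.imI ^ 2) (α 0 * α 2 * z.imJ ^ 2)
  rw [abs_of_nonneg (sq_nonneg z.re)] at t1
  linarith

theorem nrm_pos {ε : ℝ} (hα : ∀ i, 0 < ε * α i) {z : CliffordQuat α} (hz : z ≠ 0) :
    0 < nrm z := by
  have hε : 0 < ε ^ 2 := by
    have : ε ≠ 0 := by rintro rfl; simpa using hα 0
    positivity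
  have hpos : ∀ i j, 0 < α i * α j := fun i j => by
    have h1 := mul_pos (hα i) (hα j)
    have h2 : ε * α i * (ε * α j) = ε ^ 2 * (α i * α j) := by ring
    rw [h2] at h1
    exact (mul_pos_iff_of_pos_left hε).mp h1
  have h3 : 0 < α 0 * α 1 * α 2 ^ 2 :=
    mul_pos (hpos 0 1) (by have := hpos 2 2; rwa [← pow_two] at this)
  have hne : 0 < z.re ^ 2 + z.imI ^ 2 + z.imJ ^ 2 + z.imK ^ 2 := by
    rcases lt_or_eq_of_le (by positivity : 0 ≤ z.re ^ 2 + z.imI ^ 2 + z.imJ ^ 2 + z.imK ^ 2)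
      with h | h
    · exact h
    · exfalso
      apply hz
      ext
      · change z.re = 0; nlinarith [sq_nonneg z.imI, sq_nonneg z.imJ, sq_nonneg z.imK]
      · change z.imI = 0; nlinarith [sq_nonneg z.re, sq_nonneg z.imJ, sq_nonneg z.imK]
      · change z.imJ = 0; nlinarith [sq_nonneg z.imI, sq_nonneg z.re, sq_nonneg z.imK]
      · change z.imK = 0; nlinarith [sq_nonneg z.imI, sq_nonneg z.imJ, sq_nonneg z.re]
  have m1 := mul_nonneg (hpos 1 2).le (sq_nonneg z.imI)
  have m2 := mul_nonneg (hpos 0 2).le (sq_nonneg z.imJ)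
  have m3 := mul_nonneg h3.le (sq_nonneg z.imK)
  rw [nrm]
  by_contra hcon
  have n0 : z.re ^ 2 = 0 := le_antisymm (by linarith) (sq_nonneg _)
  have n1 : z.imI ^ 2 = 0 := by
    have : α 1 * α 2 * z.imI ^ 2 = 0 := le_antisymm (by linarith [sq_nonneg z.re]) m1
    exact (mul_eq_zero.mp this).resolve_left (hpos 1 2).ne'
  have n2 : z.imJ ^ 2 = 0 := by
    have : α 0 * α 2 * z.imJ ^ 2 = 0 := le_antisymm (by linarith [sq_nonneg z.re]) m2
    exact (mul_eq_zero.mp this).resolve_left (hpos 0 2).ne'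
  have n3 : z.imK ^ 2 = 0 := by
    have : α 0 * α 1 * α 2 ^ 2 * z.imK ^ 2 = 0 :=
      le_antisymm (by linarith [sq_nonneg z.re]) m3
    exact (mul_eq_zero.mp this).resolve_left h3.ne'
  linarith

/-- The displacement of a point by a bounded quaternion is bounded. -/
theorem exists_bound_rot (α o : Fin 3 → ℝ) (R : ℝ) :
    ∃ C, ∀ z : CliffordQuat α, ‖coord α z‖ ≤ R → |diagForm α o (rot z o)| ≤ C := by
  have hcont : Continuous fun q : Fin 4 → ℝ => diagForm α o (rot ((coord α).symm q) o) := by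
    have hq : ∀ q : Fin 4 → ℝ, (coord α).symm q = ⟨q 0, q 1, q 2, q 3⟩ := fun q => rfl
    simp only [hq, diagForm, rot_apply, vec, QuaternionAlgebra.imI_mul, QuaternionAlgebra.imJ_mul,
      QuaternionAlgebra.imK_mul, QuaternionAlgebra.re_mul, QuaternionAlgebra.re_star,
      QuaternionAlgebra.imI_star, QuaternionAlgebra.imJ_star, QuaternionAlgebra.imK_star,
      Matrix.cons_val_zero, Matrix.cons_val_one, Matrix.cons_val_two, Matrix.head_cons,
      Matrix.tail_cons]
    fun_prop
  obtain ⟨C, hC⟩ := (isCompact_closedBall (0 : Fin 4 → ℝ) R).exists_bound_of_continuousOn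
    hcont.continuousOn
  refine ⟨C, fun z hz => ?_⟩
  have := hC (coord α z) (by simpa using hz)
  simpa using this

end Real

section Arithmetic

variable {F : Type*} [Field F] [NumberField F] [Algebra F ℝ] {d : ℕ} {s : F} {σ : F ≃ₐ[ℚ] F}

/-- Quaternions over `ℤ[√d]` form a lattice in `ℝ⁴ × ℝ⁴` through the two embeddings. Multiplication
by `u` on the first factor has fourth power `1`, hence determinant `±1`, so Minkowski's theorem
gives an `R` independent of `u`. -/
theorem exists_small_mul (h : IsConj d s σ) (a : Fin 3 → F) :
    ∃ R : ℝ, ∀ u : CliffordQuat (fun i => algebraMap F ℝ (a i)), u * u = 1 ∨ u * u = -1 →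
      ∃ z ∈ coordsIn (a := a) h.order, z ≠ 0 ∧ ‖coord _ (u * map (algebraMap F ℝ) z)‖ ≤ R ∧
        ‖coord _ (map ((algebraMap F ℝ).comp (σ : F →+* F)) z)‖ ≤ R := by
  set τ := algebraMap F ℝ
  have ht : τ s ≠ 0 := by simpa [τ] using h.s_ne_zero
  obtain ⟨R, hR⟩ := exists_int_vector_norm_lt (sumDiffEquiv 4 ht)
  refine ⟨R, fun u hu => ?_⟩
  let T₁ : (Fin 4 → ℝ) →ₗ[ℝ] (Fin 4 → ℝ) := (coord _).toLinearMap ∘ₗ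
    LinearMap.mulLeft ℝ u ∘ₗ (coord _).symm.toLinearMap
  let T : (Fin 4 → ℝ) × (Fin 4 → ℝ) →ₗ[ℝ] (Fin 4 → ℝ) × (Fin 4 → ℝ) :=
    LinearMap.prodMap T₁ LinearMap.id
  have hT₁ : ∀ q, T₁ (T₁ (T₁ (T₁ q))) = q := by
    intro q
    have h2 : ∀ q, T₁ (T₁ q) = coord _ (u * u * (coord _).symm q) := fun q => by
      simp [T₁, mul_assoc]
    rw [h2, h2]
    rcases hu with hu | hu <;> simp [hu]
  have hdet : |LinearMap.det T| = 1 := by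
    have h4 : T ^ 4 = 1 := by
      refine LinearMap.ext fun q => Prod.ext ?_ ?_
      · exact hT₁ q.1
      · rfl
    have h5 : LinearMap.det T ^ 4 = 1 := by rw [← map_pow, h4, map_one]
    have h6 : |LinearMap.det T| ^ 4 = 1 := by rw [← abs_pow, h5, abs_one]
    exact (pow_eq_one_iff_of_nonneg (abs_nonneg _) (by norm_num)).mp h6
  obtain ⟨k, hk0, hk⟩ := hR T hdet
  let q : Fin 4 → F := fun i => (k (.inl i) : F) + (k (.inr i) : F) * s
  refine ⟨(coord a).symm q, ?_, ?_, ?_, ?_⟩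
  · exact ⟨⟨_, _, rfl⟩, ⟨_, _, rfl⟩, ⟨_, _, rfl⟩, ⟨_, _, rfl⟩⟩
  · intro h0
    apply hk0
    have hq : q = 0 := by simpa using h0
    have hii : ∀ i, k (.inl i) = 0 ∧ k (.inr i) = 0 := fun i => by
      have h1 : (k (.inl i) : F) + (k (.inr i) : F) * s = 0 := congrFun hq i
      have h2 : (k (.inl i) : F) - (k (.inr i) : F) * s = 0 := by
        have := congrArg σ h1
        simpa [h.map, sub_eq_add_neg] using this
      have h3 : (2 : F) * (k (.inl i) : F) = 0 := by linear_combination h1 + h2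
      have h4 : (k (.inl i) : F) = 0 := (mul_eq_zero.mp h3).resolve_left two_ne_zero
      have h5 : (k (.inr i) : F) = 0 := by
        rw [h4, zero_add] at h1
        exact (mul_eq_zero.mp h1).resolve_right h.s_ne_zero
      exact ⟨by exact_mod_cast h4, by exact_mod_cast h5⟩
    ext (i | i)
    · exact (hii i).1
    · exact (hii i).2
  · refine le_trans (le_of_eq ?_) ((norm_fst_le _).trans hk.le)
    have e : map τ ((coord a).symm q) = (coord fun i => τ (a i)).symm
        (sumDiffEquiv 4 ht fun i => (k i : ℝ)).1 := by
      apply QuaternionAlgebra.ext <;> simp [map, q, coord, sumDiffEquiv, τ, mul_comm]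
    rw [e]
    rfl
  · refine le_trans (le_of_eq ?_) ((norm_snd_le _).trans hk.le)
    congr 1
    have e : ∀ i, ((algebraMap F ℝ).comp (σ : F →+* F)) (q i) =
        (k (.inl i) : ℝ) - τ s * (k (.inr i) : ℝ) := fun i => by
      simp [q, τ, mul_comm, h.map, sub_eq_add_neg]
    ext i
    fin_cases i
    exacts [e 0, e 1, e 2, e 3]

/-- The half-turn about `x + o` exchanges `x` and `o`. With `u` its normalized quaternion, `x ·
rot(z)o = ± o · rot(uz)o` is bounded as soon as `uz` is, and the norm of `z` is bounded at both
embeddings. -/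
theorem exists_reduction (h : IsConj d s σ) {a : Fin 3 → F} (haR : ∀ i, a i ∈ h.order)
    {ε : ℝ} (hε : ∀ i, 0 < ε * algebraMap F ℝ (σ (a i))) {o : Fin 3 → ℝ}
    (ho : diagForm (fun i => algebraMap F ℝ (a i)) o o = -1) :
    ∃ (C : ℝ) (N : Set F), N.Finite ∧ 0 ∉ N ∧ ∀ x,
      diagForm (fun i => algebraMap F ℝ (a i)) x x = -1 →
      diagForm (fun i => algebraMap F ℝ (a i)) x o < 0 →
      ∃ z ∈ coordsIn (a := a) h.order, nrm z ∈ N ∧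
        |diagForm (fun i => algebraMap F ℝ (a i)) x (rot (map (algebraMap F ℝ) z) o)| ≤ C := by
  obtain ⟨R, hR⟩ := exists_small_mul h a
  set τ := algebraMap F ℝ with hτ
  set α : Fin 3 → ℝ := fun i => τ (a i) with hα
  set α' : Fin 3 → ℝ := fun i => ((algebraMap F ℝ).comp (σ : F →+* F)) (a i) with hα'
  obtain ⟨C, hC⟩ := exists_bound_rot α o R
  have ha0 : ∀ i, a i ≠ 0 := fun i h0 => by have := hε i; rw [h0] at this; simp at this
  have hα0 : ∀ i, α i ≠ 0 := fun i h0 => ha0 i (by simpa [hα, hτ] using h0)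
  let K : (Fin 3 → ℝ) → ℝ := fun α =>
    (1 + |α 1 * α 2| + |α 0 * α 2| + |α 0 * α 1 * α 2 ^ 2|) * R ^ 2
  refine ⟨C, {x | x ∈ h.order ∧ τ x ^ 2 ≤ K α ^ 2 ∧ τ (σ x) ^ 2 ≤ K α' ^ 2} \ {0},
    (h.finite_order _ _).sdiff, by simp, fun x hx hxo => ?_⟩
  have hsymm : ∀ v w, diagForm α v w = diagForm α w v := fun v w => by simp [diagForm]; ring
  have hdp : α 0 * α 1 * α 2 ≠ 0 := mul_ne_zero (mul_ne_zero (hα0 0) (hα0 1)) (hα0 2)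
  set δ := α 0 * α 1 * α 2 with hδ
  have hww : diagForm α (x + o) (x + o) = 2 * (diagForm α x o - 1) := by
    have : diagForm α (x + o) (x + o) = diagForm α x x + 2 * diagForm α x o + diagForm α o o := by
      simp [diagForm]; ring
    rw [this, hx, ho]; ring
  set n := nrm (vec α (x + o)) with hn
  have hn1 : n = δ * (2 * (diagForm α x o - 1)) := by rw [hn, nrm_vec, hww]
  have hn0 : n ≠ 0 := by
    rw [hn1]
    exact mul_ne_zero hdp (mul_ne_zero two_ne_zero (by linarith))
  have hwo : rot (vec α (x + o)) o = n • x := by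
    have h1 : diagForm α (x + o) o = diagForm α x o - 1 := by
      have : diagForm α (x + o) o = diagForm α x o + diagForm α o o := by simp [diagForm]; ring
      rw [this, ho]; ring
    rw [rot_vec hα0, h1, hww, hn1, ← smul_sub, smul_smul, add_sub_cancel_right]
  have hwx : rot (vec α (x + o)) x = n • o := by
    have h1 : diagForm α (x + o) x = diagForm α x o - 1 := by
      have : diagForm α (x + o) x = diagForm α x x + diagForm α x o := by simp [diagForm]; ring
      rw [this, hx]; ring
    rw [rot_vec hα0, h1, hww, hn1, ← smul_sub, smul_smul, add_sub_cancel_left]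
  set c := Real.sqrt |n|⁻¹ with hc
  have hc2 : c ^ 2 = |n|⁻¹ := Real.sq_sqrt (by positivity)
  have hrot_smul : ∀ (z : CliffordQuat α) (v : Fin 3 → ℝ), rot (c • z) v = c ^ 2 • rot z v := by
    intro z v
    rw [← QuaternionAlgebra.coe_mul_eq_smul, rot_mul hα0, rot_coe hα0]
  obtain ⟨u, hu⟩ : ∃ u, u = c • vec α (x + o) := ⟨_, rfl⟩
  obtain ⟨η, hη, hη2⟩ : ∃ η : ℝ, c ^ 2 * n = η ∧ (η = 1 ∨ η = -1) := by
    refine ⟨_, rfl, ?_⟩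
    rw [hc2]
    rcases abs_choice n with h1 | h1 <;> rw [h1]
    · left; exact inv_mul_cancel₀ hn0
    · right; field_simp
  have hηη : η * η = 1 := by rcases hη2 with h1 | h1 <;> rw [h1] <;> norm_num
  have huo : rot u o = η • x := by rw [hu, hrot_smul, hwo, smul_smul, hη]
  have hux : rot u x = η • o := by rw [hu, hrot_smul, hwx, smul_smul, hη]
  have hnu : nrm u = η := by
    rw [hu, ← hη, hn]
    simp only [nrm, QuaternionAlgebra.re_smul, QuaternionAlgebra.imI_smul,
      QuaternionAlgebra.imJ_smul, QuaternionAlgebra.imK_smul, smul_eq_mul]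
    ring
  have huu : u * u = ((-η : ℝ) : CliffordQuat α) := by
    rw [hu, smul_mul_smul_comm, vec_mul_self, QuaternionAlgebra.smul_coe, ← hn, ← hη]
    congr 1; ring
  obtain ⟨z, hz, hz0, hz1, hz2⟩ := hR u (by
    rcases hη2 with h1 | h1 <;> rw [huu, h1]
    · right; rw [QuaternionAlgebra.coe_neg, QuaternionAlgebra.coe_one]
    · left; rw [neg_neg, QuaternionAlgebra.coe_one])
  refine ⟨z, hz, ⟨⟨nrm_mem haR hz, ?_, ?_⟩, ?_⟩, ?_⟩
  · have h1 := abs_nrm_le _ hz1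
    have h2 : |nrm (u * map τ z)| = |τ (nrm z)| := by
      rw [nrm_mul, hnu, nrm_map, abs_mul]
      rcases hη2 with h1 | h1 <;> rw [h1] <;> simp
    rw [h2] at h1
    rw [← sq_abs]
    exact pow_le_pow_left₀ (abs_nonneg _) h1 2
  · have h1 := abs_nrm_le _ hz2
    rw [nrm_map] at h1
    rw [← sq_abs]
    exact pow_le_pow_left₀ (abs_nonneg _) h1 2
  -- The norm form is positive definite at the conjugate embedding, so `z ≠ 0` has nonzero norm.
  · intro hcon
    have h1 := nrm_pos (α := α') hε (z := map ((algebraMap F ℝ).comp (σ : F →+* F)) z) (by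
      intro h0
      apply hz0
      have inj := ((algebraMap F ℝ).comp (σ : F →+* F)).injective
      ext
      · exact inj ((congrArg QuaternionAlgebra.re h0).trans (map_zero _).symm)
      · exact inj ((congrArg QuaternionAlgebra.imI h0).trans (map_zero _).symm)
      · exact inj ((congrArg QuaternionAlgebra.imJ h0).trans (map_zero _).symm)
      · exact inj ((congrArg QuaternionAlgebra.imK h0).trans (map_zero _).symm))
    rw [nrm_map, hcon, map_zero] at h1
    exact lt_irrefl _ h1
  · have h1 := hC _ hz1
    have h2 : diagForm α o (rot (u * map τ z) o) = η * diagForm α x (rot (map τ z) o) := by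
      have h3 : o = η • rot u x := by rw [hux, smul_smul, hηη, one_smul]
      conv_lhs => enter [2]; rw [h3]
      rw [rot_mul hα0]
      have h4 : ∀ v w, diagForm α (η • v) w = η * diagForm α v w := fun v w => by
        simp [diagForm]; ring
      rw [h4, diagForm_rot hα0, hnu, pow_two, hηη, one_mul]
    rw [h2, abs_mul] at h1
    rcases hη2 with h5 | h5 <;> rw [h5] at h1 <;> simpa using h1

end Arithmetic

end CliffordQuat

/-! ### Cocompactness of the automorphism group. -/

namespace QuadLattice

open Minkowski QuadField CliffordQuat

variable {F : Type*} [Field F] [NumberField F] [Algebra F ℝ]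
variable {V : Type*} [AddCommGroup V] [Module F V] [Module (𝓞 F) V] [IsScalarTower (𝓞 F) F V]
variable {B : LinearMap.BilinForm F V} {L : Submodule (𝓞 F) V} {p : RealSpace F V}
  {e : Module.Basis (Fin 3) ℝ (RealSpace F V)} {d : ℕ} {s : F} {σ : F ≃ₐ[ℚ] F} {ε : ℝ}
  {h : IsConj d s σ} {f : Module.Basis (Fin 3) F V} {m : ℤ}

theorem IsAdapted.form_eq (hf : IsAdapted h B L f m) (v w : V) :
    B v w = diagForm (fun i => B (f i) (f i)) (f.equivFun v) (f.equivFun w) := by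
  have key : B v w = ∑ i, f.repr v i * B (f i) w := by
    conv_lhs => rw [← f.sum_repr v]
    rw [map_sum, LinearMap.sum_apply]
    simp only [map_smul, LinearMap.smul_apply, smul_eq_mul]
  rw [key, Fin.sum_univ_three, hf.form_repr w, hf.form_repr w, hf.form_repr w,
    diagForm]
  simp only [Module.Basis.equivFun_apply]
  ring

/-- The coordinates of real vectors. -/
noncomputable def realCoord (f : Module.Basis (Fin 3) F V) : RealSpace F V ≃ₗ[ℝ] (Fin 3 → ℝ) :=
  (f.baseChange ℝ).equivFun

theorem realCoord_toReal (f : Module.Basis (Fin 3) F V) (v : V) :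
    realCoord f (toReal v) = fun i => algebraMap F ℝ (f.equivFun v i) := by
  ext i
  rw [realCoord, Module.Basis.equivFun_apply, toReal, Module.Basis.baseChange_repr_tmul,
    Algebra.smul_def, mul_one, Module.Basis.equivFun_apply]

theorem IsAdapted.realForm_eq (hf : IsAdapted h B L f m) (x y : RealSpace F V) :
    realForm B x y =
      diagForm (fun i => algebraMap F ℝ (B (f i) (f i))) (realCoord f x) (realCoord f y) := by
  induction x using realSpace_induction with
  | h0 => simp [diagForm]
  | hadd x x' hx hx' =>
    rw [map_add, LinearMap.add_apply, hx, hx', map_add]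
    simp only [diagForm, Pi.add_apply]; ring
  | h1 c v =>
    induction y using realSpace_induction with
    | h0 => simp [diagForm]
    | hadd y y' hy hy' =>
      rw [map_add, hy, hy', map_add]
      simp only [diagForm, Pi.add_apply]; ring
    | h1 c' w =>
      simp only [map_smul, LinearMap.smul_apply, realForm_toReal, realCoord_toReal, diagForm,
        Pi.smul_apply, smul_eq_mul, hf.form_eq v w, map_add, map_mul]
      ring

/-- The rotation of `V` by a quaternion of norm `1`. -/
noncomputable def rotEquiv {a : Fin 3 → F} (ha : ∀ i, a i ≠ 0) (f : Module.Basis (Fin 3) F V)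
    (z : CliffordQuat a) (hz : nrm z = 1) : V ≃ₗ[F] V :=
  f.equivFun ≪≫ₗ LinearEquiv.ofLinearMap (rot z) (rot (star z))
    (LinearMap.ext fun v => by
      rw [LinearMap.comp_apply, rot_rot_star ha, hz, one_pow, one_smul]; rfl)
    (LinearMap.ext fun v => by
      rw [LinearMap.comp_apply, rot_star_rot ha, hz, one_pow, one_smul]; rfl) ≪≫ₗ f.equivFun.symm

theorem equivFun_rotEquiv {a : Fin 3 → F} (ha : ∀ i, a i ≠ 0) (z : CliffordQuat a)
    (hz : nrm z = 1) (v : V) : f.equivFun (rotEquiv ha f z hz v) = rot z (f.equivFun v) := by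
  change f.equivFun (f.equivFun.symm (rot z (f.equivFun v))) = _
  rw [LinearEquiv.apply_symm_apply]

theorem realCoord_rotEquiv {a : Fin 3 → F} (ha : ∀ i, a i ≠ 0) (z : CliffordQuat a)
    (hz : nrm z = 1) (x : RealSpace F V) : realCoord f (realAct (rotEquiv ha f z hz) x) =
      rot (CliffordQuat.map (algebraMap F ℝ) z) (realCoord f x) := by
  induction x using realSpace_induction with
  | h0 => simp
  | hadd x y hx hy => rw [map_add, map_add, hx, hy, map_add, map_add]
  | h1 c v =>
    rw [map_smul, map_smul, map_smul, map_smul, realAct_toReal, realCoord_toReal,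
      realCoord_toReal, equivFun_rotEquiv, rot_map]

theorem IsAdapted.rotEquiv_isometry (hf : IsAdapted h B L f m) (ha : ∀ i, B (f i) (f i) ≠ 0)
    (z : CliffordQuat fun i => B (f i) (f i)) (hz : nrm z = 1) (v w : V) :
    B (rotEquiv ha f z hz v) (rotEquiv ha f z hz w) = B v w := by
  rw [hf.form_eq, equivFun_rotEquiv, equivFun_rotEquiv, diagForm_rot ha, hz, hf.form_eq v w]
  ring

/-- By `rot_one_add` a lattice vector moves by an integral combination of the vectors `m f i` of
`L`. The inverse is the rotation by the conjugate quaternion, which has the same shape. -/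
theorem IsAdapted.rotEquiv_mem (hf : IsAdapted h B L f m) (ha : ∀ i, B (f i) (f i) ≠ 0) {n : ℤ}
    (hn : ∀ i, (n : F) * (B (f i) (f i))⁻¹ ∈ h.order)
    {x : CliffordQuat fun i => B (f i) (f i)} (hx : x ∈ coordsIn h.order)
    (hz : nrm (1 + ((m : F) ^ 2 * n) • x) = 1) (v : V) :
    rotEquiv ha f _ hz v ∈ L ↔ v ∈ L := by
  have key : ∀ {x : CliffordQuat fun i => B (f i) (f i)}, x ∈ coordsIn h.order → ∀ v ∈ L,
      f.equivFun.symm (rot (1 + ((m : F) ^ 2 * n) • x) (f.equivFun v)) ∈ L := by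
    intro x hx v hv
    have h1 := rot_one_add ha hf.norm_mem (m := (m : F)) (n := (n : F))
      (by exact_mod_cast hf.ne_zero) (h.intCast_mem_order m) (h.intCast_mem_order n) hn hx
      (v := f.equivFun v) (by simpa using hf.repr_mem v hv)
    choose c hc hcv using h1
    have h2 : f.equivFun.symm (rot (1 + ((m : F) ^ 2 * n) • x) (f.equivFun v)) =
        v + ∑ i, c i • (m : F) • f i := by
      apply f.equivFun.injective
      rw [LinearEquiv.apply_symm_apply]
      ext i
      rw [hcv, map_add, Pi.add_apply, map_sum, Finset.sum_apply, Finset.sum_eq_single i]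
      · simp [mul_comm]
      · intro j _ hj; simp [hj]
      · simp
    rw [h2]
    exact add_mem hv (sum_mem fun i _ => order_smul_mem h (hc i) (hf.smul_mem i))
  refine ⟨fun hv => ?_, fun hv => key hx v hv⟩
  have h1 := key (star_mem_coordsIn hx) _ hv
  have h2 : (1 : CliffordQuat fun i => B (f i) (f i)) + ((m : F) ^ 2 * n) • star x =
      star (1 + ((m : F) ^ 2 * n) • x) := by
    rw [star_add, star_one, QuaternionAlgebra.star_smul']
  rwa [equivFun_rotEquiv, h2, rot_star_rot ha, hz, one_pow, one_smul,
    LinearEquiv.symm_apply_apply] at h1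

/-- The automorphism group of an arithmetic lattice acts cocompactly. -/
theorem autGroup_cobounded (he : IsLorentzBasis (realForm B) e) (hp : realForm B p p < 0)
    (hε : ∀ v : V, v ≠ 0 → 0 < ε * algebraMap F ℝ (σ (B v v)))
    (hf : IsAdapted h B L f m) {o : RealSpace F V} (ho : realForm B o o = -1) :
    ∃ D : ℝ, ∀ x, realForm B x x = -1 → realForm B x o < 0 →
      ∃ g ∈ autGroup B L p, realForm B (realAct g o) o < 0 ∧
        -realForm B x (realAct g o) ≤ D := by
  set τ := algebraMap F ℝ
  set a : Fin 3 → F := fun i => B (f i) (f i) with ha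
  have hεa : ∀ i, 0 < ε * τ (σ (a i)) := fun i => hε _ (f.ne_zero i)
  have ha0 : ∀ i, a i ≠ 0 := fun i h0 => by have := hεa i; rw [h0] at this; simp at this
  have hα0 : ∀ i, τ (a i) ≠ 0 := fun i h0 => ha0 i (by simpa [τ] using h0)
  have hform := hf.realForm_eq
  obtain ⟨C, N, hN, hN0, hred⟩ := exists_reduction h hf.norm_mem hεa
    (o := realCoord f o) (by rw [← hform, ho])
  obtain ⟨k, hk, hkN⟩ := h.exists_common_mul_mem_order (hN.image fun x => x⁻¹)
  obtain ⟨n, hn, hna⟩ := h.exists_common_mul_mem_order (Set.finite_range fun i => (a i)⁻¹)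
  -- Congruence modulo `m²n` makes a rotation preserve `L`; the factor `k` allows division by the
  -- norms in `N`.
  have hQ : m ^ 2 * n * k ≠ 0 := mul_ne_zero (mul_ne_zero (pow_ne_zero 2 hf.ne_zero) hn) hk
  obtain ⟨Z, hZ, hZmem, hZrep⟩ := exists_reps (a := a) h hQ hN
  have hon : realForm B o o < 0 := by rw [ho]; norm_num
  -- the normalized images of the base point
  let q : CliffordQuat a → RealSpace F V := fun z =>
    (τ (nrm z))⁻¹ • (realCoord f).symm (rot (CliffordQuat.map τ z) (realCoord f o))
  have hq1 : ∀ z, nrm z ≠ 0 → realForm B (q z) (q z) = -1 := by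
    intro z hz
    have hz' : τ (nrm z) ≠ 0 := by simpa [τ] using hz
    simp only [q, map_smul, LinearMap.smul_apply, smul_eq_mul]
    rw [hform, LinearEquiv.apply_symm_apply, diagForm_rot hα0, ← hform, ho, nrm_map]
    field_simp
  obtain ⟨E, hE⟩ : ∃ E, ∀ z ∈ Z, 2 * (|τ (nrm z)|⁻¹ * C * |realForm B (q z) o|) ≤ E := by
    obtain ⟨E, hE⟩ := (hZ.image fun z => 2 * (|τ (nrm z)|⁻¹ * C * |realForm B (q z) o|)).bddAbove
    exact ⟨E, fun z hz => hE (Set.mem_image_of_mem _ hz)⟩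
  refine ⟨E, fun x hx hxo => ?_⟩
  obtain ⟨z, hz, hzN, hzC⟩ := hred (realCoord f x) (by rw [← hform, hx]) (by rw [← hform]; exact hxo)
  obtain ⟨z₀, hz₀, hz₀n, y, hy, hzy⟩ := hZrep z hz hzN
  have hz0 : nrm z ≠ 0 := fun h0 => hN0 (h0 ▸ hzN)
  obtain ⟨w, hw, hw1, hwz⟩ := exists_unit_of_congruent (k := (m : F) ^ 2 * n) (n := (k : F))
    hf.norm_mem (hZmem z₀ hz₀) hy (hkN _ ⟨_, hzN, rfl⟩) hz0 hz₀n
    (by rw [hzy]; push_cast; rfl)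
  set g := rotEquiv ha0 f _ hw1 with hg
  have hiso := hf.rotEquiv_isometry ha0 _ hw1
  have hgL := hf.rotEquiv_mem ha0 (fun i => hna _ ⟨i, rfl⟩) hw hw1
  have hgq : realAct g (q z₀) = (τ (nrm z))⁻¹ •
      (realCoord f).symm (rot (CliffordQuat.map τ z) (realCoord f o)) := by
    simp only [q, hz₀n, map_smul]
    congr 1
    apply (realCoord f).injective
    rw [hg, realCoord_rotEquiv, LinearEquiv.apply_symm_apply, LinearEquiv.apply_symm_apply,
      ← rot_mul hα0, ← CliffordQuat.map_mul', hwz]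
  have hxq : |realForm B x (realAct g (q z₀))| ≤ |τ (nrm z)|⁻¹ * C := by
    rw [hgq, map_smul, smul_eq_mul, abs_mul, abs_inv, hform, LinearEquiv.apply_symm_apply]
    exact mul_le_mul_of_nonneg_left hzC (by positivity)
  -- a sign makes the rotation preserve the cones
  obtain ⟨g', η, hη, hg'⟩ : ∃ (g' : V ≃ₗ[F] V) (η : F), (η = 1 ∨ η = -1) ∧ (∀ v, g' v = η • g v) ∧
      realForm B o (realAct g' o) < 0 := by
    have hgo : realForm B (realAct g o) (realAct g o) < 0 := by rw [realAct_isometry hiso]; exact hon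
    rcases lt_or_gt_of_ne (he.ne_zero_of_timelike hon hgo) with h1 | h1
    · exact ⟨g, 1, Or.inl rfl, fun v => (one_smul _ _).symm, h1⟩
    · refine ⟨g ≪≫ₗ LinearEquiv.neg F, -1, Or.inr rfl, fun v => by simp, ?_⟩
      have : ∀ x, realAct (g ≪≫ₗ LinearEquiv.neg F) x = -realAct g x := by
        intro x
        induction x using realSpace_induction with
        | h0 => simp
        | hadd x y hx hy => rw [map_add, map_add, hx, hy, neg_add]
        | h1 c v =>
          rw [map_smul, map_smul, realAct_toReal, realAct_toReal]
          exact (congrArg (c • ·) (TensorProduct.tmul_neg _ _)).trans (smul_neg c (toReal (g v)))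
      rw [this, map_neg]; linarith
  obtain ⟨hg', hg'o⟩ := hg'
  have hactg : ∀ x, realAct g' x = τ η • realAct g x := by
    intro x
    induction x using realSpace_induction with
    | h0 => simp
    | hadd x y hx hy => rw [map_add, map_add, hx, hy, smul_add]
    | h1 c v =>
      rw [map_smul, map_smul, realAct_toReal, realAct_toReal, hg', toReal_smul, smul_comm]
  have hηη : η * η = 1 := by rcases hη with h1 | h1 <;> rw [h1] <;> norm_num
  have hτη : |τ η| = 1 := by rcases hη with h1 | h1 <;> rw [h1] <;> simp
  have hiso' : ∀ v w, B (g' v) (g' w) = B v w := fun v w => by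
    rw [hg', hg']
    simp only [map_smul, LinearMap.smul_apply, smul_eq_mul]
    rw [hiso, ← mul_assoc, hηη, one_mul]
  have hgL' : ∀ v, g' v ∈ L ↔ v ∈ L := fun v => by
    rw [hg', ← hgL v]
    rcases hη with h1 | h1 <;> rw [h1]
    · rw [one_smul]
    · rw [neg_one_smul, neg_mem_iff]
  have hmem : ∀ p, realForm B p p < 0 → g' ∈ autGroup B L p := fun p hp =>
    mem_autGroup_of_isometry he hp hiso' hgL' hon hg'o
  refine ⟨g', hmem p hp, by rw [he.symm]; exact hg'o, ?_⟩
  -- the sign of the normalized image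
  obtain ⟨t, ht, hto⟩ : ∃ t : ℝ, (t = 1 ∨ t = -1) ∧ t * realForm B (q z₀) o < 0 := by
    rcases lt_or_gt_of_ne (he.ne_zero_of_timelike
      (by rw [hq1 z₀ (by rwa [hz₀n])]; norm_num : realForm B (q z₀) (q z₀) < 0) hon) with h1 | h1
    · exact ⟨1, Or.inl rfl, by linarith⟩
    · exact ⟨-1, Or.inr rfl, by linarith⟩
  have htt : t * t = 1 := by rcases ht with h1 | h1 <;> rw [h1] <;> norm_num
  have hta : |t| = 1 := by rcases ht with h1 | h1 <;> rw [h1] <;> simp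
  have hr1 : realForm B (t • q z₀) (t • q z₀) = -1 := by
    simp only [map_smul, LinearMap.smul_apply, smul_eq_mul]
    rw [hq1 z₀ (by rwa [hz₀n]), ← mul_assoc, htt, one_mul]
  have hr2 : realForm B (t • q z₀) o < 0 := by
    rw [map_smul, LinearMap.smul_apply, smul_eq_mul]; exact hto
  have hr3 : realForm B (realAct g' (t • q z₀)) o < 0 :=
    ((future_of_mem_autGroup (hmem o hon)).mpr ⟨by rw [hr1]; norm_num, hr2⟩).2
  have hr4 : realForm B (realAct g' (t • q z₀)) (realAct g' (t • q z₀)) = -1 := by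
    rw [realAct_isometry hiso', hr1]
  have hr5 : realForm B x (realAct g' (t • q z₀)) < 0 :=
    he.neg_of_future hon (by rw [hx]; norm_num) (by rw [hr4]; norm_num) hxo hr3
  -- From `x` to `g' o` by way of the image of `± q z₀`: the first leg is bounded by the choice of
  -- `z`, the second because `Z` is finite.
  have hr6 := he.triangle hx hr4 (z := realAct g' o) (by rw [realAct_isometry hiso', ho]) hr5
    (by rw [realAct_isometry hiso']; exact hr2)
  refine hr6.trans ((le_trans ?_ (hE z₀ hz₀)))
  refine mul_le_mul_of_nonneg_left ?_ (by norm_num)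
  rw [realAct_isometry hiso', ← neg_mul_neg, ← abs_of_neg hr5, ← abs_of_neg hr2, hactg]
  simp only [map_smul, LinearMap.smul_apply, smul_eq_mul, abs_mul, hτη, hta, one_mul]
  rw [hz₀n]
  exact mul_le_mul_of_nonneg_right hxq (abs_nonneg _)

end QuadLattice

/-! ### Generic base points. -/

namespace Minkowski

variable {W : Type*} [AddCommGroup W] [Module ℝ W] {β : LinearMap.BilinForm ℝ W}
  {e : Module.Basis (Fin 3) ℝ W}

/-- There are points of the hyperbolic plane off countably many lines. -/
theorem IsLorentzBasis.exists_off (he : IsLorentzBasis β e) {U : Set W} (hU : U.Countable)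
    (hU0 : ∀ u ∈ U, u ≠ 0) {p : W} (hp : β p p < 0) :
    ∃ o, β o o = -1 ∧ β o p < 0 ∧ ∀ u ∈ U, β u o ≠ 0 := by
  -- A curve that is time-like for `0 < t < 1` and meets each plane through the origin at finitely
  -- many `t`, the roots of a nonzero polynomial.
  let γ : ℝ → W := fun t => e 0 + (t / 2) • e 1 + (t ^ 2 / 2) • e 2
  have hγ : ∀ u t, β u (γ t) = -e.repr u 0 + e.repr u 1 / 2 * t + e.repr u 2 / 2 * t ^ 2 := by
    intro u t
    simp only [γ, he _ _, map_add, map_smul, Finsupp.add_apply, Finsupp.smul_apply,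
      Module.Basis.repr_self, smul_eq_mul]
    simp
    ring
  have hγγ : ∀ t, β (γ t) (γ t) = -1 + t ^ 2 / 4 + t ^ 4 / 4 := by
    intro t
    rw [hγ]
    simp only [γ, map_add, map_smul, Finsupp.add_apply, Finsupp.smul_apply,
      Module.Basis.repr_self, smul_eq_mul]
    simp
    ring
  have hfin : ∀ u ∈ U, {t | β u (γ t) = 0}.Finite := by
    intro u hu
    open Polynomial in
    let P : ℝ[X] := C (-e.repr u 0) + C (e.repr u 1 / 2) * X + C (e.repr u 2 / 2) * X ^ 2
    have hP : P ≠ 0 := by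
      intro h
      have h0 := congrArg (fun q => Polynomial.coeff q 0) h
      have h1 := congrArg (fun q => Polynomial.coeff q 1) h
      have h2 := congrArg (fun q => Polynomial.coeff q 2) h
      simp [P, Polynomial.coeff_X, Polynomial.coeff_C] at h0 h1 h2
      apply hU0 u hu
      apply e.repr.injective
      ext i
      fin_cases i <;> simp [h0, h1, h2]
    refine (P.roots.toFinset.finite_toSet).subset fun t ht => ?_
    simp only [Finset.mem_coe, Multiset.mem_toFinset, Polynomial.mem_roots hP, Polynomial.IsRoot]
    have : β u (γ t) = 0 := ht
    rw [hγ] at this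
    simp only [P, Polynomial.eval_add, Polynomial.eval_mul, Polynomial.eval_C, Polynomial.eval_X,
      Polynomial.eval_pow]
    exact this
  obtain ⟨t, ht, htU⟩ : ∃ t ∈ Set.Ioo (0 : ℝ) 1, ∀ u ∈ U, β u (γ t) ≠ 0 := by
    by_contra! hcon
    have hc : (⋃ u ∈ U, {t | β u (γ t) = 0}).Countable :=
      hU.biUnion fun u hu => (hfin u hu).countable
    have h1 : (Set.Ioo (0 : ℝ) 1).Countable := hc.mono fun t ht => by
      obtain ⟨u, hu, h⟩ := hcon t ht
      exact Set.mem_biUnion hu h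
    exact absurd (Cardinal.Real.Ioo_countable_iff.mp h1) (by norm_num)
  have hneg : β (γ t) (γ t) < 0 := by
    rw [hγγ]
    have h1 : t ^ 2 ≤ 1 := pow_le_one₀ ht.1.le ht.2.le
    have h2 : t ^ 4 ≤ 1 := pow_le_one₀ ht.1.le ht.2.le
    linarith
  set c := Real.sqrt (-β (γ t) (γ t))⁻¹ with hc
  have hc2 : c ^ 2 = (-β (γ t) (γ t))⁻¹ := Real.sq_sqrt (inv_nonneg.mpr (by linarith))
  have hc0 : 0 < c := Real.sqrt_pos.mpr (inv_pos.mpr (by linarith))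
  obtain ⟨η, hη, hηp⟩ : ∃ η : ℝ, η ^ 2 = 1 ∧ η * β (γ t) p < 0 := by
    rcases lt_or_gt_of_ne (he.ne_zero_of_timelike hneg hp) with h | h
    · exact ⟨1, by norm_num, by linarith⟩
    · exact ⟨-1, by norm_num, by linarith⟩
  have hη0 : η ≠ 0 := by rintro rfl; simp at hη
  refine ⟨(η * c) • γ t, ?_, ?_, fun u hu => ?_⟩
  · simp only [map_smul, LinearMap.smul_apply, smul_eq_mul]
    have : η * c * (η * c * β (γ t) (γ t)) = η ^ 2 * (c ^ 2 * β (γ t) (γ t)) := by ring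
    rw [this, hη, hc2, one_mul, inv_neg, neg_mul, inv_mul_cancel₀ hneg.ne]
  · simp only [map_smul, LinearMap.smul_apply, smul_eq_mul]
    nlinarith
  · rw [map_smul, smul_eq_mul]
    exact mul_ne_zero (mul_ne_zero hη0 hc0.ne') (htU u hu)

end Minkowski

/-! ### Reflective lattices: cocompact reflection group and nonexistence. -/

namespace QuadLattice

open Minkowski QuadField

section

variable {F : Type*} [Field F] [Algebra F ℝ]
variable {V : Type*} [AddCommGroup V] [Module F V]
variable {B : LinearMap.BilinForm F V}

/-- Every root has a real multiple of norm `1`. -/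
theorem exists_unit_multiple {r : V} (hr : 0 < algebraMap F ℝ (B r r)) :
    ∃ c : ℝ, 0 < c ∧ realForm B (c • toReal r) (c • toReal r : RealSpace F V) = 1 := by
  refine ⟨Real.sqrt (algebraMap F ℝ (B r r))⁻¹, Real.sqrt_pos.mpr (inv_pos.mpr hr), ?_⟩
  rw [map_smul, map_smul, LinearMap.smul_apply, smul_eq_mul, smul_eq_mul, realForm_toReal,
    ← mul_assoc, ← pow_two, Real.sq_sqrt (inv_nonneg.mpr hr.le), inv_mul_cancel₀ hr.ne']

end

variable {F : Type*} [Field F] [NumberField F] [Algebra F ℝ]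
variable {V : Type*} [AddCommGroup V] [Module F V] [Module (𝓞 F) V] [IsScalarTower (𝓞 F) F V]
variable {B : LinearMap.BilinForm F V} {L : Submodule (𝓞 F) V} {p : RealSpace F V}
  {e : Module.Basis (Fin 3) ℝ (RealSpace F V)} {d : ℕ} {s : F} {σ : F ≃ₐ[ℚ] F} {ε : ℝ}
  {h : IsConj d s σ} {f : Module.Basis (Fin 3) F V} {m : ℤ}

theorem reflections_le (he : IsLorentzBasis (realForm B) e) (hB : B.IsSymm)
    (hp : realForm B p p < 0) : reflections B L ⊆ autGroup B L p := by
  rintro g ⟨r, hr, hg⟩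
  obtain ⟨g', hg', hgr⟩ := hr.exists_reflection he hB hp
  have : g = g' := LinearEquiv.ext fun v => by rw [hg, hgr]
  rw [this]
  exact hg'

theorem exists_unitRoot_of_mem_reflections {g : V ≃ₗ[F] V} (hg : g ∈ reflections B L) :
    ∃ u ∈ unitRoots B L, ∀ x, realAct g x = hypRefl (realForm B) u x := by
  obtain ⟨r, hr, hg⟩ := hg
  obtain ⟨c, -, hc⟩ := exists_unit_multiple (B := B) hr.2.1
  exact ⟨c • toReal r, ⟨hc, r, hr, c, rfl⟩, realAct_eq_refl hg hc rfl⟩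

/-- The elements of a group generated by reflections act as words in the reflections. -/
theorem exists_reflWord {S : Set (V ≃ₗ[F] V)} (hS : S ⊆ reflections B L) {g : V ≃ₗ[F] V}
    (hg : g ∈ Subgroup.closure S) : ∃ l : List (RealSpace F V), (∀ u ∈ l, u ∈ unitRoots B L) ∧
      ∀ x, realAct g x = reflWord (realForm B) l x := by
  induction hg using Subgroup.closure_induction_left with
  | one => exact ⟨[], by simp, fun x => realAct_one x⟩
  | mul_left g hg y _ ih =>
    obtain ⟨l, hl, hly⟩ := ih
    obtain ⟨u, hu, hgu⟩ := exists_unitRoot_of_mem_reflections (hS hg)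
    refine ⟨u :: l, by simpa using ⟨hu, hl⟩, fun x => ?_⟩
    rw [realAct_mul, hgu, hly]; rfl
  | inv_mul_cancel g hg y _ ih =>
    obtain ⟨l, hl, hly⟩ := ih
    obtain ⟨u, hu, hgu⟩ := exists_unitRoot_of_mem_reflections (hS hg)
    refine ⟨u :: l, by simpa using ⟨hu, hl⟩, fun x => ?_⟩
    have hinv : ∀ x, realAct g⁻¹ x = hypRefl (realForm B) u x := fun x => by
      conv_lhs => rw [← refl_refl (β := realForm B) hu.1 x, ← hgu]
      rw [realAct_inv_apply]
    rw [realAct_mul, hinv, hly]; rfl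

theorem isRootSystemAt_unitRoots (he : IsLorentzBasis (realForm B) e) (hB : B.IsSymm)
    (hp : realForm B p p < 0) (hε : ∀ v : V, v ≠ 0 → 0 < ε * algebraMap F ℝ (σ (B v v)))
    (hf : IsAdapted h B L f m) {o : RealSpace F V} (ho : realForm B o o = -1)
    (hoff : ∀ u ∈ unitRoots B L, realForm B u o ≠ 0) :
    IsRootSystemAt (realForm B) (unitRoots B L) o where
  sq _ hu := hu.1
  neg _ hu := unitRoots_neg hu
  refl _ hu _ ht := unitRoots_refl he hB hp hu ht
  finite := finite_unitRoots he hB hε hf ho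
  point := ho
  off := hoff

theorem countable_unitRoots (he : IsLorentzBasis (realForm B) e) (hB : B.IsSymm)
    (hε : ∀ v : V, v ≠ 0 → 0 < ε * algebraMap F ℝ (σ (B v v)))
    (hf : IsAdapted h B L f m) {o : RealSpace F V} (ho : realForm B o o = -1) :
    (unitRoots B L).Countable := by
  have : unitRoots B L = ⋃ n : ℕ, {u ∈ unitRoots B L | |realForm B u o| ≤ n} := by
    ext u
    simp only [Set.mem_iUnion]
    exact ⟨fun hu => (exists_nat_ge |realForm B u o|).imp fun n hn => ⟨hu, hn⟩, fun ⟨n, hn⟩ => hn.1⟩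
  rw [this]
  exact Set.countable_iUnion fun n => (finite_unitRoots he hB hε hf ho n).countable

/-- The reflection group of a reflective lattice acts cocompactly. -/
theorem IsReflective.cobounded (hL : IsReflective B L p) (he : IsLorentzBasis (realForm B) e)
    (hB : B.IsSymm) (hp : realForm B p p < 0)
    (hε : ∀ v : V, v ≠ 0 → 0 < ε * algebraMap F ℝ (σ (B v v)))
    (hf : IsAdapted h B L f m) {o : RealSpace F V} (ho : realForm B o o = -1)
    (hop : realForm B o p < 0) :
    ∃ D : ℝ, ∀ x, realForm B x x = -1 → realForm B x o < 0 → ∃ l : List (RealSpace F V),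
      (∀ u ∈ l, u ∈ unitRoots B L) ∧ -realForm B x (reflWord (realForm B) l o) ≤ D := by
  obtain ⟨S, -, hSr, hfin⟩ := hL
  obtain ⟨D, hD⟩ := autGroup_cobounded he hp hε hf ho
  have hon : realForm B o o < 0 := by rw [ho]; norm_num
  have hofut : o ∈ futureCone (realForm B) p := ⟨hon, hop⟩
  set H := (Subgroup.closure S).subgroupOf (autGroup B L p) with hH
  have hHf : H.FiniteIndex := Subgroup.IsFiniteRelIndex.to_finiteIndex_subgroupOf
  have hQ : Finite (autGroup B L p ⧸ H) := Subgroup.finite_quotient_of_finiteIndex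
  let k : autGroup B L p ⧸ H → V ≃ₗ[F] V := fun q => ((q.out : autGroup B L p) : V ≃ₗ[F] V)
  obtain ⟨E, hE⟩ := (Set.finite_range fun q =>
    -realForm B (realAct (k q)⁻¹ o) o).bddAbove
  refine ⟨2 * (D * E), fun x hx hxo => ?_⟩
  obtain ⟨g, hg, -, hgD⟩ := hD x hx hxo
  set q : autGroup B L p ⧸ H := QuotientGroup.mk (⟨g, hg⟩⁻¹ : autGroup B L p)
  have hkq : k q ∈ autGroup B L p := (q.out).2
  -- Since `k q` runs through finitely many coset representatives, `g o` is within bounded distance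
  -- of `δ o`, where `δ` is a product of reflections.
  obtain ⟨δ, hδ, hgδ⟩ : ∃ δ ∈ Subgroup.closure S, g = δ * (k q)⁻¹ := by
    have h1 : (q.out)⁻¹ * (⟨g, hg⟩⁻¹ : autGroup B L p) ∈ H := by
      rw [← QuotientGroup.eq]; exact Quotient.out_eq' q
    have h2 : (k q)⁻¹ * g⁻¹ ∈ Subgroup.closure S := h1
    refine ⟨_, inv_mem h2, ?_⟩
    group
  have hδm : δ ∈ autGroup B L p :=
    (Subgroup.closure_le _).mpr (hSr.trans (reflections_le he hB hp)) hδ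
  obtain ⟨l, hl, hlδ⟩ := exists_reflWord hSr hδ
  refine ⟨l, hl, ?_⟩
  rw [← hlδ]
  have hxfut : realForm B x p < 0 := by
    refine he.neg_of_future hon (by rw [hx]; norm_num) hp hxo ?_
    rw [he.symm]; exact hop
  have hgo := (future_of_mem_autGroup hg).mpr hofut
  have hδo := (future_of_mem_autGroup hδm).mpr hofut
  have hko := (future_of_mem_autGroup (inv_mem hkq)).mpr hofut
  have h1 : realForm B x (realAct g o) < 0 :=
    he.neg_of_future hp (by rw [hx]; norm_num) hgo.1 hxfut hgo.2
  have h3 : realForm B (realAct g o) (realAct δ o) = realForm B (realAct (k q)⁻¹ o) o := by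
    rw [hgδ, realAct_mul, realAct_isometry hδm.1]
  have h2 : realForm B (realAct g o) (realAct δ o) < 0 :=
    he.neg_of_future hp hgo.1 hδo.1 hgo.2 hδo.2
  have h4 := he.triangle hx (y := realAct g o) (z := realAct δ o)
    (by rw [realAct_isometry hg.1, ho]) (by rw [realAct_isometry hδm.1, ho]) h1 h2
  refine h4.trans ?_
  have h5 : -realForm B (realAct (k q)⁻¹ o) o ≤ E := hE ⟨q, rfl⟩
  rw [h3] at h2 ⊢
  have h6 : -realForm B x (realAct g o) * -realForm B (realAct (k q)⁻¹ o) o ≤ D * E :=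
    mul_le_mul hgD h5 (by linarith) (by linarith)
  linarith

theorem ne_of_vol_ne_zero {W : Type*} [AddCommGroup W] [Module ℝ W]
    {e : Module.Basis (Fin 3) ℝ W} {a b c : W} (hv : vol e a b c ≠ 0) :
    (a ≠ b ∧ a ≠ -b) ∧ (b ≠ c ∧ b ≠ -c) ∧ (a ≠ c ∧ a ≠ -c) := by
  refine ⟨⟨?_, ?_⟩, ⟨?_, ?_⟩, ?_, ?_⟩ <;> rintro rfl <;> apply hv <;>
    simp only [vol, map_neg, Finsupp.neg_apply] <;> ring

/-- There are no reflective lattices over real quadratic fields of large discriminant. -/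
theorem not_isReflective (h : IsConj d s σ)
    (hd : 27935 < d ∨ ((d % 4 = 2 ∨ d % 4 = 3) ∧ 6983 < d))
    (he : IsLorentzBasis (realForm B) e) (hB : B.IsSymm) (hp : realForm B p p < 0)
    (hε : ∀ v : V, v ≠ 0 → 0 < ε * algebraMap F ℝ (σ (B v v)))
    (hf : IsAdapted h B L f m) : ¬ IsReflective B L p := by
  intro hL
  have h3 : Real.sqrt 3 ^ 2 = 3 := Real.sq_sqrt (by norm_num)
  have h30 : 0 ≤ Real.sqrt 3 := Real.sqrt_nonneg 3
  -- `M² = 13968 + 8064√3`, and this rational bound turns it into exactly `M² < 27936 = 4 · 6984`.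
  have h31 : Real.sqrt 3 < 97 / 56 := by nlinarith
  -- `M = 4(3 + 2√3)²`, from `short_bound` with `k = √3/2 = cos(π/6)`.
  set M : ℝ := 84 + 48 * Real.sqrt 3 with hM
  have hM4 : 4 ≤ M := by linarith
  have hM2 : M ^ 2 < 27936 := by nlinarith
  have hMd : M ^ 2 < d ∨ (d % 4 = 2 ∨ d % 4 = 3) ∧ M ^ 2 < 4 * d := by
    rcases hd with hd | ⟨h1, hd⟩
    · left
      have : (27936 : ℝ) ≤ d := by exact_mod_cast hd
      linarith
    · right
      have : (6984 : ℝ) ≤ d := by exact_mod_cast hd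
      exact ⟨h1, by linarith⟩
  -- A provisional point, needed only to see that there are countably many mirrors to avoid.
  obtain ⟨o₁, ho₁, -⟩ := he.exists_off (U := ∅) Set.countable_empty (by simp) hp
  obtain ⟨o, ho, hop, hoff⟩ := he.exists_off (countable_unitRoots he hB hε hf ho₁)
    (fun u hu h0 => by have := hu.1; rw [h0] at this; simp at this) hp
  obtain ⟨D, hD⟩ := hL.cobounded he hB hp hε hf ho hop
  obtain ⟨R, hRf, hRU, hRo, hRc⟩ :=
    he.exists_finite_cone (isRootSystemAt_unitRoots he hB hp hε hf ho hoff) hD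
  obtain ⟨a, ha, b, hb, c, hc, hvol, hac, hcb, y, hy, hay, hby⟩ :=
    he.exists_ear hRf ho (fun u hu => (hRU hu).1) hRo hRc
  obtain ⟨⟨hab1, hab2⟩, ⟨hbc1, hbc2⟩, hac1, hac2⟩ := ne_of_vol_ne_zero hvol
  -- Lines that cross have `4(a·c)² < 4 ≤ M`.
  have gac := gap h hB hε hM4 hMd (hRU ha) (hRU hc) hac1 hac2 (by linarith)
  have gbc := gap h hB hε hM4 hMd (hRU hb) (hRU hc) hbc1 hbc2 (by
    rw [he.symm b c]; linarith)
  have bound : ∀ x : ℝ, (∃ m : ℤ, 0 ≤ m ∧ m ≤ 3 ∧ 4 * x ^ 2 = m) → -x ≤ Real.sqrt 3 / 2 := by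
    rintro x ⟨m, -, hm3, hm⟩
    have : (m : ℝ) ≤ 3 := by exact_mod_cast hm3
    by_contra hcon
    push Not at hcon
    nlinarith
  have hcb' : -realForm B c b ≤ Real.sqrt 3 / 2 := by
    rw [he.symm]; exact bound _ gbc
  obtain ⟨k1, k2⟩ := he.short_bound (hRU ha).1 (hRU hb).1 (hRU hc).1 hy hay hby (bound _ gac) hcb'
  have gab := gap h hB hε hM4 hMd (hRU ha) (hRU hb) hab1 hab2 (by
    have : (3 + 2 * Real.sqrt 3 + realForm B a b) * (3 + 2 * Real.sqrt 3 - realForm B a b) ≥ 0 :=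
      mul_nonneg (by linarith) (by linarith)
    nlinarith)
  exact no_triangle h (by omega) hB hε he (hRU ha) (hRU hb) (hRU hc) hvol gab gbc gac

end QuadLattice

/-! ### Edges and corners of the cells of a locally finite family of lines. -/

namespace Minkowski

variable {W : Type*} [AddCommGroup W] [Module ℝ W] {β : LinearMap.BilinForm ℝ W}
  {e : Module.Basis (Fin 3) ℝ W}

/-- Three pairwise orthogonal non-null vectors have nonzero Gram determinant, so they span. This
serves to expand normals in orthogonal frames. -/
theorem IsLorentzBasis.eq_zero_of_orthogonal (he : IsLorentzBasis β e) {a b c v : W}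
    (ha : β a a ≠ 0) (hb : β b b ≠ 0) (hc : β c c ≠ 0) (hab : β a b = 0) (hac : β a c = 0)
    (hbc : β b c = 0) (hva : β v a = 0) (hvb : β v b = 0) (hvc : β v c = 0) : v = 0 := by
  have hg := he.gram a b c
  rw [hab, hac, hbc] at hg
  have hvol : vol e a b c ≠ 0 := by
    intro h0
    rw [h0] at hg
    apply mul_ne_zero (mul_ne_zero ha hb) hc
    linarith
  have hv := vol_smul_eq (e := e) a b c v
  have e1 := congrArg (fun x => β x a) hv
  have e2 := congrArg (fun x => β x b) hv
  have e3 := congrArg (fun x => β x c) hv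
  simp only [map_add, map_smul, LinearMap.add_apply, LinearMap.smul_apply, smul_eq_mul, hva, hvb,
    hvc, he.symm b a, he.symm c a, he.symm c b, hab, hac, hbc, mul_zero, add_zero, zero_add]
    at e1 e2 e3
  rw [(mul_eq_zero.mp e1.symm).resolve_right ha, (mul_eq_zero.mp e2.symm).resolve_right hb,
    (mul_eq_zero.mp e3.symm).resolve_right hc] at hv
  simpa [hvol] using hv

/-- The line through two points has only two unit normal vectors. -/
theorem IsLorentzBasis.eq_or_eq_neg (he : IsLorentzBasis β e) {n u x y : W} (hn : β n n = 1)
    (hu : β u u = 1) (hx : β x x = -1) (hy : β y y = -1) (hxy : β x y < 0) (hne : x ≠ y)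
    (hnx : β n x = 0) (hny : β n y = 0) (hux : β u x = 0) (huy : β u y = 0) : u = n ∨ u = -n := by
  have hyx := he.symm y x
  have hm : β (x + y) (x + y) < 0 := by
    simp only [map_add, LinearMap.add_apply, hx, hy, hyx]; linarith
  have hwm : β (x - y) (x + y) = 0 := by
    simp only [map_add, map_sub, LinearMap.sub_apply, hx, hy, hyx]; ring
  have hw := he.pos_of_orthogonal hm hwm (sub_ne_zero.mpr hne)
  have hv : u - β u n • n = 0 := by
    refine he.eq_zero_of_orthogonal (by rw [hn]; norm_num) hw.ne' hm.ne
      (by rw [map_sub, hnx, hny, sub_zero]) (by rw [map_add, hnx, hny, add_zero]) hwm ?_ ?_ ?_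
    · simp [hn]
    · simp [hux, huy, hnx, hny]
    · simp [hux, huy, hnx, hny]
  have hv' : u = β u n • n := sub_eq_zero.mp hv
  have hc : β u n * β u n = 1 := by
    have h1 := hu
    rw [hv'] at h1
    simpa [hn] using h1
  rcases mul_self_eq_one_iff.mp hc with h1 | h1
  · left; rw [hv', h1, one_smul]
  · right; rw [hv', h1, neg_one_smul]

/-- `P` is the cell that contains the point `x₀`, in the subdivision of the hyperbolic plane by the
lines with unit normal vectors in the locally finite set `U`. -/
structure IsCellOf (β : LinearMap.BilinForm ℝ W) (p : W) (U : Set W) (x₀ : W) (P : Set W) :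
    Prop where
  sq : ∀ u ∈ U, β u u = 1
  neg : ∀ u ∈ U, -u ∈ U
  finite : ∀ o, β o o = -1 → ∀ C, {u ∈ U | |β u o| ≤ C}.Finite
  base : x₀ ∈ hyperbolicPlane β p
  off : ∀ u ∈ U, β u x₀ ≠ 0
  mem_iff : ∀ x, x ∈ P ↔ x ∈ hyperbolicPlane β p ∧ ∀ u ∈ U, β u x₀ < 0 → β u x ≤ 0

namespace IsCellOf

variable {p x₀ : W} {U P : Set W}

theorem base_mem (hP : IsCellOf β p U x₀ P) : x₀ ∈ P :=
  (hP.mem_iff _).mpr ⟨hP.base, fun _ _ h => h.le⟩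

theorem sq_point (hP : IsCellOf β p U x₀ P) {x : W} (hx : x ∈ P) : β x x = -1 :=
  ((hP.mem_iff x).mp hx).1.1

theorem mul_neg (hP : IsCellOf β p U x₀ P) (he : IsLorentzBasis β e) (hp : β p p < 0) {x y : W}
    (hx : x ∈ P) (hy : y ∈ P) : β x y < 0 :=
  have h1 := ((hP.mem_iff x).mp hx).1.2
  have h2 := ((hP.mem_iff y).mp hy).1.2
  he.neg_of_future hp h1.1 h2.1 h1.2 h2.2

/-- A point off the mirrors and on the same side of all of them lies in the interior. -/
theorem exists_push (hP : IsCellOf β p U x₀ P) (he : IsLorentzBasis β e) (hp : β p p < 0)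
    {o n : W} (ho : β o o = -1) (hop : β o p < 0) (hn : β n n = 1) (hno : β n o = 0)
    (hU : ∀ u ∈ U, β u x₀ < 0 → β u o < 0) : ∃ z ∈ P, 0 < β n z := by
  have hle : ∀ u ∈ U, (β u n) ^ 2 ≤ 4 * (1 + β u o ^ 2) := fun u hu => by
    have := he.sq_le ho u n
    rw [hn, hno, hP.sq u hu] at this
    simpa using this
  -- By `hle`, `u·n ≤ 3` if `|u·o| ≤ 1`, and `u·n ≤ 3|u·o|` otherwise. So `t ≤ 1/3` handles all far
  -- mirrors, and only finitely many near ones restrict `t` further.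
  obtain ⟨t, ht0, ht1, ht⟩ : ∃ t : ℝ, 0 < t ∧ t ≤ 1 / 3 ∧
      ∀ u ∈ U, β u x₀ < 0 → |β u o| ≤ 1 → 3 * t ≤ -β u o := by
    have hf : {u | u ∈ U ∧ β u x₀ < 0 ∧ |β u o| ≤ 1}.Finite :=
      (hP.finite o ho 1).subset fun u hu => ⟨hu.1, hu.2.2⟩
    rcases Set.eq_empty_or_nonempty {u | u ∈ U ∧ β u x₀ < 0 ∧ |β u o| ≤ 1} with h0 | h0
    · exact ⟨1 / 3, by norm_num, le_rfl, fun u hu h1 h2 =>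
        (Set.eq_empty_iff_forall_notMem.mp h0 u ⟨hu, h1, h2⟩).elim⟩
    · obtain ⟨v, ⟨hv1, hv2, hv3⟩, hv⟩ := Set.exists_min_image _ (fun u => -β u o) hf h0
      have := hU v hv1 hv2
      refine ⟨-β v o / 3, by linarith, by linarith [neg_le_abs (β v o)], fun u hu h1 h2 => ?_⟩
      have := hv u ⟨hu, h1, h2⟩
      linarith
  have hon := he.symm o n
  have hz : β (o + t • n) (o + t • n) = -1 + t ^ 2 := by
    simp only [map_add, map_smul, LinearMap.add_apply, LinearMap.smul_apply, smul_eq_mul, ho, hn,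
      hno, hon]; ring
  have ht2 : t ^ 2 < 1 := by nlinarith
  have hzn : β (o + t • n) (o + t • n) < 0 := by rw [hz]; linarith
  have hzp : β (o + t • n) p < 0 := by
    refine he.neg_of_future (p := o) (by rw [ho]; norm_num) hzn hp ?_ (by rw [he.symm]; exact hop)
    simp only [map_add, map_smul, LinearMap.add_apply, LinearMap.smul_apply, smul_eq_mul, ho, hno]
    linarith
  set c := Real.sqrt (1 - t ^ 2)⁻¹ with hc
  have hc2 : c ^ 2 = (1 - t ^ 2)⁻¹ := Real.sq_sqrt (inv_nonneg.mpr (by linarith))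
  have hc0 : 0 < c := Real.sqrt_pos.mpr (inv_pos.mpr (by linarith))
  have hzz : β (c • (o + t • n)) (c • (o + t • n)) = -1 := by
    rw [map_smul, map_smul, LinearMap.smul_apply, smul_eq_mul, smul_eq_mul, hz, ← mul_assoc,
      ← pow_two, hc2]
    have : (1 - t ^ 2) ≠ 0 := by linarith
    field_simp
    ring
  refine ⟨c • (o + t • n), (hP.mem_iff _).mpr ⟨⟨hzz, by rw [hzz]; norm_num, ?_⟩, ?_⟩, ?_⟩
  · rw [map_smul, LinearMap.smul_apply, smul_eq_mul]
    exact mul_neg_of_pos_of_neg hc0 hzp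
  · intro u hu hux
    have h1 := hU u hu hux
    have h2 := hle u hu
    rw [map_smul, smul_eq_mul]
    refine mul_nonpos_of_nonneg_of_nonpos hc0.le ?_
    rw [map_add, map_smul, smul_eq_mul]
    rcases le_or_gt |β u o| 1 with h3 | h3
    · have h4 := ht u hu hux h3
      have h5 : β u o ^ 2 ≤ 1 := by rw [← sq_abs]; exact pow_le_one₀ (abs_nonneg _) h3
      have h6 : β u n ≤ 3 := by nlinarith
      nlinarith
    · have h4 : 1 < -β u o := by rwa [abs_of_neg h1] at h3
      have h5 : β u n ≤ 3 * -β u o := by nlinarith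
      nlinarith
  · rw [map_smul, smul_eq_mul, map_add, map_smul, smul_eq_mul, hno, hn]
    positivity

/-- The edges of a cell lie on mirrors. -/
theorem edge_mem (hP : IsCellOf β p U x₀ P) (he : IsLorentzBasis β e) (hp : β p p < 0) {n : W}
    (hn : n ∈ edges β P) : n ∈ U := by
  obtain ⟨hn1, hnP, x, hx, y, hy, hxy, hnx, hny⟩ := hn
  have hx1 := hP.sq_point hx
  have hy1 := hP.sq_point hy
  have hneg := hP.mul_neg he hp hx hy
  have hm : β (x + y) (x + y) = -2 + 2 * β x y := by
    simp only [map_add, LinearMap.add_apply, hx1, hy1, he.symm y x]; ring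
  -- A mirror through the midpoint of `x` and `y` contains both, as neither is on its positive side.
  -- Without such a mirror, `P` would extend beyond the edge.
  by_cases hZ : ∃ u ∈ U, β u x₀ < 0 ∧ β u (x + y) = 0
  · obtain ⟨u, hu, hux, hum⟩ := hZ
    have h1 := ((hP.mem_iff x).mp hx).2 u hu hux
    have h2 := ((hP.mem_iff y).mp hy).2 u hu hux
    rw [map_add] at hum
    rcases he.eq_or_eq_neg (hP.sq u hu) hn1 hx1 hy1 hneg hxy (by linarith) (by linarith) hnx hny
      with h3 | h3
    · rw [h3]; exact hu
    · rw [h3]; exact hP.neg u hu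
  · exfalso
    push Not at hZ
    set c := Real.sqrt (-β (x + y) (x + y))⁻¹ with hc
    have hmm : β (x + y) (x + y) < 0 := by rw [hm]; linarith
    have hc2 : c ^ 2 = (-β (x + y) (x + y))⁻¹ := Real.sq_sqrt (inv_nonneg.mpr (by linarith))
    have hc0 : 0 < c := Real.sqrt_pos.mpr (inv_pos.mpr (by linarith))
    have hxp := ((hP.mem_iff x).mp hx).1.2.2
    have hyp := ((hP.mem_iff y).mp hy).1.2.2
    obtain ⟨z, hz, hnz⟩ := hP.exists_push he hp (o := c • (x + y)) (n := n) (by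
        rw [map_smul, map_smul, LinearMap.smul_apply, smul_eq_mul, smul_eq_mul, ← mul_assoc,
          ← pow_two, hc2, inv_neg, neg_mul, inv_mul_cancel₀ hmm.ne]) (by
        rw [map_smul, LinearMap.smul_apply, smul_eq_mul, map_add, LinearMap.add_apply]
        exact mul_neg_of_pos_of_neg hc0 (by linarith)) hn1 (by simp [hnx, hny]) (by
        intro u hu hux
        rw [map_smul, smul_eq_mul]
        refine mul_neg_of_pos_of_neg hc0 (lt_of_le_of_ne ?_ (hZ u hu hux))
        have h1 := ((hP.mem_iff x).mp hx).2 u hu hux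
        have h2 := ((hP.mem_iff y).mp hy).2 u hu hux
        rw [map_add]; linarith)
    exact absurd (hnP z hz) (not_le.mpr hnz)

theorem edge_base_neg (hP : IsCellOf β p U x₀ P) (he : IsLorentzBasis β e) (hp : β p p < 0) {n : W}
    (hn : n ∈ edges β P) : β n x₀ < 0 :=
  lt_of_le_of_ne (hn.2.1 _ hP.base_mem) (hP.off _ (hP.edge_mem he hp hn))

/-- Two edges have at most one common point. -/
theorem edge_neg (hP : IsCellOf β p U x₀ P) (he : IsLorentzBasis β e) (hp : β p p < 0) {n u x y : W}
    (hn : n ∈ edges β P) (hu : u ∈ edges β P) (hne : n ≠ u) (hx : x ∈ P) (hy : y ∈ P) (hxy : x ≠ y)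
    (hnx : β n x = 0) (hux : β u x = 0) (hny : β n y = 0) : β u y < 0 := by
  refine lt_of_le_of_ne (hu.2.1 y hy) fun huy => ?_
  rcases he.eq_or_eq_neg hn.1 hu.1 (hP.sq_point hx) (hP.sq_point hy) (hP.mul_neg he hp hx hy) hxy
    hnx hny hux huy with h | h
  · exact hne h.symm
  · have h1 := hP.edge_base_neg he hp hn
    have h2 := hP.edge_base_neg he hp hu
    rw [h, map_neg, LinearMap.neg_apply] at h2
    linarith

theorem exists_ne_of_edge {n : W} (hn : n ∈ edges β P) (x : W) : ∃ v ∈ P, x ≠ v ∧ β n v = 0 := by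
  obtain ⟨-, -, y, hy, z, hz, hyz, hny, hnz⟩ := hn
  by_cases h : x = y
  · exact ⟨z, hz, h ▸ hyz, hnz⟩
  · exact ⟨y, hy, h, hny⟩

/-- At a right-angled corner there is no third edge. -/
theorem edge_eq_of_corner (hP : IsCellOf β p U x₀ P) (he : IsLorentzBasis β e) (hp : β p p < 0)
    {R S l x y : W} (hR : IsCorner β P R S x) (hRS : β R S = 0) (hy : y ∈ P) (hxy : x ≠ y)
    (hSy : β S y = 0) (hl : IsCorner β P l S x) : l = R := by
  obtain ⟨hRe, hSe, hRSne, hx, hRx, hSx⟩ := hR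
  obtain ⟨hle, -, hlS, -, hlx, -⟩ := hl
  by_contra hlR
  -- All three normals lie in `x^⊥`, where `R`, `S` are orthonormal. Points on the edges `S` and `R`
  -- make both coefficients of `l` positive, so `l` is negative at the other points of its own edge.
  have hexp : l - β l R • R - β l S • S = 0 := by
    refine he.eq_zero_of_orthogonal (a := R) (b := S) (c := x) (by rw [hRe.1]; norm_num)
      (by rw [hSe.1]; norm_num) (by rw [hP.sq_point hx]; norm_num) hRS hRx hSx ?_ ?_ ?_
    · simp [hRe.1, he.symm S R, hRS]
    · simp [hSe.1, hRS]
    · simp [hRx, hSx, hlx]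
  have hlv : ∀ v, β l v = β l R * β R v + β l S * β S v := fun v => by
    have := congrArg (fun w => β w v) hexp
    simp only [map_sub, map_smul, LinearMap.sub_apply, LinearMap.smul_apply, smul_eq_mul, map_zero,
      LinearMap.zero_apply] at this
    linarith
  have h1 : β l y < 0 := hP.edge_neg he hp hSe hle hlS.symm hx hy hxy hSx hlx hSy
  have h2 : β R y < 0 := hP.edge_neg he hp hSe hRe hRSne.symm hx hy hxy hSx hRx hSy
  have ha : 0 < β l R := by
    rw [hlv, hSy, mul_zero, add_zero] at h1
    exact (pos_iff_neg_of_mul_neg h1).mpr h2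
  obtain ⟨v, hv, hxv, hRv⟩ := exists_ne_of_edge hRe x
  have h3 : β S v < 0 := hP.edge_neg he hp hRe hSe hRSne hx hv hxv hRx hSx hRv
  have h4 : β l v < 0 := hP.edge_neg he hp hRe hle (Ne.symm hlR) hx hv hxv hRx hlx hRv
  have hb : 0 < β l S := by
    rw [hlv, hRv, mul_zero, zero_add] at h4
    exact (pos_iff_neg_of_mul_neg h4).mpr h3
  obtain ⟨w, hw, hxw, hlw⟩ := exists_ne_of_edge hle x
  have h5 : β R w < 0 := hP.edge_neg he hp hle hRe hlR hx hw hxw hlx hRx hlw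
  have h6 : β S w ≤ 0 := hSe.2.1 w hw
  rw [hlv] at hlw
  nlinarith [mul_neg_of_pos_of_neg ha h5, mul_nonpos_of_nonneg_of_nonpos hb.le h6]

/-- The corners on an edge are its two endpoints. -/
theorem corner_eq (hP : IsCellOf β p U x₀ P) (he : IsLorentzBasis β e) (hp : β p p < 0)
    {R S T l x y z : W} (hR : IsCorner β P R S x) (hT : IsCorner β P T S y) (hxy : x ≠ y)
    (hRS : β R S = 0) (hTS : β T S = 0) (hl : IsCorner β P l S z) :
    (z = x ∧ l = R) ∨ (z = y ∧ l = T) := by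
  obtain ⟨hRe, hSe, hRSne, hx, hRx, hSx⟩ := id hR
  obtain ⟨hTe, -, hTSne, hy, hTy, hSy⟩ := id hT
  obtain ⟨hle, -, hlS, hz, hlz, hSz⟩ := id hl
  have hx1 := hP.sq_point hx
  have hy1 := hP.sq_point hy
  have hz1 := hP.sq_point hz
  have hRy : β R y < 0 := hP.edge_neg he hp hSe hRe hRSne.symm hx hy hxy hSx hRx hSy
  have hTx : β T x < 0 := hP.edge_neg he hp hSe hTe hTSne.symm hy hx hxy.symm hSy hTy hSx
  -- These are the coefficients of `z = a x + b y`. If both were positive, `l` would vanish at `x`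
  -- and at `y` and so be the same edge as `S`.
  obtain ⟨a, ha⟩ : ∃ a, a = β T z / β T x := ⟨_, rfl⟩
  obtain ⟨b, hb⟩ : ∃ b, b = β R z / β R y := ⟨_, rfl⟩
  have ha0 : 0 ≤ a := by rw [ha]; exact div_nonneg_of_nonpos (hTe.2.1 z hz) hTx.le
  have hb0 : 0 ≤ b := by rw [hb]; exact div_nonneg_of_nonpos (hRe.2.1 z hz) hRy.le
  have haT : a * β T x = β T z := by rw [ha]; exact div_mul_cancel₀ _ hTx.ne
  have hbR : b * β R y = β R z := by rw [hb]; exact div_mul_cancel₀ _ hRy.ne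
  obtain ⟨v, hv⟩ : ∃ v, v = z - a • x - b • y := ⟨_, rfl⟩
  have hRv : β R v = 0 := by
    rw [hv]; simp only [map_sub, map_smul, smul_eq_mul, hRx]; linarith
  have hTv : β T v = 0 := by
    rw [hv]; simp only [map_sub, map_smul, smul_eq_mul, hTy]; linarith
  have hSv : β S v = 0 := by
    rw [hv]; simp only [map_sub, map_smul, smul_eq_mul, hSx, hSy, hSz]; ring
  have hvx : v + β v x • x = 0 := by
    refine he.eq_zero_of_orthogonal (a := R) (b := S) (c := x) (by rw [hRe.1]; norm_num)
      (by rw [hSe.1]; norm_num) (by rw [hx1]; norm_num) hRS hRx hSx ?_ ?_ ?_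
    · simp [he.symm v R, hRv, he.symm x R, hRx]
    · simp [he.symm v S, hSv, he.symm x S, hSx]
    · simp [hx1]
  have hv0 : v = 0 := by
    have h1 := congrArg (β T) hvx
    simp only [map_add, map_smul, smul_eq_mul, hTv, zero_add, map_zero] at h1
    rwa [(mul_eq_zero.mp h1).resolve_right hTx.ne, zero_smul, add_zero] at hvx
  have hzxy : z = a • x + b • y := by
    rw [hv0] at hv
    have := sub_eq_zero.mp (sub_sub z _ _ ▸ hv.symm)
    exact this
  have hlx := hle.2.1 x hx
  have hly := hle.2.1 y hy
  have hl0 : a * β l x + b * β l y = 0 := by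
    rw [hzxy] at hlz
    simpa using hlz
  have hpoint : ∀ {c : ℝ} {w : W}, 0 ≤ c → β w w = -1 → z = c • w → z = w := by
    intro c w hc hw hzw
    have h1 := hz1
    rw [hzw] at h1
    simp only [map_smul, LinearMap.smul_apply, smul_eq_mul, hw] at h1
    have : c = 1 := by nlinarith
    rw [hzw, this, one_smul]
  rcases ha0.eq_or_lt with h0 | hapos
  · right
    have hzy : z = y := hpoint hb0 hy1 (by rw [hzxy, ← h0, zero_smul, zero_add])
    rw [hzy] at hl
    exact ⟨hzy, hP.edge_eq_of_corner he hp hT hTS hx hxy.symm hSx hl⟩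
  rcases hb0.eq_or_lt with h0 | hbpos
  · left
    have hzx : z = x := hpoint ha0 hx1 (by rw [hzxy, ← h0, zero_smul, add_zero])
    rw [hzx] at hl
    exact ⟨hzx, hP.edge_eq_of_corner he hp hR hRS hy hxy hSy hl⟩
  exfalso
  have h1 := mul_nonpos_of_nonneg_of_nonpos hapos.le hlx
  have h2 := mul_nonpos_of_nonneg_of_nonpos hbpos.le hly
  have h3 : β l x = 0 := by nlinarith
  have h4 : β l y = 0 := by nlinarith
  have h5 := hP.edge_neg he hp hle hSe hlS hx hy hxy h3 hSx h4
  linarith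

/-- The neighbors of a short edge that is orthogonal to both of them are ultraparallel or tangent,
with a bounded inner product. -/
theorem short_edge (hP : IsCellOf β p U x₀ P) (he : IsLorentzBasis β e) (hp : β p p < 0)
    {R S T x y : W} (hR : IsCorner β P R S x) (hT : IsCorner β P S T y) (hxy : x ≠ y)
    (hRS : β R S = 0) (hST : β S T = 0) (hS : IsShortEdge β p P S) :
    R ∈ U ∧ T ∈ U ∧ R ≠ T ∧ R ≠ -T ∧ 1 ≤ β R T ^ 2 ∧ β R T ^ 2 ≤ 9 := by
  have hTS : β T S = 0 := by rw [he.symm]; exact hST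
  have flip : ∀ {m n z}, IsCorner β P m n z → IsCorner β P n m z :=
    fun ⟨h1, h2, h3, h4, h5, h6⟩ => ⟨h2, h1, h3.symm, h4, h6, h5⟩
  have hT' := flip hT
  obtain ⟨hRe, hSe, hRSne, hx, hRx, hSx⟩ := id hR
  obtain ⟨hTe, -, hTSne, hy, hTy, hSy⟩ := id hT'
  have hRy : β R y < 0 := hP.edge_neg he hp hSe hRe hRSne.symm hx hy hxy hSx hRx hSy
  have hTx : β T x < 0 := hP.edge_neg he hp hSe hTe hTSne.symm hy hx hxy.symm hSy hTy hSx
  have hRTne : R ≠ T := by rintro rfl; linarith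
  have hRTne' : R ≠ -T := by rintro rfl; simp at hRx; linarith
  refine ⟨hP.edge_mem he hp hRe, hP.edge_mem he hp hTe, hRTne, hRTne', ?_, ?_⟩
  -- In the orthogonal frame `R`, `S`, `x`, with `S·T = 0`, the norm of `T` reads `1 = (R·T)² -
  -- (T·x)²`.
  · have hexp : T - β T R • R + β T x • x = 0 := by
      refine he.eq_zero_of_orthogonal (a := R) (b := S) (c := x) (by rw [hRe.1]; norm_num)
        (by rw [hSe.1]; norm_num) (by rw [hP.sq_point hx]; norm_num) hRS hRx hSx ?_ ?_ ?_
      · simp [hRe.1, he.symm x R, hRx]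
      · simp [hTS, hRS, he.symm x S, hSx]
      · simp [hRx, hP.sq_point hx]
    have h1 := congrArg (β T) hexp
    simp only [map_add, map_sub, map_smul, smul_eq_mul, map_zero, hTe.1] at h1
    rw [he.symm R T]
    nlinarith [sq_nonneg (β T x)]
  -- The only corners on `S` are `x` and `y`, so the bisectors that meet are those with `R` and with
  -- `T`. Then `short_bound` with `k = 0` gives `|R·T| ≤ 3`.
  · obtain ⟨q, hq, h1, h2⟩ : ∃ q, β q q < 0 ∧ β R q = β S q ∧ β T q = β S q := by
      obtain ⟨l, n, x', y', hl, hn, hxy', q, ⟨hq, hlq, -⟩, -, hnq, -⟩ := hS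
      have hqq : β q q < 0 := hq.2.1
      rcases hP.corner_eq he hp hR hT' hxy hRS hTS hl with ⟨h1, h2⟩ | ⟨h1, h2⟩ <;>
      rcases hP.corner_eq he hp hR hT' hxy hRS hTS (flip hn) with ⟨h3, h4⟩ | ⟨h3, h4⟩
      · exact absurd (h1.trans h3.symm) hxy'
      · exact ⟨q, hqq, h2 ▸ hlq, h4 ▸ hnq.symm⟩
      · exact ⟨q, hqq, h4 ▸ hnq.symm, h2 ▸ hlq⟩
      · exact absurd (h1.trans h3.symm) hxy'
    obtain ⟨h3, h4⟩ := he.short_bound hRe.1 hTe.1 hSe.1 hq (h1.trans h2.symm) h2 (k := 0)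
      (by rw [hRS]; simp) (by rw [hST]; simp)
    nlinarith

end IsCellOf

end Minkowski

/-! ### Short edges of the chambers. -/

namespace QuadLattice

open Minkowski QuadField

variable {F : Type*} [Field F] [NumberField F] [Algebra F ℝ]
variable {V : Type*} [AddCommGroup V] [Module F V] [Module (𝓞 F) V] [IsScalarTower (𝓞 F) F V]
variable {B : LinearMap.BilinForm F V} {L : Submodule (𝓞 F) V} {p : RealSpace F V}
  {e : Module.Basis (Fin 3) ℝ (RealSpace F V)} {d : ℕ} {s : F} {σ : F ≃ₐ[ℚ] F} {ε : ℝ}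
  {h : IsConj d s σ} {f : Module.Basis (Fin 3) F V} {m : ℤ} {P : Set (RealSpace F V)}

theorem IsChamber.exists_isCellOf (hP : IsChamber B L p P) (he : IsLorentzBasis (realForm B) e)
    (hB : B.IsSymm) (hε : ∀ v : V, v ≠ 0 → 0 < ε * algebraMap F ℝ (σ (B v v)))
    (hf : IsAdapted h B L f m) : ∃ x₀, IsCellOf (realForm B) p (unitRoots B L) x₀ P := by
  obtain ⟨x₀, hx₀, hoff, rfl⟩ := hP
  have hpair : ∀ (c : ℝ) (r : V) (x : RealSpace F V),
      realForm B (c • toReal r) x = c * realForm B (toReal r) x := fun c r x => by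
    rw [map_smul, LinearMap.smul_apply, smul_eq_mul]
  refine ⟨x₀, ⟨fun u hu => hu.1, fun u hu => unitRoots_neg hu, fun o ho C =>
    finite_unitRoots he hB hε hf ho C, hx₀, ?_, fun x => ⟨?_, ?_⟩⟩⟩
  · rintro u ⟨hu, r, hr, c, rfl⟩
    rw [hpair]
    exact mul_ne_zero (unit_ne_zero hu rfl).1 (hoff r hr)
  · rintro ⟨hx, hxr⟩
    refine ⟨hx, ?_⟩
    rintro u ⟨hu, r, hr, c, rfl⟩ hneg
    have h1 := hxr r hr
    have h2 : 0 ≤ realForm B (c • toReal r) x * realForm B (c • toReal r) x₀ := by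
      rw [hpair, hpair]
      nlinarith [mul_nonneg (sq_nonneg c) h1]
    by_contra hcon
    push Not at hcon
    exact absurd h2 (not_le.mpr (mul_neg_of_pos_of_neg hcon hneg))
  · rintro ⟨hx, hxu⟩
    refine ⟨hx, fun r hr => ?_⟩
    obtain ⟨c, hc, hu⟩ := exists_unit_multiple (B := B) hr.2.1
    have hu' : (c • toReal r : RealSpace F V) ∈ unitRoots B L := ⟨hu, r, hr, c, rfl⟩
    rcases lt_or_gt_of_ne (hoff r hr) with h1 | h1
    · have h2 := hxu _ hu' (by rw [hpair]; exact mul_neg_of_pos_of_neg hc h1)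
      rw [hpair] at h2
      exact mul_nonneg_of_nonpos_of_nonpos (nonpos_of_mul_nonpos_right h2 hc) h1.le
    · have h2 := hxu _ (unitRoots_neg hu') (by
        rw [map_neg, LinearMap.neg_apply, hpair]
        linarith [mul_pos hc h1])
      rw [map_neg, LinearMap.neg_apply, hpair] at h2
      exact mul_nonneg (nonneg_of_mul_nonneg_right (by linarith) hc) h1.le

/-- A short edge of a chamber is not orthogonal to both its neighbors, if the discriminant is
large. -/
theorem IsChamber.not_orthogonal (h : IsConj d s σ)
    (hd : 1296 < d ∨ ((d % 4 = 2 ∨ d % 4 = 3) ∧ 324 < d)) (hP : IsChamber B L p P)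
    (he : IsLorentzBasis (realForm B) e) (hB : B.IsSymm) (hp : realForm B p p < 0)
    (hε : ∀ v : V, v ≠ 0 → 0 < ε * algebraMap F ℝ (σ (B v v)))
    (hf : IsAdapted h B L f m) {R S T x y : RealSpace F V}
    (hR : IsCorner (realForm B) P R S x) (hT : IsCorner (realForm B) P S T y) (hxy : x ≠ y)
    (hS : IsShortEdge (realForm B) p P S) (hRS : realForm B R S = 0) :
    realForm B S T ≠ 0 := by
  intro hST
  obtain ⟨x₀, hcell⟩ := hP.exists_isCellOf he hB hε hf
  obtain ⟨hRU, hTU, hne, hne', h1, h9⟩ := hcell.short_edge he hp hR hT hxy hRS hST hS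
  -- `M = 4 · 3²`, so `M² = 1296 = 4 · 324`. The outcome `4(R·T)² ≤ 3` contradicts `(R·T)² ≥ 1`.
  obtain ⟨k, -, hk3, hk⟩ := gap h hB hε (M := 36) (by norm_num) (by
    rcases hd with hd | ⟨hd4, hd⟩
    · left
      have : (1296 : ℝ) < d := by exact_mod_cast hd
      linarith
    · right
      have : (324 : ℝ) < d := by exact_mod_cast hd
      exact ⟨hd4, by linarith⟩) hRU hTU hne hne' (by linarith)
  have : (k : ℝ) ≤ 3 := by exact_mod_cast hk3
  linarith

end QuadLattice

/-! ### The theorem. -/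

theorem theorem3
    (d : ℕ) (hd0 : 0 < d) (hd : Squarefree d)
    (F : Type*) [Field F] [NumberField F]
    (s : F) (hs : s ^ 2 = (d : F)) (hF : ℚ⟮s⟯ = ⊤)
    [IsPrincipalIdealRing (𝓞 F)] [Algebra F ℝ]
    (V : Type*) [AddCommGroup V] [Module F V] [Module (𝓞 F) V] [IsScalarTower (𝓞 F) F V]
    (B : LinearMap.BilinForm F V) (hB : B.IsSymm)
    (hsig : Minkowski.HasSignatureTwoOne (QuadLattice.realForm B))
    (harith : QuadLattice.IsArithmetic B)
    (L : Submodule (𝓞 F) V) [Submodule.IsLattice F L]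
    (p : QuadLattice.RealSpace F V) (hp : QuadLattice.realForm B p p < 0) :
    ((27935 < d ∨ ((d % 4 = 2 ∨ d % 4 = 3) ∧ 6983 < d)) →
      ¬ QuadLattice.IsReflective B L p) ∧
    ((1296 < d ∨ ((d % 4 = 2 ∨ d % 4 = 3) ∧ 324 < d)) →
      QuadLattice.IsReflective B L p →
      ∀ P : Set (QuadLattice.RealSpace F V), QuadLattice.IsChamber B L p P →
        ¬ Minkowski.HasShortPair (QuadLattice.realForm B) p P ∧
        ¬ Minkowski.HasClosePair (QuadLattice.realForm B) p P) := by
  obtain ⟨e, he⟩ := hsig.exists_isLorentzBasis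
  have hdim : Module.finrank F V = 3 := by
    rw [← Module.finrank_baseChange (R := ℝ), Module.finrank_eq_card_basis e, Fintype.card_fin]
  -- `d = 1`, where `F = ℚ` has no nontrivial conjugation, is excluded by all the thresholds.
  have key : 1 < d → ∃ (σ : F ≃ₐ[ℚ] F) (h : QuadField.IsConj d s σ) (ε : ℝ)
      (f : Module.Basis (Fin 3) F V) (m : ℤ),
      (∀ v : V, v ≠ 0 → 0 < ε * algebraMap F ℝ (σ (B v v))) ∧ QuadLattice.IsAdapted h B L f m := by
    intro hd1
    obtain ⟨σ, h⟩ := QuadField.exists_isConj hd hd1 hs hF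
    obtain ⟨ε, hε⟩ := harith.exists_sign h.ne_one
    obtain ⟨f, m, hf⟩ := QuadLattice.exists_isAdapted h hB hdim L
    exact ⟨σ, h, ε, f, m, hε, hf⟩
  refine ⟨fun hd' => ?_, fun hd' _ P hP => ?_⟩
  · obtain ⟨σ, h, ε, f, m, hε, hf⟩ := key (by omega)
    exact QuadLattice.not_isReflective h hd' he hB hp hε hf
  · obtain ⟨σ, h, ε, f, m, hε, hf⟩ := key (by omega)
    refine ⟨?_, ?_⟩
    -- A short edge `S` orthogonal to both its neighbors is already impossible; the condition on
    -- perpendicular bisectors plays no role.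
    · rintro ⟨-, R, S, T, -, x, y, -, hR, hT, -, hxy, -, hS, hRS, hST, -⟩
      exact hP.not_orthogonal h hd' he hB hp hε hf hR hT hxy hS hRS hST
    · rintro ⟨-, R, S, T, -, -, w, x, -, -, hR, hT, -, -, hwx, -, -, hS, -, -, hRS, hST, -⟩
      exact hP.not_orthogonal h hd' he hB hp hε hf hR hT hwx hS hRS hST
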